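/- **Setting.** RISC-U is the subset of 32- or 64-bit RISC-V with the instructions `lui`, `addi`, `ld`, `sd` (`lw`, `sw`), `add`, `sub`, `mul`, `divu`, `remu`, `sltu`, `beq`, `jal`, `jalr`, `ecall`. Let $R$ be any RISC-U binary on a machine with word size $w\in\{32,64\}$ (in particular, the binary that a C* compiler generates for a C* program $P$), given by its code of $|R|$ instructions, its entry point, its data, heap and stack segments, and the initial values of registers and memory words. Given allowances of $h$ further words of heap and $s$ further words of stack, let $m$ be the resulting total number of words of data, heap and stack, and let $B=B(R,h,s)$ be the BTOR2 model that BEATOR generates for $R$ when it models memory by a segmenting MMU and one $w$-bit state variable per memory word. The model $B$ has, besides, a state variable for each register, a one-bit program-counter flag for each instruction, kernel-mode state, input variables for the `read` system call, and `bad` lines for invalid system calls, non-zero exit codes, division by zero, unaligned memory access and segmentation faults (including memory accesses that exceed the allowances). In general, a BTOR2 model (in the subset BEATOR2) is a list of lines without forward references that defines, over bitvectors and arrays of bitvectors, constants, inputs, state variables with at most one `init` and exactly one `next` line each, the combinational operators `add`, `sub`, `mul`, `udiv`, `urem`, `and`, `not`, `inc`, `eq`, `neq`, `ult`, `ulte`,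 `ugt`, `ugte`, `uext`, `slice`, `ite`, `read`, `write`, and `bad` conditions. State variables without `init` have any initial value. An input $I$ gives a value to each input variable in each state. A bad state of $B$ is reachable on $I$ in at most $n$ state transitions if for some $k\le n$ there is a run of $k$ transitions from an initial state, reading $I$, to a state in which some `bad` condition holds. A QUBO model $Q$ is a quadratic polynomial function, with integer coefficients, of binary variables (qubits), stored as an offset and a sparse upper triangular matrix; some of its qubits are the bits of the input variables in each of the states $0,\dots,n$. $Q$ *evaluates to* $e$ on $I$ if $e$ is the minimum of $Q$ over all assignments of the qubits in which the input qubits have the values given by $I$. QUBOT translates $B$ and $n$ to a QUBO model $\mathrm{QUBOT}(B,n)$: it builds the duplicates $D_0,\dots,D_n$ of the combinational circuits of $B$ by bit-blasting each line to logic gates whose penalty functions are added up (with `udiv` and `urem` as constrained multiplications, and `read` and `write` by comparing the address with all addresses), substitutes initial values for state variables in $D_0$ and the outputs of $D_i$ for those in $D_{i+1}$, propagates constants at bit level, and constrains the disjunction of all `bad` conditions in all duplicates to $1$. Its time is the number of elementary steps of a random access machine (creating a qubit, adding a term, dispatching a gate, producing or copying a bit, accessing a table); the size of a QUBO model is the number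 of its qubits, terms and input-table entries. **Proposition.** (1) For every RISC-U binary $R$ and all $h,s$, the model $B=B(R,h,s)$ is a well-formed BTOR2 model, and for every $n\ge 0$ and every input $I$, a bad state of $B$ is reachable on $I$ in at most $n$ state transitions if and only if $\mathrm{QUBOT}(B,n)$ evaluates to $0$ on $I$. (2) More generally, for every well-formed BTOR2 model $B$ in the above subset and every $n\ge0$: the function $\mathrm{QUBOT}(B,n)$ is given by an upper triangular matrix over its qubits and takes no negative values; on every input $I$ it evaluates to some $e\ge 0$, and $e=0$ if and only if a bad state of $B$ is reachable on $I$ in at most $n$ state transitions. Hence there is an input $I$ on which a bad state of $B$ is reachable in at most $n$ state transitions if and only if $\mathrm{QUBOT}(B,n)$ takes the value $0$. (3) There is an absolute constant $C$ such that, for every well-formed $B$ and every $n$, both the time that QUBOT takes for $B$ and $n$ and the size of the generated model are at most $C\,(n+1)\,m_B\,w_B^2\,(|B|+1)$, where $|B|$ is the number of lines of $B$, $w_B\ge1$ is the largest bitvector width in $B$ and $m_B\ge1$ is the largest number of elements of an array in $B$. (4) There is an absolute constant $C$ such that, for all $R,h,s,n$, both the time that QUBOT takes for $B(R,h,s)$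 and $n$ and the size of the generated model are at most $C\,(n+1)\,(m+1)\,w^2\,(|R|+1)$. (5) Hence the translation takes $O(n^2)$ time and space: for every $R$ and every $a$ there is a constant $C$ such that, whenever $h+s\le a(n+1)$ (memory grows by a bounded number of words per state transition), both the time that QUBOT takes for $B(R,h,s)$ and $n$ and the size of the generated model are at most $C\,(n+1)^2$. -/

import Mathlib

namespace QA

/-! ## BTOR2 models (the BEATOR2 subset) -/

/-- A value type: bitvectors of width `w`, or arrays of `e`-bit words indexed by `k`-bit words. -/
inductive Srt where
  | bitvec (w : ℕ)
  | array (k e : ℕ)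
deriving DecidableEq

/-- The values of a sort. -/
abbrev Srt.Val : Srt → Type
  | .bitvec w => BitVec w
  | .array k e => BitVec k → BitVec e

/-- A node identifier. The lines of a model are numbered consecutively from `0`. -/
abbrev Nid := ℕ

/-- Binary operators on two words of the same width, with a result of that width. -/
inductive BinOp where
  | add | sub | mul | udiv | urem | and

/-- Binary operators on two words of the same width, with a one-bit result. -/
inductive CmpOp where
  | eq | neq | ult | ulte | ugt | ugte

/-- The lines of a BTOR2 model, except that sorts are written out instead of being lines of their
own. Where BTOR2 leaves the sorts of the operands implicit, they are written out, too. -/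
inductive Line where
  /-- the constant `c`, in two's complement, in `w` bits -/
  | constd (w : ℕ) (c : ℤ)
  /-- an operator on two `w`-bit operands, with `w`-bit result -/
  | binary (op : BinOp) (w : ℕ) (x y : Nid)
  /-- a comparison of two `w`-bit operands, with one-bit result -/
  | compare (op : CmpOp) (w : ℕ) (x y : Nid)
  /-- bitwise negation -/
  | not (w : ℕ) (x : Nid)
  /-- increment by one -/
  | inc (w : ℕ) (x : Nid)
  /-- unsigned extension of a `v`-bit operand by `b` bits -/
  | uext (v b : ℕ) (x : Nid)
  /-- the bits `l` to `u` of a `v`-bit operand -/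
  | slice (v u l : ℕ) (x : Nid)
  /-- if-then-else on words or arrays, with a one-bit condition `c` -/
  | ite (s : Srt) (c x y : Nid)
  /-- the element at index `idx` of an array -/
  | read (k e : ℕ) (mem idx : Nid)
  /-- the array `mem`, with the element at index `idx` replaced by `val` -/
  | write (k e : ℕ) (mem idx val : Nid)
  /-- a state variable -/
  | state (s : Srt)
  /-- an input variable, read anew in every state -/
  | input (w : ℕ)
  /-- the initial value of the state variable `st` is that of `val` -/
  | init (s : Srt) (st val : Nid)
  /-- a state transition updates the state variable `st` to the value of `val` -/
  | next (s : Srt) (st val : Nid)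
  /-- the states (with inputs) in which the one-bit `c` is `1` are bad -/
  | bad (c : Nid)

/-- A BTOR2 model: a list of lines. -/
abbrev Model := List Line

/-- The sort of the value that a line defines; `init`, `next` and `bad` define no value. -/
def Line.sort : Line → Option Srt
  | .constd w _ => some (.bitvec w)
  | .binary _ w _ _ => some (.bitvec w)
  | .compare _ _ _ _ => some (.bitvec 1)
  | .not w _ => some (.bitvec w)
  | .inc w _ => some (.bitvec w)
  | .uext v b _ => some (.bitvec (v + b))
  | .slice _ u l _ => some (.bitvec (u - l + 1))
  | .ite s _ _ _ => some s
  | .read _ e _ _ => some (.bitvec e)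
  | .write k e _ _ _ => some (.array k e)
  | .state s => some s
  | .input w => some (.bitvec w)
  | .init _ _ _ => none
  | .next _ _ _ => none
  | .bad _ => none

/-- The operands of a line, with the sorts that they must have. -/
def Line.operands : Line → List (Nid × Srt)
  | .constd _ _ => []
  | .binary _ w x y => [(x, .bitvec w), (y, .bitvec w)]
  | .compare _ w x y => [(x, .bitvec w), (y, .bitvec w)]
  | .not w x => [(x, .bitvec w)]
  | .inc w x => [(x, .bitvec w)]
  | .uext v _ x => [(x, .bitvec v)]
  | .slice v _ _ x => [(x, .bitvec v)]
  | .ite s c x y => [(c, .bitvec 1), (x, s), (y, s)]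
  | .read k e mem idx => [(mem, .array k e), (idx, .bitvec k)]
  | .write k e mem idx val => [(mem, .array k e), (idx, .bitvec k), (val, .bitvec e)]
  | .state _ => []
  | .input _ => []
  | .init s st val => [(st, s), (val, s)]
  | .next s st val => [(st, s), (val, s)]
  | .bad c => [(c, .bitvec 1)]

/-- Widths are positive. -/
def Srt.Positive : Srt → Prop
  | .bitvec w => 0 < w
  | .array k e => 0 < k ∧ 0 < e

/-- Is the line `init _ j v`? Then `some v`. -/
def Line.initOf (j : Nid) : Line → Option Nid
  | .init _ st v => if st = j then some v else none
  | _ => none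

/-- Is the line `next _ j v`? Then `some v`. -/
def Line.nextOf (j : Nid) : Line → Option Nid
  | .next _ st v => if st = j then some v else none
  | _ => none

/-- The conditions on a line of the model `B` that go beyond the sorts of its operands: a slice
stays within its operand, `init` and `next` refer to state variables, the initial value is defined
before the state variable, and a state variable has at most one `init` and exactly one `next`. -/
def Line.SideCondition (B : Model) (j : Nid) : Line → Prop
  | .slice v u l _ => l ≤ u ∧ u < v
  | .state _ => (B.filterMap (Line.initOf j)).length ≤ 1 ∧ (B.filterMap (Line.nextOf j)).length = 1
  | .init s st val => B[st]? = some (.state s) ∧ val < st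
  | .next s st _ => B[st]? = some (.state s)
  | _ => True

/-- Well-formed models. There are no forward references. -/
def Model.WF (B : Model) : Prop :=
  ∀ (j : Nid) (l : Line), B[j]? = some l →
    (∀ s, l.sort = some s → s.Positive) ∧
    (∀ x s, (x, s) ∈ l.operands → x < j ∧ (B[x]?).bind Line.sort = some s) ∧
    l.SideCondition B j

/-! ## Semantics of BTOR2 models -/

/-- A value together with its sort. -/
abbrev Value := (s : Srt) × s.Val

/-- The all-zero value of a sort. -/
def Srt.zero : (s : Srt) → s.Val
  | .bitvec w => 0#w
  | .array _ e => fun _ => 0#e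

/-- The value as one of sort `s`; used only where the sort of `v` is `s`. -/
def Value.as (v : Value) (s : Srt) : s.Val :=
  if h : v.1 = s then cast (congrArg Srt.Val h) v.2 else s.zero

/-- The value of line `x`. Lines that define no value count as one-bit zeros. -/
def valueAt (env : List Value) (x : Nid) : Value := env.getD x ⟨.bitvec 1, 0#1⟩

/-- The value of line `x`, of sort `s`. -/
def operand (env : List Value) (s : Srt) (x : Nid) : s.Val := (valueAt env x).as s

/-- `udiv` by zero has all bits set, and `urem` by zero is the dividend, as in SMT-LIB. -/
def BinOp.eval (op : BinOp) {w : ℕ} (x y : BitVec w) : BitVec w :=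
  match op with
  | .add => x + y
  | .sub => x - y
  | .mul => x * y
  | .udiv => if y = 0#w then BitVec.allOnes w else x / y
  | .urem => if y = 0#w then x else x % y
  | .and => x &&& y

def CmpOp.eval (op : CmpOp) {w : ℕ} (x y : BitVec w) : Bool :=
  match op with
  | .eq => decide (x = y)
  | .neq => decide (x ≠ y)
  | .ult => decide (x < y)
  | .ulte => decide (x ≤ y)
  | .ugt => decide (y < x)
  | .ugte => decide (y ≤ x)

/-- The value of a line, given those of all lines before it, when the state variables have the
values `σ` and the inputs the values `ι` (reduced modulo `2 ^ w` for an input of `w` bits). -/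
def Line.eval (σ : Nid → Value) (ι : Nid → ℕ) (env : List Value) : Line → Value
  | .constd w c => ⟨.bitvec w, BitVec.ofInt w c⟩
  | .binary op w x y => ⟨.bitvec w, op.eval (operand env (.bitvec w) x) (operand env (.bitvec w) y)⟩
  | .compare op w x y =>
      ⟨.bitvec 1, BitVec.ofBool (op.eval (operand env (.bitvec w) x) (operand env (.bitvec w) y))⟩
  | .not w x => ⟨.bitvec w, ~~~(operand env (.bitvec w) x)⟩
  | .inc w x => ⟨.bitvec w, (operand env (.bitvec w) x : BitVec w) + 1#w⟩
  | .uext v b x => ⟨.bitvec (v + b), BitVec.setWidth (v + b) (operand env (.bitvec v) x)⟩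
  | .slice v u l x => ⟨.bitvec (u - l + 1), BitVec.extractLsb u l (operand env (.bitvec v) x)⟩
  | .ite s c x y => ⟨s, if operand env (.bitvec 1) c = 1#1 then operand env s x else operand env s y⟩
  | .read k e mem idx => ⟨.bitvec e, operand env (.array k e) mem (operand env (.bitvec k) idx)⟩
  | .write k e mem idx val =>
      ⟨.array k e, fun a => if a = operand env (.bitvec k) idx then operand env (.bitvec e) val
        else operand env (.array k e) mem a⟩
  | .state s => ⟨s, (σ env.length).as s⟩
  | .input w => ⟨.bitvec w, BitVec.ofNat w (ι env.length)⟩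
  | .init _ _ _ => ⟨.bitvec 1, 0#1⟩
  | .next _ _ _ => ⟨.bitvec 1, 0#1⟩
  | .bad _ => ⟨.bitvec 1, 0#1⟩

/-- The values of all lines of a model. -/
def Model.eval (B : Model) (σ : Nid → Value) (ι : Nid → ℕ) : List Value :=
  B.foldl (fun env l => env ++ [l.eval σ ι env]) []

/-- `σ` is an initial state; state variables without `init` have any value. -/
def Model.Initial (B : Model) (ι : Nid → ℕ) (σ : Nid → Value) : Prop :=
  ∀ s st v, Line.init s st v ∈ B → σ st = valueAt (B.eval σ ι) v

/-- There is a state transition from `σ` to `σ'` on the input `ι`. -/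
def Model.Step (B : Model) (ι : Nid → ℕ) (σ σ' : Nid → Value) : Prop :=
  ∀ s st v, Line.next s st v ∈ B → σ' st = valueAt (B.eval σ ι) v

/-- The state `σ` is bad on the input `ι`. -/
def Model.Bad (B : Model) (ι : Nid → ℕ) (σ : Nid → Value) : Prop :=
  ∃ c, Line.bad c ∈ B ∧ operand (B.eval σ ι) (.bitvec 1) c = 1#1

/-- An input: `I i j` is what the input variable at line `j` reads after `i` state transitions. -/
abbrev Input := ℕ → Nid → ℕ

/-- A bad state is reachable on `I` in no more than `n` state transitions. -/
def Model.BadReachable (B : Model) (n : ℕ) (I : Input) : Prop :=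
  ∃ k ≤ n, ∃ σ : ℕ → Nid → Value,
    B.Initial (I 0) (σ 0) ∧ (∀ i < k, B.Step (I i) (σ i) (σ (i + 1))) ∧ B.Bad (I k) (σ k)

/-- The widest bitvector width that occurs in a sort. -/
def Srt.width : Srt → ℕ
  | .bitvec w => w
  | .array k e => max k e

/-- The number of words of a sort. -/
def Srt.words : Srt → ℕ
  | .bitvec _ => 1
  | .array k _ => 2 ^ k

/-- The word size: the largest bitvector width in the model (at least `1`). -/
def Model.wordSize (B : Model) : ℕ :=
  ((B.filterMap Line.sort).map Srt.width).foldr max 1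

/-- The memory size: the largest number of words of an array in the model (at least `1`). -/
def Model.memorySize (B : Model) : ℕ :=
  ((B.filterMap Line.sort).map Srt.words).foldr max 1

/-! ## QUBO models -/

/-- A QUBO model, as a sparse upper triangular matrix: the entry `(i, j)` is the sum of all `a` with
`(i, j, a)` in `terms`; the diagonal holds the linear factors. An element `(i, j, qs)` of `inputs`
says that the qubits `qs` are the bits, from the least significant one on, of the input variable at
line `j` after `i` state transitions. -/
structure Qubo where
  qubits : ℕ
  offset : ℤ
  terms : List (ℕ × ℕ × ℤ)
  inputs : List (ℕ × Nid × List ℕ)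

/-- The value of the binary quadratic function under an assignment of the qubits. -/
def Qubo.value (Q : Qubo) (x : ℕ → Bool) : ℤ :=
  Q.offset + (Q.terms.map fun t => t.2.2 * ((x t.1).toNat * (x t.2.1).toNat : ℤ)).sum

/-- The input qubits have the values that `I` gives to them. -/
def Qubo.Agrees (Q : Qubo) (I : Input) (x : ℕ → Bool) : Prop :=
  ∀ r ∈ Q.inputs, ∀ (k : ℕ) (hk : k < r.2.2.length), x r.2.2[k] = (I r.1 r.2.1).testBit k

/-- `Q` evaluates to `e` on `I`: this is the least value with the input qubits set to `I`. -/
def Qubo.EvaluatesTo (Q : Qubo) (I : Input) (e : ℤ) : Prop :=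
  IsLeast {v : ℤ | ∃ x, Q.Agrees I x ∧ v = Q.value x} e

/-- The matrix is upper triangular, and of the size of the number of qubits. -/
def Qubo.UpperTriangular (Q : Qubo) : Prop :=
  ∀ t ∈ Q.terms, t.1 ≤ t.2.1 ∧ t.2.1 < Q.qubits

/-- The size of a QUBO model: its qubits, its terms, and the entries of its table of inputs. -/
def Qubo.size (Q : Qubo) : ℕ :=
  Q.qubits + Q.terms.length + (Q.inputs.map fun r => r.2.2.length + 1).sum

/-! ## QUBOT

The translator is a program on a random access machine: it runs in a monad that holds the QUBO model
built so far and the number of steps. A step is an elementary operation: creating a qubit, adding a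
term, changing the offset, dispatching on the operands of a gate, producing or copying a bit of a
word, or accessing a table by its index. -/

structure QState extends Qubo where
  steps : ℕ

abbrev QM := StateM QState

/-- Spend `k` steps. -/
def charge (k : ℕ) : QM Unit := modify fun q => { q with steps := q.steps + k }

def newQubit : QM ℕ := do
  charge 1
  let q ← get
  set { q with qubits := q.qubits + 1 }
  return q.qubits

def addTerm (i j : ℕ) (a : ℤ) : QM Unit := do
  charge 1
  modify fun q => { q with terms := (min i j, max i j, a) :: q.terms }

def addOffset (a : ℤ) : QM Unit := do
  charge 1
  modify fun q => { q with offset := q.offset + a }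

/-- A bit is a known constant or a qubit. -/
inductive Bit where
  | const (b : Bool)
  | qubit (q : ℕ)

/-- A word, from the least significant bit on. -/
abbrev Word := List Bit

/-- The words of a value: one of them for a bitvector, and those at the indices `0, 1, …` for an
array. -/
abbrev Words := List Word

/-- `2 - 2x - 2y + 4xy`, which is `0` if and only if `y` is `NOT x`. -/
def gNot : Bit → QM Bit
  | .const b => do charge 1; return .const (!b)
  | .qubit x => do
      charge 1
      let y ← newQubit
      addOffset 2; addTerm x x (-2); addTerm y y (-2); addTerm x y 4
      return .qubit y

/-- `6z + 2xy - 4xz - 4yz`, which is `0` if and only if `z` is `x AND y`. -/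
def gAnd : Bit → Bit → QM Bit
  | .const false, _ => do charge 1; return .const false
  | .const true, b => do charge 1; return b
  | .qubit _, .const false => do charge 1; return .const false
  | .qubit x, .const true => do charge 1; return .qubit x
  | .qubit x, .qubit y => do
      charge 1
      let z ← newQubit
      addTerm z z 6; addTerm x y 2; addTerm x z (-4); addTerm y z (-4)
      return .qubit z

/-- `2x + 2y + 2z + 2xy - 4xz - 4yz`, which is `0` if and only if `z` is `x OR y`. -/
def gOr : Bit → Bit → QM Bit
  | .const true, _ => do charge 1; return .const true
  | .const false, b => do charge 1; return b
  | .qubit _, .const true => do charge 1; return .const true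
  | .qubit x, .const false => do charge 1; return .qubit x
  | .qubit x, .qubit y => do
      charge 1
      let z ← newQubit
      addTerm x x 2; addTerm y y 2; addTerm z z 2
      addTerm x y 2; addTerm x z (-4); addTerm y z (-4)
      return .qubit z

/-- `6 - 4x - 4y - 6z + 2xy + 4xz + 4yz`, which is `0` if and only if `z` is `x NAND y`. -/
def gNand : Bit → Bit → QM Bit
  | .const false, _ => do charge 1; return .const true
  | .const true, b => do charge 1; gNot b
  | .qubit _, .const false => do charge 1; return .const true
  | .qubit x, .const true => do charge 1; gNot (.qubit x)
  | .qubit x, .qubit y => do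
      charge 1
      let z ← newQubit
      addOffset 6; addTerm x x (-4); addTerm y y (-4); addTerm z z (-6)
      addTerm x y 2; addTerm x z 4; addTerm y z 4
      return .qubit z

/-- `2y + 2z - 2xy + 4xz - 4yz`, which is `0` if and only if `z` is `(NOT x) AND y`. -/
def gInhibit : Bit → Bit → QM Bit
  | .const true, _ => do charge 1; return .const false
  | .const false, b => do charge 1; return b
  | .qubit _, .const false => do charge 1; return .const false
  | .qubit x, .const true => do charge 1; gNot (.qubit x)
  | .qubit x, .qubit y => do
      charge 1
      let z ← newQubit
      addTerm y y 2; addTerm z z 2; addTerm x y (-2); addTerm x z 4; addTerm y z (-4)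
      return .qubit z

/-- Constrain a bit to `1`, with the function `1 - x`. -/
def assertTrue : Bit → QM Unit
  | .const true => charge 1
  | .const false => addOffset 1
  | .qubit x => do addOffset 1; addTerm x x (-1)

def gXor (x y : Bit) : QM Bit := do
  let a ← gOr x y
  let b ← gNand x y
  gAnd a b

def gIte (c x y : Bit) : QM Bit := do
  let a ← gAnd c x
  let b ← gInhibit c y
  gOr a b

/-- `w` copies of a constant. -/
def constWord (w : ℕ) (b : Bool) : QM Word := do
  charge w
  return List.replicate w (.const b)

/-- The `w`-bit constant `c`. -/
def intWord (w : ℕ) (c : ℤ) : QM Word := do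
  charge w
  return (List.range w).map fun k => .const (c.testBit k)

/-- `w` new qubits. -/
def newQubits : ℕ → QM (List ℕ)
  | 0 => return []
  | w + 1 => do
      let q ← newQubit
      let qs ← newQubits w
      return q :: qs

def newWord (w : ℕ) : QM Word := do
  let qs ← newQubits w
  return qs.map .qubit

def newWords (w : ℕ) : ℕ → QM Words
  | 0 => return []
  | m + 1 => do
      let x ← newWord w
      let xs ← newWords w m
      return x :: xs

def notWord : Word → QM Word
  | [] => return []
  | x :: xs => do
      let z ← gNot x
      let zs ← notWord xs
      return z :: zs

def andWord : Word → Word → QM Word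
  | x :: xs, y :: ys => do
      let z ← gAnd x y
      let zs ← andWord xs ys
      return z :: zs
  | _, _ => return []

def iteWord (c : Bit) : Word → Word → QM Word
  | x :: xs, y :: ys => do
      let z ← gIte c x y
      let zs ← iteWord c xs ys
      return z :: zs
  | _, _ => return []

def iteWords (c : Bit) : Words → Words → QM Words
  | x :: xs, y :: ys => do
      charge 1
      let z ← iteWord c x y
      let zs ← iteWords c xs ys
      return z :: zs
  | _, _ => return []

/-- Are all bits `1`? -/
def allOne : Word → QM Bit
  | [] => return .const true
  | x :: xs => do
      let a ← allOne xs
      gAnd x a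

/-- Is some bit `1`? -/
def someOne : Word → QM Bit
  | [] => return .const false
  | x :: xs => do
      let a ← someOne xs
      gOr x a

def eqWord : Word → Word → QM Bit
  | x :: xs, y :: ys => do
      let d ← gXor x y
      let e ← eqWord xs ys
      gInhibit d e
  | _, _ => return .const true

/-- Sum with carry-in `c`, and the carry-out. -/
def addCarry : Word → Word → Bit → QM (Word × Bit)
  | x :: xs, y :: ys, c => do
      let d ← gXor x y
      let s ← gXor d c
      let a ← gAnd x y
      let b ← gAnd d c
      let c' ← gOr a b
      let (ss, o) ← addCarry xs ys c'
      return (s :: ss, o)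
  | _, _, c => return ([], c)

/-- Difference `x + (NOT y) + 1`; the carry-out says whether `y ≤ x`. -/
def subCarry (x y : Word) : QM (Word × Bit) := do
  let y' ← notWord y
  addCarry x y' (.const true)

/-- Is `x < y`? -/
def ltWord (x y : Word) : QM Bit := do
  let (_, o) ← subCarry x y
  gNot o

/-- Shift-and-add: `acc + x * y`, in as many bits as `x` and `acc` have. -/
def mulAdd (x : Word) : Word → Word → QM Word
  | [], acc => return acc
  | y :: ys, acc => do
      let zero ← constWord x.length false
      let row ← iteWord y x zero
      let (acc', _) ← addCarry acc row (.const false)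
      charge x.length
      mulAdd ((.const false :: x).dropLast) ys acc'

/-- Quotient and remainder, as new qubits `q` and `r` with the constraints `q * y + r = x`, in twice
the number of bits, and `r < y` unless `y` is zero, in which case all bits of `q` are `1`. -/
def divWord (w : ℕ) (x y : Word) : QM (Word × Word) := do
  let q ← newWord w
  let r ← newWord w
  let zero ← constWord w false
  let zero₂ ← constWord (2 * w) false
  charge (6 * w)
  let p ← mulAdd (y ++ zero) q zero₂
  let (s, _) ← addCarry p (r ++ zero) (.const false)
  let e ← eqWord s (x ++ zero)
  assertTrue e
  let nonzero ← someOne y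
  let lt ← ltWord r y
  let ones ← allOne q
  let ok ← gIte nonzero lt ones
  assertTrue ok
  return (q, r)

/-- Read from a memory whose words have the addresses `a, a + 1, …`, by comparing the `k`-bit
address `idx` with all of them; `acc` is the word found before. -/
def readWord (k : ℕ) (idx : Word) : ℕ → Words → Word → QM Word
  | _, [], acc => return acc
  | a, x :: xs, acc => do
      let addr ← intWord k a
      let here ← eqWord idx addr
      let acc' ← iteWord here x acc
      readWord k idx (a + 1) xs acc'

/-- Write to a memory whose words have the addresses `a, a + 1, …`. -/
def writeWord (k : ℕ) (idx val : Word) : ℕ → Words → QM Words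
  | _, [] => return []
  | a, x :: xs => do
      let addr ← intWord k a
      let here ← eqWord idx addr
      let z ← iteWord here val x
      let zs ← writeWord k idx val (a + 1) xs
      return z :: zs

def buildBinary (op : BinOp) (w : ℕ) (x y : Word) : QM Word :=
  match op with
  | .add => return (← addCarry x y (.const false)).1
  | .sub => return (← subCarry x y).1
  | .mul => do
      let zero ← constWord w false
      mulAdd x y zero
  | .udiv => return (← divWord w x y).1
  | .urem => return (← divWord w x y).2
  | .and => andWord x y

def buildCompare (op : CmpOp) (x y : Word) : QM Bit :=
  match op with
  | .eq => eqWord x y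
  | .neq => do gNot (← eqWord x y)
  | .ult => ltWord x y
  | .ulte => do gNot (← ltWord y x)
  | .ugt => ltWord y x
  | .ugte => do gNot (← ltWord x y)

/-- Table access: the circuit built for line `x`. -/
def fetch (env : List Words) (x : Nid) : QM Words := do
  charge 1
  return env.getD x []

/-- Table access: the circuit built for line `x`, a bitvector. -/
def fetchWord (env : List Words) (x : Nid) : QM Word := do
  return (← fetch env x).headD []

/-- Table access: the circuit built for line `x`, a single bit. -/
def fetchBit (env : List Words) (x : Nid) : QM Bit := do
  return (← fetchWord env x).headD (.const false)

/-- New qubits for a state variable. -/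
def newValue : Srt → QM Words
  | .bitvec w => newWords w 1
  | .array k e => newWords e (2 ^ k)

/-- Build the circuit of a line of `B` in the `i`-th duplicate. The circuits of the previous lines
are in `env`, and those of the previous duplicate in `prev`, which is `none` in the duplicate `0`. In
the duplicate `0`, state variables are replaced by their initial values; in all others, by the outputs
of the previous duplicate that update them. Inputs are new qubits in every duplicate. -/
def buildLine (B : Model) (i : ℕ) (prev : Option (List Words)) (env : List Words) :
    Line → QM Words
  | .constd w c => do return [← intWord w c]
  | .binary op w x y => do return [← buildBinary op w (← fetchWord env x) (← fetchWord env y)]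
  | .compare op _ x y => do return [[← buildCompare op (← fetchWord env x) (← fetchWord env y)]]
  | .not _ x => do return [← notWord (← fetchWord env x)]
  | .inc w x => do
      let one ← intWord w 1
      return [(← addCarry (← fetchWord env x) one (.const false)).1]
  | .uext v b x => do
      let zero ← constWord b false
      charge v
      return [(← fetchWord env x) ++ zero]
  | .slice v u l x => do
      charge v
      return [((← fetchWord env x).drop l).take (u - l + 1)]
  | .ite _ c x y => do iteWords (← fetchBit env c) (← fetch env x) (← fetch env y)
  | .read k e mem idx => do
      let zero ← constWord e false
      return [← readWord k (← fetchWord env idx) 0 (← fetch env mem) zero]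
  | .write k _ mem idx val => do
      writeWord k (← fetchWord env idx) (← fetchWord env val) 0 (← fetch env mem)
  | .state s => do
      charge 1
      match prev with
      | none =>
          match B.findSome? (Line.initOf env.length) with
          | some v => fetch env v
          | none => newValue s
      | some p =>
          match B.findSome? (Line.nextOf env.length) with
          | some v => fetch p v
          | none => newValue s
  | .input w => do
      let qs ← newQubits w
      charge (w + 1)
      modify fun q => { q with inputs := (i, env.length, qs) :: q.inputs }
      return [qs.map .qubit]
  | .init _ _ _ => return []
  | .next _ _ _ => return []
  | .bad _ => return []

/-- Build the circuits of the given lines, in their order. -/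
def buildLines (B : Model) (i : ℕ) (prev : Option (List Words)) :
    List Line → List Words → QM (List Words)
  | [], env => return env
  | l :: ls, env => do
      charge 1
      let z ← buildLine B i prev env l
      buildLines B i prev ls (env ++ [z])

/-- The OR circuit over all bad lines, and `acc`. -/
def buildBad (env : List Words) : List Line → Bit → QM Bit
  | [], acc => return acc
  | .bad c :: ls, acc => do
      charge 1
      let acc' ← gOr (← fetchBit env c) acc
      buildBad env ls acc'
  | _ :: ls, acc => do
      charge 1
      buildBad env ls acc

/-- The duplicates `0` to `i`, with the OR circuit over all their bad lines. -/
def buildDuplicates (B : Model) : ℕ → QM (List Words × Bit)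
  | 0 => do
      let env ← buildLines B 0 none B []
      let b ← buildBad env B (.const false)
      return (env, b)
  | i + 1 => do
      let (p, acc) ← buildDuplicates B i
      let env ← buildLines B (i + 1) (some p) B []
      let b ← buildBad env B acc
      return (env, b)

/-- Index the `init` and `next` lines of `B` by their state variables, in one pass over `B`; build
the duplicates; constrain the OR circuit over all bad lines to `1`. -/
def buildModel (B : Model) (n : ℕ) : QM Unit := do
  charge B.length
  let (_, b) ← buildDuplicates B n
  assertTrue b

def runQubot (B : Model) (n : ℕ) : QState :=
  ((buildModel B n).run
    { qubits := 0, offset := 0, terms := [], inputs := [], steps := 0 }).2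

/-- The QUBO model that QUBOT generates for `B` and `n`. -/
def qubot (B : Model) (n : ℕ) : Qubo := (runQubot B n).toQubo

/-- The number of steps in which QUBOT generates it. -/
def qubotTime (B : Model) (n : ℕ) : ℕ := (runQubot B n).steps

/-! ## RISC-U binaries -/

abbrev Reg := Fin 32

inductive ArithOp where
  | add | sub | mul | divu | remu

/-- The RISC-U instructions; `load` and `store` stand for `ld` and `sd` on 64-bit machines, and for
`lw` and `sw` on 32-bit machines. -/
inductive Instr where
  | lui (rd : Reg) (imm : ℤ)
  | addi (rd rs1 : Reg) (imm : ℤ)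
  | load (rd rs1 : Reg) (imm : ℤ)
  | store (rs1 rs2 : Reg) (imm : ℤ)
  | arith (op : ArithOp) (rd rs1 rs2 : Reg)
  | sltu (rd rs1 rs2 : Reg)
  | beq (rs1 rs2 : Reg) (imm : ℤ)
  | jal (rd : Reg) (imm : ℤ)
  | jalr (rd rs1 : Reg) (imm : ℤ)
  | ecall

inductive Machine where
  | riscu32
  | riscu64

/-- The number of bytes of a machine word. -/
def Machine.bytes : Machine → ℕ
  | .riscu32 => 4
  | .riscu64 => 8

/-- The number of bits of a machine word. -/
def Machine.bits (M : Machine) : ℕ := 8 * M.bytes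

/-- A RISC-U binary, loaded into the 4GB of memory of a machine: its code, the segments of its
memory with their initial sizes in words, and the initial values of memory words and registers. -/
structure Binary where
  machine : Machine
  codeStart : ℕ
  code : List Instr
  entry : ℕ
  dataStart : ℕ
  dataWords : ℕ
  heapStart : ℕ
  heapWords : ℕ
  stackWords : ℕ
  memory : ℕ → ℕ
  register : Reg → ℕ

namespace Binary

def dataEnd (R : Binary) : ℕ := R.dataStart + R.machine.bytes * R.dataWords

def heapEnd (R : Binary) : ℕ := R.heapStart + R.machine.bytes * R.heapWords

/-- The end of the heap after an allowance of `h` further words. -/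
def allowedHeapEnd (R : Binary) (h : ℕ) : ℕ := R.heapEnd + R.machine.bytes * h

/-- The start of the stack after an allowance of `s` further words. -/
def allowedStackStart (R : Binary) (s : ℕ) : ℕ := 2 ^ 32 - R.machine.bytes * (R.stackWords + s)

/-- The highest address of a word in memory. -/
def highestAddress (R : Binary) : ℕ := 2 ^ 32 - R.machine.bytes

/-- The virtual addresses of the words of physical memory: data, heap and stack segments. -/
def addresses (R : Binary) (h s : ℕ) : List ℕ :=
  (List.range R.dataWords).map (fun i => R.dataStart + R.machine.bytes * i) ++
  (List.range (R.heapWords + h)).map (fun i => R.heapStart + R.machine.bytes * i) ++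
  (List.range (R.stackWords + s)).map (fun i => R.allowedStackStart s + R.machine.bytes * i)

/-- The number of words of memory that the binary may access. -/
def memoryWords (R : Binary) (h s : ℕ) : ℕ := R.dataWords + R.heapWords + h + R.stackWords + s

end Binary

/-! ## BEATOR

The translation of RISC-U binaries to BTOR2 models that do not contain arrays: a segmenting MMU maps
virtual addresses directly to a finite number of state variables, one for each memory word. -/

abbrev BM := StateM Model

/-- Append a line to the model, and return its nid. -/
def emit (l : Line) : BM Nid := do
  let B ← get
  set (B ++ [l])
  return B.length

def regZero : Reg := 0
def regRa : Reg := 1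
def regSp : Reg := 2
def regA0 : Reg := 10
def regA1 : Reg := 11
def regA2 : Reg := 12
def regA7 : Reg := 17

/-- The nids of the header and of the state variables. -/
structure Header where
  /-- word size in bits -/
  w : ℕ
  ff : Nid
  tt : Nid
  zero : Nid
  one : Nid
  /-- the numbers of bytes `2, 3, …` up to those of a word -/
  counts : List Nid
  /-- the number of bytes of a word, minus one -/
  mask : Nid
  /-- the number of bytes of a word -/
  bytes : Nid
  dataStart : Nid
  dataEnd : Nid
  heapStart : Nid
  heapEnd : Nid
  allowedHeapEnd : Nid
  allowedStackStart : Nid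
  highest : Nid
  kernel : Nid
  user : Nid
  /-- unsigned-extended inputs of `1, 2, …` bytes -/
  inputs : List Nid
  regs : List Nid
  flags : List Nid
  /-- virtual address and state variable of each memory word -/
  ram : List (Nid × Nid)

def Header.reg (H : Header) (r : Reg) : Nid := H.regs.getD r 0

def Header.flag (H : Header) (i : ℕ) : Nid := H.flags.getD i 0

def emitHeader (R : Binary) (h s : ℕ) : BM Header := do
  let b := R.machine.bytes
  let w := R.machine.bits
  let ff ← emit (.constd 1 0)
  let tt ← emit (.constd 1 1)
  let zero ← emit (.constd w 0)
  let one ← emit (.constd w 1)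
  let counts ← (List.range (b - 1)).mapM fun k => emit (.constd w ((k : ℤ) + 2))
  let dataStart ← emit (.constd w R.dataStart)
  let dataEnd ← emit (.constd w R.dataEnd)
  let heapStart ← emit (.constd w R.heapStart)
  let heapEnd ← emit (.constd w R.heapEnd)
  let allowedHeapEnd ← emit (.constd w (R.allowedHeapEnd h))
  let allowedStackStart ← emit (.constd w (R.allowedStackStart s))
  let highest ← emit (.constd w R.highestAddress)
  let kernel ← emit (.state (.bitvec 1))
  let _ ← emit (.init (.bitvec 1) kernel ff)
  let user ← emit (.not 1 kernel)
  let inputs ← (List.range (b - 1)).mapM fun k => do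
    let x ← emit (.input (8 * (k + 1)))
    emit (.uext (8 * (k + 1)) (w - 8 * (k + 1)) x)
  let wordInput ← emit (.input w)
  let regs ← (List.finRange 32).mapM fun r => do
    if r = regZero then
      emit (.constd w 0)
    else
      let v ← emit (.constd w (R.register r))
      let x ← emit (.state (.bitvec w))
      let _ ← emit (.init (.bitvec w) x v)
      return x
  let flags ← (List.range R.code.length).mapM fun i => do
    let x ← emit (.state (.bitvec 1))
    let _ ← emit (.init (.bitvec 1) x (if R.codeStart + 4 * i = R.entry then tt else ff))
    return x
  let ram ← (R.addresses h s).mapM fun (a : ℕ) => do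
    let v ← emit (.constd w a)
    let c ← emit (.constd w (R.memory a))
    let x ← emit (.state (.bitvec w))
    let _ ← emit (.init (.bitvec w) x c)
    return (v, x)
  return { w, ff, tt, zero, one, counts, mask := counts.getD (b - 3) 0,
           bytes := counts.getD (b - 2) 0, dataStart, dataEnd, heapStart, heapEnd,
           allowedHeapEnd, allowedStackStart, highest, kernel, user,
           inputs := inputs ++ [wordInput], regs, flags, ram }

/-- The heads of the cascades that encode the data flow into the state variables. -/
structure Flow where
  reg : Reg → Nid
  ram : List Nid
  division : Nid
  remainder : Nid
  access : Nid
  ecall : Nid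

def Flow.setReg (F : Flow) (r : Reg) (x : Nid) : Flow := { F with reg := Function.update F.reg r x }

def ArithOp.toBinOp : ArithOp → BinOp
  | .add => .add
  | .sub => .sub
  | .mul => .mul
  | .divu => .udiv
  | .remu => .urem

/-- Data flow of the instruction at address `pc` with the pc flag `flag`. Also returns the nids that
control flow needs: the conditions of a `beq`, and the link address of a `jal`. -/
def emitDataFlow (H : Header) (pc : ℕ) (flag : Nid) (F : Flow) :
    Instr → BM (Flow × Nid × Nid)
  | .lui rd imm => do
      if rd = regZero then return (F, 0, 0)
      let v ← emit (.constd H.w (imm * 2 ^ 12))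
      let x ← emit (.ite (.bitvec H.w) flag v (F.reg rd))
      return (F.setReg rd x, 0, 0)
  | .addi rd rs1 imm => do
      if rd = regZero then return (F, 0, 0)
      let c ← emit (.constd H.w imm)
      let v ← emit (.binary .add H.w (H.reg rs1) c)
      let x ← emit (.ite (.bitvec H.w) flag v (F.reg rd))
      return (F.setReg rd x, 0, 0)
  | .load rd rs1 imm => do
      if rd = regZero then return (F, 0, 0)
      let c ← emit (.constd H.w imm)
      let a ← emit (.binary .add H.w (H.reg rs1) c)
      let acc ← emit (.ite (.bitvec H.w) flag a F.access)
      let v ← H.ram.foldlM (init := H.zero) fun v p => do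
        let e ← emit (.compare .eq H.w a p.1)
        emit (.ite (.bitvec H.w) e p.2 v)
      let x ← emit (.ite (.bitvec H.w) flag v (F.reg rd))
      return ({ F with access := acc }.setReg rd x, 0, 0)
  | .store rs1 rs2 imm => do
      let c ← emit (.constd H.w imm)
      let a ← emit (.binary .add H.w (H.reg rs1) c)
      let acc ← emit (.ite (.bitvec H.w) flag a F.access)
      let ram ← (H.ram.zip F.ram).mapM fun p => do
        let e ← emit (.compare .eq H.w a p.1.1)
        let v ← emit (.ite (.bitvec H.w) e (H.reg rs2) p.2)
        emit (.ite (.bitvec H.w) flag v p.2)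
      return ({ F with access := acc, ram := ram }, 0, 0)
  | .arith op rd rs1 rs2 => do
      if rd = regZero then return (F, 0, 0)
      let F ← match op with
        | .divu => do
            let x ← emit (.ite (.bitvec H.w) flag (H.reg rs2) F.division)
            pure { F with division := x }
        | .remu => do
            let x ← emit (.ite (.bitvec H.w) flag (H.reg rs2) F.remainder)
            pure { F with remainder := x }
        | _ => pure F
      let v ← emit (.binary op.toBinOp H.w (H.reg rs1) (H.reg rs2))
      let x ← emit (.ite (.bitvec H.w) flag v (F.reg rd))
      return (F.setReg rd x, 0, 0)
  | .sltu rd rs1 rs2 => do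
      if rd = regZero then return (F, 0, 0)
      let c ← emit (.compare .ult H.w (H.reg rs1) (H.reg rs2))
      let v ← emit (.uext 1 (H.w - 1) c)
      let x ← emit (.ite (.bitvec H.w) flag v (F.reg rd))
      return (F.setReg rd x, 0, 0)
  | .beq rs1 rs2 _ => do
      let e ← emit (.compare .eq H.w (H.reg rs1) (H.reg rs2))
      let d ← emit (.not 1 e)
      return (F, e, d)
  | .jal rd _ => do
      if rd = regZero then return (F, 0, 0)
      let link ← emit (.constd H.w ((pc : ℤ) + 4))
      let x ← emit (.ite (.bitvec H.w) flag link (F.reg rd))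
      return (F.setReg rd x, link, link)
  | .jalr _ _ _ => return (F, 0, 0)
  | .ecall => do
      let x ← emit (.ite (.bitvec 1) flag H.tt F.ecall)
      return ({ F with ecall := x }, 0, 0)

/-- Data flow of all instructions, the first of which has index `i`. -/
def emitAllDataFlow (R : Binary) (H : Header) :
    ℕ → List Instr → Flow → BM (Flow × List (Nid × Nid))
  | _, [], F => return (F, [])
  | i, a :: as, F => do
      let (F, x) ← emitDataFlow H (R.codeStart + 4 * i) (H.flag i) F a
      let (F, xs) ← emitAllDataFlow R H (i + 1) as F
      return (F, x :: xs)

/-- A way in which control flows into an instruction: from the instruction with index `i`; from a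
`beq` with index `i` under a condition; by returning from the callee at an address to a link address;
or from an `ecall` with index `i`. -/
inductive Edge where
  | plain (i : ℕ)
  | branch (i : ℕ) (cond : Nid)
  | ret (callee : ℤ) (link : Nid)
  | ecall (i : ℕ)

/-- Control flow so far: the edges with the addresses of their targets, the last one first; the value
of register `a7` if known, and `0` otherwise; the address of the current callee; and the indices of
the instructions with which callees return, by the addresses of the callees, the last one first. -/
structure Control where
  edges : List (ℤ × Edge)
  a7 : ℤ
  callee : ℤ
  returns : List (ℤ × ℕ)

/-- Control flow of the instruction with index `i` at address `pc`; `x` are the nids that data flow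
has returned for it. -/
def Control.add (K : Control) (i : ℕ) (pc : ℤ) (x : Nid × Nid) : Instr → Control
  | .addi rd rs1 imm =>
      { K with edges := (pc + 4, .plain i) :: K.edges
               a7 := if rs1 = regZero ∧ imm ≠ 0 ∧ rd = regA7 then imm else K.a7 }
  | .beq _ _ imm =>
      { K with edges := (pc + 4, .branch i x.2) :: (pc + imm, .branch i x.1) :: K.edges }
  | .jal rd imm =>
      let edges := (pc + imm, .plain i) :: K.edges
      { K with edges := if rd = regZero then edges else (pc + 4, .ret (pc + imm) x.1) :: edges }
  | .jalr rd rs1 imm =>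
      if rd = regZero ∧ imm = 0 ∧ rs1 = regRa then
        { K with returns := (K.callee, i) :: K.returns, callee := pc + 4 }
      else K
  | .ecall =>
      { K with edges := (pc + 4, .ecall i) :: K.edges
               callee := if K.a7 = 93 then pc + 4 else K.callee
               a7 := 0 }
  | _ => { K with edges := (pc + 4, .plain i) :: K.edges }

/-- Control flow of all instructions, the first of which has index `i`. -/
def Control.addAll (R : Binary) : ℕ → List (Instr × Nid × Nid) → Control → Control
  | _, [], K => K
  | i, a :: as, K =>
      Control.addAll R (i + 1) as (K.add i ((R.codeStart : ℤ) + 4 * i) a.2 a.1)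

/-- The nids that the system calls define for the checks of error states. -/
structure Syscalls where
  ids : List Nid
  exitActive : Nid
  brk : Nid

/-- The system calls `exit`, `read`, `write`, `openat` and `brk`. -/
def emitSyscalls (H : Header) (F : Flow) : BM (Flow × Syscalls) := do
  let word := Srt.bitvec H.w
  let bool := Srt.bitvec 1
  let a0 := H.reg regA0
  let a1 := H.reg regA1
  let a2 := H.reg regA2
  let a7 := H.reg regA7
  let exitId ← emit (.constd H.w 93)
  let readId ← emit (.constd H.w 63)
  let writeId ← emit (.constd H.w 64)
  let openatId ← emit (.constd H.w 56)
  let brkId ← emit (.constd H.w 214)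
  let exitCall ← emit (.compare .eq H.w a7 exitId)
  let readCall ← emit (.compare .eq H.w a7 readId)
  let writeCall ← emit (.compare .eq H.w a7 writeId)
  let openatCall ← emit (.compare .eq H.w a7 openatId)
  let brkCall ← emit (.compare .eq H.w a7 brkId)
  -- exit
  let exitActive ← emit (.binary .and 1 F.ecall exitCall)
  let exitKernel ← emit (.ite bool H.kernel exitCall exitActive)
  -- read
  let readActive ← emit (.binary .and 1 F.ecall readCall)
  let readAccess ← emit (.ite word readActive a1 F.access)
  let readKernel ← emit (.ite bool readActive H.tt exitKernel)
  let readSetA0 ← emit (.ite word readActive H.zero (F.reg regA0))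
  let rest ← emit (.binary .sub H.w a2 a0)
  let full ← emit (.compare .ugte H.w rest H.bytes)
  let incr ← emit (.ite word full H.bytes rest)
  let byteInput := H.inputs.headD 0
  let input ← (H.counts.zip H.inputs.tail).foldlM (init := byteInput) fun v p => do
    let e ← emit (.compare .eq H.w incr p.1)
    emit (.ite word e p.2 v)
  let cursor ← emit (.binary .add H.w a1 a0)
  let more ← emit (.compare .ult H.w a0 a2)
  let goOn ← emit (.binary .and 1 readCall more)
  let activeKernel ← emit (.binary .and 1 H.kernel goOn)
  let positive ← emit (.compare .ugt H.w incr H.zero)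
  let kernelInc ← emit (.binary .and 1 activeKernel positive)
  let ram ← (H.ram.zip F.ram).mapM fun p => do
    let e ← emit (.compare .eq H.w cursor p.1.1)
    let v ← emit (.ite word e input p.2)
    emit (.ite word kernelInc v p.2)
  let moved ← emit (.binary .add H.w a0 incr)
  let readMoveA0 ← emit (.ite word activeKernel moved readSetA0)
  let kernelFlow ← emit (.ite bool activeKernel H.tt readKernel)
  -- write
  let writeActive ← emit (.binary .and 1 F.ecall writeCall)
  let writeAccess ← emit (.ite word writeActive a1 readAccess)
  let writeSetA0 ← emit (.ite word writeActive a2 readMoveA0)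
  -- openat
  let openatActive ← emit (.binary .and 1 F.ecall openatCall)
  let openatAccess ← emit (.ite word openatActive a1 writeAccess)
  let fd ← emit (.state word)
  let _ ← emit (.init word fd H.one)
  let fdInc ← emit (.inc H.w fd)
  let newFd ← emit (.ite word openatActive fdInc fd)
  let _ ← emit (.next word fd newFd)
  let openatSetA0 ← emit (.ite word openatActive fdInc writeSetA0)
  -- brk
  let brkActive ← emit (.binary .and 1 F.ecall brkCall)
  let brk ← emit (.state word)
  let _ ← emit (.init word brk H.heapEnd)
  let shrink ← emit (.compare .ulte H.w brk a0)
  let free ← emit (.compare .ult H.w a0 (H.reg regSp))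
  let segment ← emit (.binary .and 1 shrink free)
  let reset ← emit (.binary .and H.w a0 H.mask)
  let aligned ← emit (.compare .eq H.w reset H.zero)
  let valid ← emit (.binary .and 1 segment aligned)
  let ok ← emit (.binary .and 1 brkActive valid)
  let newBrk ← emit (.ite word ok a0 brk)
  let _ ← emit (.next word brk newBrk)
  let invalid ← emit (.not 1 valid)
  let fail ← emit (.binary .and 1 brkActive invalid)
  let brkSetA0 ← emit (.ite word fail brk openatSetA0)
  let _ ← emit (.next bool H.kernel kernelFlow)
  return ({ F with ram := ram, access := openatAccess }.setReg regA0 brkSetA0,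
    { ids := [exitCall, readCall, writeCall, openatCall, brkCall], exitActive, brk })

/-- The nid of the bit that says whether control flows along an edge; `none` if the callee of a
return edge never returns. -/
def emitEdge (H : Header) (returns : List (ℤ × ℕ)) : Edge → BM (Option Nid)
  | .plain i => return some (H.flag i)
  | .branch i c => do return some (← emit (.binary .and 1 (H.flag i) c))
  | .ret callee link =>
      match returns.lookup callee with
      | none => return none
      | some i => do
          let inv ← emit (.not H.w H.one)
          let target ← emit (.binary .and H.w (H.reg regRa) inv)
          let e ← emit (.compare .eq H.w target link)
          return some (← emit (.binary .and 1 (H.flag i) e))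
  | .ecall i => do
      let k ← emit (.state (.bitvec 1))
      let _ ← emit (.init (.bitvec 1) k H.ff)
      let active ← emit (.ite (.bitvec 1) k H.kernel (H.flag i))
      let _ ← emit (.next (.bitvec 1) k active)
      return some (← emit (.binary .and 1 k H.user))

/-- Control flow into the instruction with index `i`. -/
def emitControlFlow (R : Binary) (H : Header) (K : Control) (i : ℕ) : BM Unit := do
  let pc : ℤ := (R.codeStart : ℤ) + 4 * i
  let edges := (K.edges.filter fun e => decide (e.1 = pc)).map Prod.snd
  let flow ← edges.foldlM (init := H.ff) fun flow e => do
    match ← emitEdge H K.returns e with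
    | none => return flow
    | some x => if flow = H.ff then return x else emit (.ite (.bitvec 1) x H.tt flow)
  let _ ← emit (.next (.bitvec 1) (H.flag i) flow)

/-- Invalid system calls, non-zero exit codes, division by zero, and unaligned memory access. -/
def emitChecks (H : Header) (F : Flow) (S : Syscalls) : BM Unit := do
  let no ← S.ids.mapM fun c => emit (.not 1 c)
  let invalid ← no.tail.foldlM (init := no.headD 0) fun v c => emit (.binary .and 1 v c)
  let b0 ← emit (.binary .and 1 F.ecall invalid)
  let _ ← emit (.bad b0)
  let code ← emit (.compare .neq H.w (H.reg regA0) H.zero)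
  let b1 ← emit (.binary .and 1 S.exitActive code)
  let _ ← emit (.bad b1)
  let b2 ← emit (.compare .eq H.w F.division H.zero)
  let _ ← emit (.bad b2)
  let b3 ← emit (.compare .eq H.w F.remainder H.zero)
  let _ ← emit (.bad b3)
  let low ← emit (.binary .and H.w F.access H.mask)
  let b4 ← emit (.compare .neq H.w low H.zero)
  let _ ← emit (.bad b4)

/-- Memory access outside of the segments. -/
def emitSegfaults (H : Header) (F : Flow) (S : Syscalls) : BM Unit := do
  let sp := H.reg regSp
  -- below the data segment
  let c0 ← emit (.compare .ult H.w F.access H.dataStart)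
  let _ ← emit (.bad c0)
  -- between the data and the heap segment
  let c2 ← emit (.compare .ugte H.w F.access H.dataEnd)
  let c3 ← emit (.compare .ult H.w F.access H.heapStart)
  let c4 ← emit (.binary .and 1 c2 c3)
  let _ ← emit (.bad c4)
  -- between the current heap and stack segments
  let c6 ← emit (.compare .ugte H.w F.access S.brk)
  let c7 ← emit (.compare .ult H.w F.access sp)
  let c8 ← emit (.binary .and 1 c6 c7)
  let _ ← emit (.bad c8)
  -- between the allowed and the current end of the heap segment
  let c10 ← emit (.compare .ugte H.w F.access H.allowedHeapEnd)
  let c11 ← emit (.compare .ult H.w F.access S.brk)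
  let c12 ← emit (.binary .and 1 c10 c11)
  let _ ← emit (.bad c12)
  -- between the current and the allowed start of the stack segment
  let c14 ← emit (.compare .ugte H.w F.access sp)
  let c15 ← emit (.compare .ult H.w F.access H.allowedStackStart)
  let c16 ← emit (.binary .and 1 c14 c15)
  let _ ← emit (.bad c16)
  -- above the stack segment
  let c18 ← emit (.compare .ugt H.w F.access H.highest)
  let _ ← emit (.bad c18)

def emitModel (R : Binary) (h s : ℕ) : BM Unit := do
  let H ← emitHeader R h s
  let F₀ : Flow :=
    { reg := H.reg, ram := H.ram.map Prod.snd, division := H.one, remainder := H.one,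
      access := H.dataStart, ecall := H.ff }
  let (F₁, nids) ← emitAllDataFlow R H 0 R.code F₀
  let K := Control.addAll R 0 (R.code.zip nids)
    { edges := [], a7 := 0, callee := R.codeStart, returns := [] }
  let (F, S) ← emitSyscalls H F₁
  (List.range R.code.length).forM (emitControlFlow R H K)
  (List.finRange 32).forM fun r => do
    if r = regZero then return ()
    let _ ← emit (.next (.bitvec H.w) (H.reg r) (F.reg r))
  (H.ram.zip F.ram).forM fun p => do
    let _ ← emit (.next (.bitvec H.w) p.1.2 p.2)
  emitChecks H F S
  emitSegfaults H F S

/-- The BTOR2 model that BEATOR generates for the binary `R`, with an allowance of `h` further words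
of heap and `s` further words of stack. -/
def beator (R : Binary) (h s : ℕ) : Model := ((emitModel R h s).run []).2

end QA

/-!
QUBOT builds its model by a program in a state monad, and correctness is proved by a program logic
for this monad. The penalty functions that are added are nonnegative, so the value of the final
model is `0` if and only if every gate and every constraint has penalty `0`. A `Triple` therefore
records two directions for a program: under an assignment for which the program adds no penalty
its result has the intended value (`sound`), and every assignment of the older qubits can be
extended to the new ones such that the program adds no penalty (`total`). The second direction
holds for circuits without any condition (`Circ`), since the output qubit of a gate is determined
by its inputs. This covers division too: quotient and remainder are new qubits under constraints,
and the constraints have exactly one solution (`divWord_circ`). Only the last constraint, which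
asserts the disjunction of all `bad` conditions, can fail. A `Triple` also bounds the number of
steps, and since every qubit, term and table entry is paid for by a step, the bound on the time is
a bound on the size.

An assignment without penalty decodes to the values of all lines in all duplicates, and these
values are a run of the BTOR2 model (`Complete.badReachable`). Conversely, given a run, the input
qubits and the qubits of uninitialised state variables are chosen as in the run, and the circuits
then compute the values of that run (`Complete.bad_of_run`). Since the last duplicate and all
earlier ones contribute to the disjunction, `QUBOT(B, n)` has value `0` on an input if and only if
a bad state is reachable on it in at most `n` transitions (`badReachable_iff_evaluatesTo_zero`). A
line costs at most a constant times `m_B * w_B ^ 2` steps, the worst cases being multiplication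
and division (`w_B ^ 2`) and access to arrays (`m_B * w_B`), which gives `qubotTime_le`.

For BEATOR, well-formedness and the number of lines are proved by a second program logic
(`Typed`). It keeps track of the sorts of the nids that are known, and of the multiset of state
variables which still lack their `next` lines; the model is well-formed once this multiset is
empty. The number of lines is of the order of the product of the sizes of code and memory, since
every `load` and every `store` compares its address with all addresses (`inv_beator`). As the
models of BEATOR contain no arrays and no bitvectors longer than a machine word, the bounds for
them follow from the general ones.
-/

namespace QA

/-! ### A program logic for QUBOT -/

/-- An assignment of truth values to the qubits. -/
abbrev Asg := ℕ → Bool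

/-- The truth value of a bit. -/
def Bit.val (x : Asg) : Bit → Bool
  | .const b => b
  | .qubit q => x q

theorem Bit.val_const (x : Asg) (b : Bool) : (Bit.const b).val x = b := rfl

/-- The bit is a constant or one of the first `N` qubits. -/
def Bit.Below (N : ℕ) : Bit → Prop
  | .const _ => True
  | .qubit q => q < N

/-- Two assignments agree on the first `N` qubits. -/
def Agree (N : ℕ) (x y : Asg) : Prop := ∀ i < N, x i = y i

/-- A condition on assignments that depends only on the first `N` qubits. -/
def Stable (N : ℕ) (T : Asg → Prop) : Prop := ∀ x y, Agree N x y → T x → T y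

theorem Agree.refl (N : ℕ) (x : Asg) : Agree N x x := fun _ _ => rfl

theorem Agree.trans {N M : ℕ} {x y z : Asg} (h : Agree N x y) (h' : Agree M y z) (hN : N ≤ M) :
    Agree N x z := fun i hi => (h i hi).trans (h' i (hi.trans_le hN))

theorem Agree.mono {N M : ℕ} {x y : Asg} (h : Agree M x y) (hN : N ≤ M) : Agree N x y :=
  fun i hi => h i (hi.trans_le hN)

theorem Stable.mono {N M : ℕ} {T : Asg → Prop} (h : Stable N T) (hN : N ≤ M) : Stable M T :=
  fun x y hxy => h x y (hxy.mono hN)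

theorem Stable.and {N : ℕ} {T T' : Asg → Prop} (h : Stable N T) (h' : Stable N T') :
    Stable N (fun x => T x ∧ T' x) :=
  fun x y hxy hx => ⟨h x y hxy hx.1, h' x y hxy hx.2⟩

theorem Bit.Below.mono {N M : ℕ} {b : Bit} (h : b.Below N) (hN : N ≤ M) : b.Below M := by
  cases b with
  | const b => trivial
  | qubit q => exact lt_of_lt_of_le h hN

theorem Bit.Below.agree {N : ℕ} {b : Bit} (h : b.Below N) {x y : Asg} (hxy : Agree N x y) :
    b.val x = b.val y := by
  cases b with
  | const b => rfl
  | qubit q => exact hxy q h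

/-- Terms mention only qubits that exist. -/
theorem Qubo.UpperTriangular.value_congr {Q : Qubo} (hQ : Q.UpperTriangular) {x y : Asg}
    (h : Agree Q.qubits x y) : Q.value x = Q.value y := by
  unfold Qubo.value
  congr 2
  refine List.map_congr_left fun t ht => ?_
  obtain ⟨h1, h2⟩ := hQ t ht
  rw [h _ (lt_of_le_of_lt h1 h2), h _ h2]

/-- The result and the final state of a program. -/
def out {α : Type} (p : QM α) (q : QState) : α × QState := p q

/-- Nothing is ever removed from the model: penalties are nonnegative, and every new qubit, term and
table entry is paid for by a step. -/
structure Grows (q q' : QState) : Prop where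
  qubits : q.qubits ≤ q'.qubits
  upper : q.UpperTriangular → q'.UpperTriangular
  value : ∀ x, q.value x ≤ q'.value x
  size : q'.size + q.steps ≤ q.size + q'.steps

theorem Grows.refl (q : QState) : Grows q q := ⟨le_rfl, id, fun _ => le_rfl, le_rfl⟩

theorem Grows.trans {a b c : QState} (h : Grows a b) (h' : Grows b c) : Grows a c :=
  ⟨h.qubits.trans h'.qubits, fun u => h'.upper (h.upper u), fun x => (h.value x).trans (h'.value x),
    by have := h.size; have := h'.size; omega⟩

/-- The program `p`, run in the state `q`, takes at most `k` steps and returns a result as described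
by `V`. An assignment under which `p` adds no penalty satisfies `S`. An assignment that satisfies
`T` can be changed on the new qubits such that `p` adds no penalty and `F` holds. -/
structure Triple {α : Type} (q : QState) (p : QM α) (k : ℕ) (V : QState → α → Prop)
    (T : Asg → Prop) (F S : Asg → α → Prop) : Prop where
  grows : Grows q (out p q).2
  steps : (out p q).2.steps ≤ q.steps + k
  valid : V (out p q).2 (out p q).1
  sound : ∀ x, (out p q).2.value x = q.value x → S x (out p q).1
  total : q.UpperTriangular → ∀ x, T x → ∃ y, Agree q.qubits x y ∧
    (out p q).2.value y = q.value y ∧ F y (out p q).1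

/-- Sequential composition. The second program may assume about the old qubits all that the first
one guarantees. -/
theorem Triple.bind {α β : Type} {q : QState} {p : QM α} {f : α → QM β} {k₁ k₂ : ℕ}
    {V₁ : QState → α → Prop} {V : QState → β → Prop} {T : Asg → Prop} {F₁ S₁ : Asg → α → Prop}
    {F S : Asg → β → Prop} (hp : Triple q p k₁ V₁ T F₁ S₁)
    (hf : V₁ (out p q).2 (out p q).1 → Triple (out p q).2 (f (out p q).1) k₂ V
      (fun x => S₁ x (out p q).1 ∧ F₁ x (out p q).1) F (fun x b => S₁ x (out p q).1 → S x b)) :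
    Triple q (p >>= f) (k₁ + k₂) V T F S := by
  have e : out (p >>= f) q = out (f (out p q).1) (out p q).2 := rfl
  have hf := hf hp.valid
  refine ⟨?_, ?_, ?_, ?_, ?_⟩
  · rw [e]; exact hp.grows.trans hf.grows
  · rw [e]; have := hp.steps; have := hf.steps; omega
  · rw [e]; exact hf.valid
  · intro x hx
    rw [e] at hx ⊢
    have h1 := hp.grows.value x
    have h2 := hf.grows.value x
    -- No penalty is negative, so both programs add none if their composition adds none.
    exact hf.sound x (by omega) (hp.sound x (by omega))
  · intro hq x hx
    rw [e]
    obtain ⟨y, hy, hv, hF⟩ := hp.total hq x hx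
    obtain ⟨z, hz, hv', hF'⟩ := hf.total (hp.grows.upper hq) y ⟨hp.sound y hv, hF⟩
    have hyz := hz.mono hp.grows.qubits
    refine ⟨z, hy.trans hyz le_rfl, ?_, hF'⟩
    rw [hv', ← (hp.grows.upper hq).value_congr hz, hv, hq.value_congr hyz]

theorem Triple.weaken {α : Type} {q : QState} {p : QM α} {k k' : ℕ} {V V' : QState → α → Prop}
    {T T' : Asg → Prop} {F F' S S' : Asg → α → Prop} (h : Triple q p k V T F S) (hk : k ≤ k')
    (hV : ∀ q' a, V q' a → V' q' a) (hT : ∀ x, T' x → T x)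
    (hF : ∀ q' x a, V q' a → S x a → F x a → F' x a)
    (hS : ∀ q' x a, V q' a → S x a → S' x a) : Triple q p k' V' T' F' S' :=
  ⟨h.grows, h.steps.trans (by omega), hV _ _ h.valid, fun x hx => hS _ x _ h.valid (h.sound x hx),
    fun hq x hx => by
      obtain ⟨y, h1, h2, h3⟩ := h.total hq x (hT x hx)
      exact ⟨y, h1, h2, hF _ y _ h.valid (h.sound y h2) h3⟩⟩

/-- A condition on the old qubits is preserved. -/
theorem Triple.frame {α : Type} {q : QState} {p : QM α} {k : ℕ} {V : QState → α → Prop}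
    {T T' : Asg → Prop} {F S : Asg → α → Prop} (h : Triple q p k V T F S)
    (hT : Stable q.qubits T') :
    Triple q p k V (fun x => T x ∧ T' x) (fun x a => F x a ∧ T' x) S :=
  ⟨h.grows, h.steps, h.valid, h.sound, fun hq x hx => by
    obtain ⟨y, h1, h2, h3⟩ := h.total hq x hx.1
    exact ⟨y, h1, h2, h3, hT x y h1 hx.2⟩⟩

/-- A `Triple` for a program that reads no inputs; `V` only depends on the number of qubits. -/
def Spec {α : Type} (q : QState) (p : QM α) (k : ℕ) (V : ℕ → α → Prop) (T : Asg → Prop)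
    (F S : Asg → α → Prop) : Prop :=
  Triple q p k (fun q' a => q'.inputs = q.inputs ∧ V q'.qubits a) T F S

/-- A `Spec` for a circuit: every assignment of the old qubits can be extended to the new ones
without penalty. -/
def Circ {α : Type} (q : QState) (p : QM α) (k : ℕ) (V : ℕ → α → Prop) (S : Asg → α → Prop) :
    Prop :=
  Spec q p k V (fun _ => True) (fun _ _ => True) S

section

variable {α β : Type} {q : QState} {p : QM α} {f : α → QM β} {k k₁ k₂ : ℕ} {V₁ : ℕ → α → Prop}
  {V : ℕ → β → Prop} {T : Asg → Prop} {F₁ S₁ : Asg → α → Prop} {F S : Asg → β → Prop}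

theorem Spec.bind (hp : Spec q p k₁ V₁ T F₁ S₁)
    (hf : ∀ a q', q.qubits ≤ q'.qubits → V₁ q'.qubits a → Spec q' (f a) k₂ V
      (fun x => S₁ x a ∧ F₁ x a) F (fun x b => S₁ x a → S x b)) :
    Spec q (p >>= f) (k₁ + k₂) V T F S :=
  Triple.bind hp fun h => (hf _ _ hp.grows.qubits h.2).weaken le_rfl
    (fun _ _ h' => ⟨h'.1.trans h.1, h'.2⟩) (fun _ => id) (fun _ _ _ _ _ => id) fun _ _ _ _ => id

theorem Circ.bind (hp : Circ q p k₁ V₁ S₁)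
    (hf : ∀ a q', q.qubits ≤ q'.qubits → V₁ q'.qubits a → Circ q' (f a) k₂ V
      (fun x b => S₁ x a → S x b)) : Circ q (p >>= f) (k₁ + k₂) V S :=
  Spec.bind hp fun a q' h h' => (hf a q' h h').weaken le_rfl (fun _ _ => id) (fun _ _ => trivial)
    (fun _ _ _ _ _ => id) fun _ _ _ _ => id

theorem Circ.frame (h : Circ q p k V₁ S₁) (hT : Stable q.qubits T) :
    Spec q p k V₁ T (fun x _ => T x) S₁ :=
  (Triple.frame h hT).weaken le_rfl (fun _ _ => id) (fun _ h => ⟨trivial, h⟩)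
    (fun _ _ _ _ _ h => h.2) fun _ _ _ _ => id

theorem Circ.le {k' : ℕ} (h : Circ q p k V₁ S₁) (hk : k ≤ k') : Circ q p k' V₁ S₁ :=
  Triple.weaken h hk (fun _ _ => id) (fun _ => id) (fun _ _ _ _ _ => id) fun _ _ _ _ => id

theorem Circ.imp {V' : ℕ → α → Prop} {S' : Asg → α → Prop} (h : Circ q p k V₁ S₁)
    (hV : ∀ N a, V₁ N a → V' N a) (hS : ∀ N x a, V₁ N a → S₁ x a → S' x a) : Circ q p k V' S' :=
  Triple.weaken h le_rfl (fun _ _ h => ⟨h.1, hV _ _ h.2⟩) (fun _ => id) (fun _ _ _ _ _ => id)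
    fun q' x a h => hS q'.qubits x a h.2

theorem Circ.pure {a : α} (hV : V₁ q.qubits a) (hS : ∀ x, S₁ x a) :
    Circ q (pure a) 0 V₁ S₁ :=
  ⟨Grows.refl q, le_rfl, ⟨rfl, hV⟩, fun x _ => hS x,
    fun _ x _ => ⟨x, Agree.refl _ x, rfl, trivial⟩⟩

theorem Circ.charge (q : QState) (c : ℕ) :
    Circ q (charge c) c (fun _ _ => True) (fun _ _ => True) :=
  ⟨⟨le_rfl, id, fun _ => le_rfl, by
      change q.size + q.steps ≤ q.size + (q.steps + c); omega⟩,
    le_rfl, ⟨rfl, trivial⟩, fun _ _ => trivial, fun _ x _ => ⟨x, Agree.refl _ x, rfl, trivial⟩⟩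

theorem Circ.charge_bind {f : Unit → QM β} {c : ℕ} (h : ∀ q', q'.qubits = q.qubits →
    Circ q' (f ()) k V S) (hk : c + k ≤ k₂) : Circ q (QA.charge c >>= f) k₂ V S := by
  have := h (out (QA.charge c) q).2 rfl
  exact Circ.le (Triple.bind (Circ.charge q c) fun h' => this.weaken le_rfl
    (fun _ _ h => ⟨h.1.trans h'.1, h.2⟩) (fun _ _ => trivial) (fun _ _ _ _ _ => id)
    fun _ _ _ _ h _ => h) hk

theorem Circ.charge_pure {b : β} {c : ℕ} (hV : V q.qubits b) (hS : ∀ x, S x b) (hk : c ≤ k) :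
    Circ q (QA.charge c >>= fun _ => Pure.pure b) k V S :=
  Circ.charge_bind (k := 0) (fun _ e => Circ.pure (by rwa [e]) hS) hk

end

theorem Triple.of_spec {α : Type} {q : QState} {p : QM α} {k : ℕ} {V : ℕ → α → Prop}
    {T : Asg → Prop} {F S : Asg → α → Prop} (h : Spec q p k V T F S) :
    Triple q p k (fun q' a => q.qubits ≤ q'.qubits ∧ q'.inputs = q.inputs ∧ V q'.qubits a) T F S :=
  ⟨h.grows, h.steps, ⟨h.grows.qubits, h.valid⟩, h.sound, h.total⟩

theorem Spec.weaken {α : Type} {q : QState} {p : QM α} {k k' : ℕ} {V V' : ℕ → α → Prop}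
    {T T' : Asg → Prop} {F F' S S' : Asg → α → Prop} (h : Spec q p k V T F S) (hk : k ≤ k')
    (hV : ∀ N a, V N a → V' N a) (hT : ∀ x, T' x → T x)
    (hF : ∀ N x a, V N a → S x a → F x a → F' x a)
    (hS : ∀ N x a, V N a → S x a → S' x a) : Spec q p k' V' T' F' S' :=
  Triple.weaken h hk (fun _ _ h => ⟨h.1, hV _ _ h.2⟩) hT (fun q' x a h => hF q'.qubits x a h.2)
    fun q' x a h => hS q'.qubits x a h.2

theorem Spec.frame {α : Type} {q : QState} {p : QM α} {k : ℕ} {V : ℕ → α → Prop}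
    {T T' : Asg → Prop} {F S : Asg → α → Prop} (h : Spec q p k V T F S)
    (hT : Stable q.qubits T') :
    Spec q p k V (fun x => T x ∧ T' x) (fun x a => F x a ∧ T' x) S :=
  Triple.frame h hT

theorem Spec.pre {α : Type} {q : QState} {p : QM α} {k : ℕ} {V : ℕ → α → Prop}
    {T T' : Asg → Prop} {F S : Asg → α → Prop} (h : Spec q p k V T F S) (hT : ∀ x, T' x → T x) :
    Spec q p k V T' F S :=
  h.weaken le_rfl (fun _ _ => id) hT (fun _ _ _ _ _ => id) fun _ _ _ _ => id

theorem Spec.le {α : Type} {q : QState} {p : QM α} {k k' : ℕ} {V : ℕ → α → Prop}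
    {T : Asg → Prop} {F S : Asg → α → Prop} (h : Spec q p k V T F S) (hk : k ≤ k') :
    Spec q p k' V T F S :=
  h.weaken hk (fun _ _ => id) (fun _ => id) (fun _ _ _ _ _ => id) fun _ _ _ _ => id

theorem Spec.map {α β : Type} {q : QState} {p : QM α} {k : ℕ} {V : ℕ → α → Prop}
    {T : Asg → Prop} {F S : Asg → α → Prop} (g : α → β) {V' : ℕ → β → Prop} {F' S' : Asg → β → Prop}
    (h : Spec q p k V T F S) (hV : ∀ N a, V N a → V' N (g a)) (hF : ∀ x a, F x a → F' x (g a))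
    (hS : ∀ x a, S x a → S' x (g a)) :
    Spec q (p >>= fun a => pure (g a)) k V' T F' S' :=
  ⟨h.grows, h.steps, ⟨h.valid.1, hV _ _ h.valid.2⟩, fun x hx => hS _ _ (h.sound x hx),
    fun hq x hx => by
      obtain ⟨y, h1, h2, h3⟩ := h.total hq x hx
      exact ⟨y, h1, h2, hF _ _ h3⟩⟩

theorem Spec.pure {α : Type} {q : QState} {a : α} {V : ℕ → α → Prop} {T : Asg → Prop}
    {F S : Asg → α → Prop} (hV : V q.qubits a) (hF : ∀ x, T x → F x a) (hS : ∀ x, S x a) :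
    Spec q (pure a) 0 V T F S :=
  ⟨Grows.refl q, le_rfl, ⟨rfl, hV⟩, fun x _ => hS x,
    fun _ x hx => ⟨x, Agree.refl _ x, rfl, hF x hx⟩⟩

/-- A `Spec` that only says which values the new qubits can have. -/
abbrev Free {α : Type} (q : QState) (p : QM α) (k : ℕ) (V : ℕ → α → Prop) (T : Asg → Prop)
    (F : Asg → α → Prop) : Prop :=
  Spec q p k V T F fun _ _ => True

theorem Free.bind {α β : Type} {q : QState} {p : QM α} {f : α → QM β} {k₁ k₂ k : ℕ}
    {V₁ : ℕ → α → Prop} {V : ℕ → β → Prop} {T : Asg → Prop} {F₁ : Asg → α → Prop}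
    {F : Asg → β → Prop} (hp : Free q p k₁ V₁ T F₁) (hk : k₁ + k₂ ≤ k)
    (hf : ∀ a q', q.qubits ≤ q'.qubits → V₁ q'.qubits a → Free q' (f a) k₂ V (fun x => F₁ x a) F) :
    Free q (p >>= f) k V T F :=
  (Spec.bind hp fun a q' h h' => (hf a q' h h').weaken le_rfl (fun _ _ => id) (fun _ h => h.2)
    (fun _ _ _ _ _ => id) fun _ _ _ _ _ _ => trivial).weaken hk (fun _ _ => id) (fun _ => id)
    (fun _ _ _ _ _ => id) fun _ _ _ _ => id

theorem Circ.map {α β : Type} {q : QState} {p : QM α} {k : ℕ} {V : ℕ → α → Prop}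
    {S : Asg → α → Prop} (g : α → β) {V' : ℕ → β → Prop} {S' : Asg → β → Prop}
    (h : Circ q p k V S) (hV : ∀ N a, V N a → V' N (g a)) (hS : ∀ x a, S x a → S' x (g a)) :
    Circ q (p >>= fun a => Pure.pure (g a)) k V' S' :=
  Spec.map g h hV (fun _ _ => id) hS

/-! ### Gates -/

/-- Terms are stored with the smaller qubit first, which does not change their value. -/
theorem toNat_min_mul_max (x : Asg) (i j : ℕ) :
    ((x (min i j)).toNat : ℤ) * ((x (max i j)).toNat : ℤ) = (x i).toNat * (x j).toNat := by
  rcases le_total i j with h | h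
  · simp [h]
  · simp [h, mul_comm]

/-- A program that creates one qubit and adds a penalty function that is `0` if and only if this
qubit has the value `f`, and positive otherwise. -/
theorem Circ.gate {q : QState} {p : QM Bit} {ts : List (ℕ × ℕ × ℤ)} {c : ℕ} (d : ℤ) (f : Asg → Bool)
    (h1 : (out p q).1 = .qubit q.qubits) (h2 : (out p q).2.qubits = q.qubits + 1)
    (h3 : (out p q).2.offset = q.offset + d) (h4 : (out p q).2.terms = ts ++ q.terms)
    (h5 : (out p q).2.inputs = q.inputs) (h6 : (out p q).2.steps = q.steps + c)
    (hc : ts.length + 1 ≤ c) (hts : ∀ t ∈ ts, t.1 ≤ t.2.1 ∧ t.2.1 < q.qubits + 1)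
    (hf : ∀ x y, Agree q.qubits x y → f x = f y)
    (hpen : ∀ x : Asg, 0 ≤ d + (ts.map fun t => t.2.2 * ((x t.1).toNat * (x t.2.1).toNat : ℤ)).sum ∧
      (d + (ts.map fun t => t.2.2 * ((x t.1).toNat * (x t.2.1).toNat : ℤ)).sum = 0 ↔
        x q.qubits = f x)) :
    Circ q p c (fun N b => b.Below N) (fun x b => b.val x = f x) := by
  have hv : ∀ x, (out p q).2.value x = q.value x +
      (d + (ts.map fun t => t.2.2 * ((x t.1).toNat * (x t.2.1).toNat : ℤ)).sum) := by
    intro x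
    simp only [Qubo.value, h3, h4, List.map_append, List.sum_append]
    ring
  refine ⟨⟨by omega, ?_, ?_, ?_⟩, h6.le, ⟨h5, ?_⟩, ?_, ?_⟩
  · intro hq t ht
    rw [h4] at ht
    rw [h2]
    rcases List.mem_append.mp ht with ht | ht
    · exact hts t ht
    · exact ⟨(hq t ht).1, (hq t ht).2.trans (Nat.lt_succ_self _)⟩
  · intro x
    rw [hv]
    have := (hpen x).1
    omega
  · simp only [Qubo.size, h2, h4, h5, h6, List.length_append]
    omega
  · rw [h1, h2]
    exact Nat.lt_succ_self q.qubits
  · intro x hx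
    rw [h1]
    rw [hv] at hx
    exact (hpen x).2.mp (by omega)
  · -- The new qubit is given the value that the old ones determine.
    intro hq x _
    have hag : Agree q.qubits x (Function.update x q.qubits (f x)) := by
      intro i hi
      rw [Function.update_of_ne hi.ne]
    refine ⟨Function.update x q.qubits (f x), hag, ?_, trivial⟩
    rw [hv]
    have := (hpen (Function.update x q.qubits (f x))).2.mpr (by
      rw [Function.update_self]; exact hf _ _ hag)
    omega

theorem gNot_circ {q : QState} {b : Bit} (hb : b.Below q.qubits) :
    Circ q (gNot b) 6 (fun N z => z.Below N) (fun x z => z.val x = !b.val x) := by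
  cases b with
  | const b => exact Circ.charge_pure trivial (fun x => rfl) (by omega)
  | qubit i =>
    have hi : i < q.qubits := hb
    refine Circ.gate (c := 6) 2 _ rfl rfl rfl (ts := [_, _, _]) rfl rfl rfl (by simp) ?_ ?_ ?_
    · simp; omega
    · intro x y h; exact congrArg _ (h i hi)
    · intro x
      simp only [List.map_cons, List.map_nil, List.sum_cons, List.sum_nil, toNat_min_mul_max]
      simp only [Bit.val]
      cases x i <;> cases x q.qubits <;> simp

theorem gAnd_circ {q : QState} {a b : Bit} (ha : a.Below q.qubits) (hb : b.Below q.qubits) :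
    Circ q (gAnd a b) 6 (fun N z => z.Below N) (fun x z => z.val x = (a.val x && b.val x)) := by
  rcases a with (_ | _) | i
  · exact Circ.charge_pure trivial (fun x => by simp [Bit.val]) (by omega)
  · exact Circ.charge_pure hb (fun x => by simp [Bit.val]) (by omega)
  rcases b with (_ | _) | j
  · exact Circ.charge_pure trivial (fun x => by simp [Bit.val]) (by omega)
  · exact Circ.charge_pure ha (fun x => by simp [Bit.val]) (by omega)
  have hi : i < q.qubits := ha
  have hj : j < q.qubits := hb
  refine Circ.gate (c := 6) 0 _ rfl rfl (Int.add_zero _).symm (ts := [_, _, _, _]) rfl rfl rfl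
    (by simp) ?_ ?_ ?_
  · simp; omega
  · intro x y h; exact congrArg₂ _ (h i hi) (h j hj)
  · intro x
    simp only [List.map_cons, List.map_nil, List.sum_cons, List.sum_nil, toNat_min_mul_max]
    simp only [Bit.val]
    cases x i <;> cases x j <;> cases x q.qubits <;> simp

theorem gOr_circ {q : QState} {a b : Bit} (ha : a.Below q.qubits) (hb : b.Below q.qubits) :
    Circ q (gOr a b) 8 (fun N z => z.Below N) (fun x z => z.val x = (a.val x || b.val x)) := by
  rcases a with (_ | _) | i
  · exact Circ.charge_pure hb (fun x => by simp [Bit.val]) (by omega)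
  · exact Circ.charge_pure trivial (fun x => by simp [Bit.val]) (by omega)
  rcases b with (_ | _) | j
  · exact Circ.charge_pure ha (fun x => by simp [Bit.val]) (by omega)
  · exact Circ.charge_pure trivial (fun x => by simp [Bit.val]) (by omega)
  have hi : i < q.qubits := ha
  have hj : j < q.qubits := hb
  refine Circ.gate (c := 8) 0 _ rfl rfl (Int.add_zero _).symm (ts := [_, _, _, _, _, _]) rfl rfl rfl
    (by simp) ?_ ?_ ?_
  · simp; omega
  · intro x y h; exact congrArg₂ _ (h i hi) (h j hj)
  · intro x
    simp only [List.map_cons, List.map_nil, List.sum_cons, List.sum_nil, toNat_min_mul_max]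
    simp only [Bit.val]
    cases x i <;> cases x j <;> cases x q.qubits <;> simp

theorem gNand_circ {q : QState} {a b : Bit} (ha : a.Below q.qubits) (hb : b.Below q.qubits) :
    Circ q (gNand a b) 9 (fun N z => z.Below N) (fun x z => z.val x = !(a.val x && b.val x)) := by
  rcases a with (_ | _) | i
  · exact Circ.charge_pure trivial (fun x => by simp [Bit.val]) (by omega)
  · exact Circ.charge_bind (k := 6) (fun q' e => (gNot_circ (by rwa [e])).imp (fun _ _ => id)
      (fun _ x z _ h => by simpa [Bit.val] using h)) (by omega)
  rcases b with (_ | _) | j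
  · exact Circ.charge_pure trivial (fun x => by simp [Bit.val]) (by omega)
  · exact Circ.charge_bind (k := 6) (fun q' e => (gNot_circ (by rwa [e])).imp (fun _ _ => id)
      (fun _ x z _ h => by simpa [Bit.val] using h)) (by omega)
  have hi : i < q.qubits := ha
  have hj : j < q.qubits := hb
  refine Circ.gate (c := 9) 6 _ rfl rfl rfl (ts := [_, _, _, _, _, _]) rfl rfl rfl
    (by simp) ?_ ?_ ?_
  · simp; omega
  · intro x y h; exact congrArg₂ (fun a b => !(a && b)) (h i hi) (h j hj)
  · intro x
    simp only [List.map_cons, List.map_nil, List.sum_cons, List.sum_nil, toNat_min_mul_max]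
    simp only [Bit.val]
    cases x i <;> cases x j <;> cases x q.qubits <;> simp

theorem gInhibit_circ {q : QState} {a b : Bit} (ha : a.Below q.qubits) (hb : b.Below q.qubits) :
    Circ q (gInhibit a b) 7 (fun N z => z.Below N)
      (fun x z => z.val x = (!a.val x && b.val x)) := by
  rcases a with (_ | _) | i
  · exact Circ.charge_pure hb (fun x => by simp [Bit.val]) (by omega)
  · exact Circ.charge_pure trivial (fun x => by simp [Bit.val]) (by omega)
  rcases b with (_ | _) | j
  · exact Circ.charge_pure trivial (fun x => by simp [Bit.val]) (by omega)
  · exact Circ.charge_bind (k := 6) (fun q' e => (gNot_circ (by rwa [e])).imp (fun _ _ => id)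
      (fun _ x z _ h => by simpa [Bit.val] using h)) (by omega)
  have hi : i < q.qubits := ha
  have hj : j < q.qubits := hb
  refine Circ.gate (c := 7) 0 _ rfl rfl (Int.add_zero _).symm (ts := [_, _, _, _, _]) rfl rfl rfl
    (by simp) ?_ ?_ ?_
  · simp; omega
  · intro x y h; exact congrArg₂ (fun a b => !a && b) (h i hi) (h j hj)
  · intro x
    simp only [List.map_cons, List.map_nil, List.sum_cons, List.sum_nil, toNat_min_mul_max]
    simp only [Bit.val]
    cases x i <;> cases x j <;> cases x q.qubits <;> simp

/-- A bit can be constrained to `1` without penalty if and only if it is `1`. -/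
theorem assertTrue_spec {q : QState} {b : Bit} (hb : b.Below q.qubits) :
    Spec q (assertTrue b) 2 (fun _ _ => True) (fun x => b.val x = true) (fun _ _ => True)
      (fun x _ => b.val x = true) := by
  have key : ∀ x, (out (assertTrue b) q).2.value x = q.value x + (1 - (b.val x).toNat) := by
    intro x
    rcases b with (_ | _) | i
    · change q.offset + 1 + _ = q.offset + _ + _
      simp only [Bit.val]
      change q.offset + 1 + (List.map _ q.terms).sum = _
      simp; ring
    · change q.value x = _
      simp [Bit.val]
    · change q.offset + 1 + (List.map _ ((min i i, max i i, -1) :: q.terms)).sum = q.offset + _ + _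
      simp only [List.map_cons, List.sum_cons, toNat_min_mul_max, Bit.val]
      cases x i <;> simp <;> ring
  refine ⟨⟨?_, ?_, ?_, ?_⟩, ?_, ⟨?_, trivial⟩, ?_, ?_⟩
  · rcases b with (_ | _) | i <;> exact le_rfl
  · rcases b with (_ | _) | i
    · exact id
    · exact id
    · intro hq t ht
      rcases List.mem_cons.mp ht with rfl | ht
      · have : i < q.qubits := hb
        exact ⟨by simp, by change max i i < q.qubits; simpa using this⟩
      · exact hq t ht
  · intro x
    rw [key]
    cases b.val x <;> simp
  · rcases b with (_ | _) | i
    · change q.size + q.steps ≤ q.size + (q.steps + 1); omega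
    · change q.size + q.steps ≤ q.size + (q.steps + 1); omega
    · change q.qubits + (q.terms.length + 1) + (List.map _ q.inputs).sum + q.steps ≤
        q.qubits + q.terms.length + (List.map _ q.inputs).sum + (q.steps + 1 + 1)
      omega
  · rcases b with (_ | _) | i
    · exact Nat.le_succ _
    · exact Nat.le_succ _
    · exact le_rfl
  · rcases b with (_ | _) | i <;> rfl
  · intro x hx
    rw [key] at hx
    cases h : b.val x
    · simp [h] at hx
    · rfl
  · intro _ x hx
    exact ⟨x, Agree.refl _ _, by rw [key, hx]; simp, trivial⟩

theorem gXor_circ {q : QState} {a b : Bit} (ha : a.Below q.qubits) (hb : b.Below q.qubits) :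
    Circ q (gXor a b) 23 (fun N z => z.Below N) (fun x z => z.val x = (a.val x ^^ b.val x)) := by
  refine Circ.le (Circ.bind (gOr_circ ha hb) fun c q₁ l₁ hc => ?_) (by omega : 8 + (9 + 6) ≤ _)
  refine Circ.bind (gNand_circ (ha.mono l₁) (hb.mono l₁)) fun d q₂ l₂ hd => ?_
  refine (gAnd_circ (hc.mono l₂) hd).imp (fun _ _ => id) fun _ x z _ h h₁ h₂ => ?_
  rw [h, h₁, h₂]
  cases a.val x <;> cases b.val x <;> rfl

theorem gIte_circ {q : QState} {c a b : Bit} (hc : c.Below q.qubits) (ha : a.Below q.qubits)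
    (hb : b.Below q.qubits) : Circ q (gIte c a b) 21 (fun N z => z.Below N)
      (fun x z => z.val x = if c.val x then a.val x else b.val x) := by
  refine Circ.le (Circ.bind (gAnd_circ hc ha) fun d q₁ l₁ hd => ?_) (by omega : 6 + (7 + 8) ≤ _)
  refine Circ.bind (gInhibit_circ (hc.mono l₁) (hb.mono l₁)) fun e q₂ l₂ he => ?_
  refine (gOr_circ (hd.mono l₂) he).imp (fun _ _ => id) fun _ x z _ h h₁ h₂ => ?_
  rw [h, h₁, h₂]
  cases c.val x <;> cases a.val x <;> cases b.val x <;> rfl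

/-! ### Words -/

/-- The number that a word represents, least significant bit first. -/
def valW (x : Asg) : Word → ℕ
  | [] => 0
  | b :: bs => (b.val x).toNat + 2 * valW x bs

/-- A word of `n` bits, over the first `N` qubits. -/
def WordOK (N n : ℕ) (z : Word) : Prop := z.length = n ∧ ∀ b ∈ z, Bit.Below N b

theorem WordOK.mono {N M n : ℕ} {z : Word} (h : WordOK N n z) (hN : N ≤ M) : WordOK M n z :=
  ⟨h.1, fun b hb => (h.2 b hb).mono hN⟩

theorem wordOK_nil (N : ℕ) : WordOK N 0 [] := ⟨rfl, by simp⟩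

theorem WordOK.cons {N n : ℕ} {b : Bit} {z : Word} (hb : b.Below N) (h : WordOK N n z) :
    WordOK N (n + 1) (b :: z) :=
  ⟨by simp [h.1], by simpa using ⟨hb, h.2⟩⟩

theorem WordOK.of_cons {N n : ℕ} {b : Bit} {z : Word} (h : WordOK N n (b :: z)) :
    ∃ m, n = m + 1 ∧ b.Below N ∧ WordOK N m z :=
  ⟨z.length, h.1.symm, h.2 b (by simp), rfl, fun c hc => h.2 c (by simp [hc])⟩

theorem WordOK.append {N n m : ℕ} {y z : Word} (hy : WordOK N n y) (hz : WordOK N m z) :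
    WordOK N (n + m) (y ++ z) :=
  ⟨by simp [hy.1, hz.1], fun b hb => (List.mem_append.mp hb).elim (hy.2 b) (hz.2 b)⟩

theorem wordOK_replicate (N n : ℕ) (b : Bool) : WordOK N n (List.replicate n (.const b)) :=
  ⟨by simp, fun c hc => by rw [List.eq_of_mem_replicate hc]; trivial⟩

theorem WordOK.agree {N n : ℕ} {z : Word} (h : WordOK N n z) {x y : Asg} (hxy : Agree N x y) :
    valW x z = valW y z := by
  induction z generalizing n with
  | nil => rfl
  | cons b z ih =>
    obtain ⟨m, -, hb, hz⟩ := h.of_cons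
    simp only [valW, hb.agree hxy, ih hz]

theorem valW_lt_length (x : Asg) (z : Word) : valW x z < 2 ^ z.length := by
  induction z with
  | nil => simp [valW]
  | cons b z ih =>
    rw [valW, List.length_cons, pow_succ]
    have := Bool.toNat_le (b.val x)
    omega

theorem WordOK.lt {N n : ℕ} {z : Word} (h : WordOK N n z) (x : Asg) : valW x z < 2 ^ n :=
  h.1 ▸ valW_lt_length x z

theorem valW_append (x : Asg) (y z : Word) :
    valW x (y ++ z) = valW x y + 2 ^ y.length * valW x z := by
  induction y with
  | nil => simp [valW]
  | cons b y ih => rw [List.cons_append, valW, ih, valW, List.length_cons, pow_succ]; ring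

theorem valW_replicate_false (x : Asg) (n : ℕ) : valW x (List.replicate n (.const false)) = 0 := by
  induction n with
  | zero => rfl
  | succ n ih => simp [List.replicate_succ, valW, ih, Bit.val]

theorem valW_take (x : Asg) (n : ℕ) (z : Word) : valW x (z.take n) = valW x z % 2 ^ n := by
  induction n generalizing z with
  | zero => simp [valW, Nat.mod_one]
  | succ n ih =>
    cases z with
    | nil => simp [valW]
    | cons b z =>
      rw [List.take_succ_cons, valW, valW, ih, pow_succ', Nat.mod_mul]
      have := Bool.toNat_le (b.val x)
      rw [show ((b.val x).toNat + 2 * valW x z) % 2 = (b.val x).toNat by omega,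
        show ((b.val x).toNat + 2 * valW x z) / 2 = valW x z by omega]

theorem valW_drop (x : Asg) (n : ℕ) (z : Word) : valW x (z.drop n) = valW x z / 2 ^ n := by
  induction n generalizing z with
  | zero => simp
  | succ n ih =>
    cases z with
    | nil => simp [valW]
    | cons b z =>
      rw [List.drop_succ_cons, valW, ih, pow_succ', ← Nat.div_div_eq_div_mul]
      have := Bool.toNat_le (b.val x)
      rw [show ((b.val x).toNat + 2 * valW x z) / 2 = valW x z by omega]

theorem testBit_valW (x : Asg) (z : Word) (k : ℕ) :
    (valW x z).testBit k = (z.getD k (.const false)).val x := by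
  induction z generalizing k with
  | nil => simp [valW, Bit.val]
  | cons b z ih =>
    rw [valW]
    have := Bool.toNat_le (b.val x)
    cases k with
    | zero =>
      rw [Nat.testBit_zero, List.getD_cons_zero,
        show ((b.val x).toNat + 2 * valW x z) % 2 = (b.val x).toNat by omega]
      cases b.val x <;> rfl
    | succ k =>
      rw [Nat.testBit_succ, List.getD_cons_succ, ← ih,
        show ((b.val x).toNat + 2 * valW x z) / 2 = valW x z by omega]

theorem constWord_circ (q : QState) (w : ℕ) (b : Bool) :
    Circ q (constWord w b) w (fun _ z => z = List.replicate w (.const b)) (fun _ _ => True) :=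
  Circ.charge_pure rfl (fun _ => trivial) le_rfl

/-- The bits of the `w`-bit constant `c`. -/
def intBits (w : ℕ) (c : ℤ) : Word := (List.range w).map fun k => .const (c.testBit k)

theorem wordOK_intBits (N w : ℕ) (c : ℤ) : WordOK N w (intBits w c) := by
  refine ⟨by simp [intBits], fun b hb => ?_⟩
  obtain ⟨k, -, rfl⟩ := List.mem_map.mp hb
  trivial

theorem valW_intBits (x : Asg) (w : ℕ) (c : ℤ) :
    valW x (intBits w c) = (BitVec.ofInt w c).toNat := by
  apply Nat.eq_of_testBit_eq
  intro k
  rw [testBit_valW, BitVec.testBit_toNat, intBits]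
  by_cases hk : k < w
  · rw [List.getD_eq_getElem _ _ (by simpa using hk)]
    cases c with
    | ofNat n =>
      rw [Int.ofNat_eq_natCast, BitVec.ofInt_natCast, BitVec.getLsbD_ofNat]
      simp [Bit.val, hk, Int.testBit]
    | negSucc n =>
      rw [BitVec.ofInt_negSucc_eq_not_ofNat, BitVec.getLsbD_not, BitVec.getLsbD_ofNat]
      simp [Bit.val, hk, Int.testBit]
  · rw [List.getD_eq_default _ _ (by simpa using hk)]
    simp [Bit.val, Nat.le_of_not_lt hk]

theorem intWord_circ (q : QState) (w : ℕ) (c : ℤ) :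
    Circ q (intWord w c) w (fun N z => WordOK N w z)
      (fun x z => valW x z = (BitVec.ofInt w c).toNat) :=
  Circ.charge_pure (wordOK_intBits _ _ _) (fun x => valW_intBits x w c) le_rfl

/-- A new qubit can have any value. -/
theorem newQubit_spec {q : QState} {T : Asg → Prop} (hT : Stable q.qubits T) (b : Bool) :
    Spec q newQubit 1 (fun N i => i < N) T (fun x i => T x ∧ x i = b) (fun _ _ => True) := by
  refine ⟨⟨Nat.le_succ _, ?_, fun _ => le_rfl, ?_⟩, le_rfl, ⟨rfl, Nat.lt_succ_self _⟩,
    fun _ _ => trivial, ?_⟩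
  · intro hq t ht
    exact ⟨(hq t ht).1, (hq t ht).2.trans (Nat.lt_succ_self _)⟩
  · change q.qubits + 1 + q.terms.length + (List.map _ q.inputs).sum + q.steps ≤
      q.qubits + q.terms.length + (List.map _ q.inputs).sum + (q.steps + 1)
    omega
  · intro _ x hx
    have hag : Agree q.qubits x (Function.update x q.qubits b) := by
      intro i hi
      rw [Function.update_of_ne hi.ne]
    refine ⟨Function.update x q.qubits b, hag, ?_, hT _ _ hag hx, Function.update_self ..⟩
    change Qubo.value { q.toQubo with qubits := q.qubits + 1 } _ = _
    rfl

/-- New qubits can represent any number. -/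
theorem newQubits_spec {q : QState} {T : Asg → Prop} (hT : Stable q.qubits T) (w v : ℕ)
    (hv : v < 2 ^ w) :
    Free q (newQubits w) w (fun N qs => qs.length = w ∧ ∀ i ∈ qs, i < N) T
      (fun x qs => T x ∧ valW x (qs.map .qubit) = v) := by
  induction w generalizing q T v with
  | zero =>
    refine Spec.pure (by simp) (fun x hx => ⟨hx, ?_⟩) fun _ => trivial
    simp [valW]
    omega
  | succ w ih =>
    refine Free.bind (newQubit_spec hT (v.testBit 0)) (k₂ := w) (by omega) fun i q₁ l₁ hi => ?_
    -- The value of the first qubit is preserved while the others are created.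
    have hT' : Stable q₁.qubits fun x => T x ∧ x i = v.testBit 0 := by
      intro x y h hx
      exact ⟨hT x y (h.mono l₁) hx.1, by rw [← h i hi]; exact hx.2⟩
    refine Free.bind (ih hT' (v / 2) (by rw [pow_succ] at hv; omega)) (k₂ := 0) le_rfl
      fun qs q₂ l₂ hqs => Spec.pure ?_ ?_ fun _ => trivial
    · refine ⟨by simp [hqs.1], fun j hj => ?_⟩
      rcases List.mem_cons.mp hj with rfl | hj
      · exact lt_of_lt_of_le hi l₂
      · exact hqs.2 j hj
    · rintro x ⟨⟨h1, h2⟩, h3⟩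
      refine ⟨h1, ?_⟩
      rw [List.map_cons, valW, h3, Bit.val, h2, Nat.testBit_zero]
      rcases Nat.mod_two_eq_zero_or_one v with h | h <;> simp [h] <;> omega

theorem wordOK_qubits {N w : ℕ} {qs : List ℕ} (h : qs.length = w ∧ ∀ i ∈ qs, i < N) :
    WordOK N w (qs.map .qubit) := by
  refine ⟨by simp [h.1], fun b hb => ?_⟩
  obtain ⟨i, hi, rfl⟩ := List.mem_map.mp hb
  exact h.2 i hi

theorem newWord_spec {q : QState} {T : Asg → Prop} (hT : Stable q.qubits T) (w v : ℕ)
    (hv : v < 2 ^ w) :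
    Free q (newWord w) w (fun N z => WordOK N w z) T (fun x z => T x ∧ valW x z = v) :=
  Spec.map _ (newQubits_spec hT w v hv) (fun _ _ => wordOK_qubits) (fun _ _ => id) fun _ _ => id

/-- New words can represent any numbers. -/
theorem newWords_spec {q : QState} {T : Asg → Prop} (hT : Stable q.qubits T) (w m : ℕ) (v : ℕ → ℕ)
    (hv : ∀ a, v a < 2 ^ w) :
    Free q (newWords w m) (m * w) (fun N zs => zs.length = m ∧ ∀ z ∈ zs, WordOK N w z) T
      (fun x zs => T x ∧ ∀ a < m, valW x (zs.getD a []) = v a) := by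
  induction m generalizing q T v with
  | zero =>
    rw [Nat.zero_mul]
    exact Spec.pure (by simp) (fun x hx => ⟨hx, by simp⟩) fun _ => trivial
  | succ m ih =>
    refine Free.bind (newWord_spec hT w (v 0) (hv 0)) (k₂ := m * w) (by rw [Nat.succ_mul]; omega)
      fun z q₁ l₁ hz => ?_
    have hT' : Stable q₁.qubits fun x => T x ∧ valW x z = v 0 := by
      intro x y h hx
      exact ⟨hT x y (h.mono l₁) hx.1, by rw [← hz.agree h]; exact hx.2⟩
    refine Free.bind (ih hT' (fun a => v (a + 1)) fun a => hv _) (k₂ := 0) le_rfl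
      fun zs q₂ l₂ hzs => Spec.pure ?_ ?_ fun _ => trivial
    · refine ⟨by simp [hzs.1], fun j hj => ?_⟩
      rcases List.mem_cons.mp hj with rfl | hj
      · exact hz.mono l₂
      · exact hzs.2 j hj
    · rintro x ⟨⟨h1, h2⟩, h3⟩
      refine ⟨h1, fun a ha => ?_⟩
      cases a with
      | zero => exact h2
      | succ a => exact h3 a (by omega)

/-! ### Circuits on words -/

theorem notWord_circ {q : QState} {n : ℕ} {xs : Word} (h : WordOK q.qubits n xs) :
    Circ q (notWord xs) (6 * n) (fun N z => WordOK N n z)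
      (fun x z => valW x z + valW x xs + 1 = 2 ^ n) := by
  induction xs generalizing q n with
  | nil =>
    obtain rfl : 0 = n := h.1
    exact Circ.pure (wordOK_nil _) fun x => rfl
  | cons b xs ih =>
    obtain ⟨m, rfl, hb, h⟩ := h.of_cons
    refine Circ.le (Circ.bind (gNot_circ hb) fun c q₁ l₁ hc => Circ.bind (ih (h.mono l₁))
      fun z q₂ l₂ hz => Circ.pure (.cons (hc.mono l₂) hz) fun x h₁ h₂ => ?_)
      (by omega : 6 + (6 * m + 0) ≤ _)
    simp only [valW, h₂, pow_succ]
    cases b.val x <;> simp <;> omega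

theorem land_bit (a b : Bool) (m n : ℕ) :
    (a.toNat + 2 * m) &&& (b.toNat + 2 * n) = (a && b).toNat + 2 * (m &&& n) := by
  apply Nat.eq_of_testBit_eq
  intro k
  have e : ∀ (c : Bool) (l : ℕ), c.toNat + 2 * l = Nat.bit c l := by
    intro c l; cases c <;> simp only [Nat.bit, cond, Bool.toNat] <;> omega
  rw [e, e, e, Nat.testBit_land]
  cases k with
  | zero => simp
  | succ k => simp [Nat.testBit_bit_succ]

theorem andWord_circ {q : QState} {n : ℕ} {xs ys : Word} (h : WordOK q.qubits n xs)
    (h' : WordOK q.qubits n ys) :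
    Circ q (andWord xs ys) (6 * n) (fun N z => WordOK N n z)
      (fun x z => valW x z = valW x xs &&& valW x ys) := by
  induction xs generalizing q n ys with
  | nil =>
    obtain rfl : 0 = n := h.1
    obtain rfl : ys = [] := List.length_eq_zero_iff.mp h'.1
    exact Circ.pure (wordOK_nil _) fun x => (Nat.and_self _).symm
  | cons b xs ih =>
    obtain ⟨m, rfl, hb, h⟩ := h.of_cons
    obtain _ | ⟨c, ys⟩ := ys
    · cases h'.1
    obtain ⟨_, e, hc, h'⟩ := h'.of_cons
    cases e
    refine Circ.le (Circ.bind (gAnd_circ hb hc) fun d q₁ l₁ hd => Circ.bind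
      (ih (h.mono l₁) (h'.mono l₁)) fun z q₂ l₂ hz => Circ.pure (.cons (hd.mono l₂) hz)
        fun x h₁ h₂ => ?_) (by omega : 6 + (6 * m + 0) ≤ _)
    simp only [valW, h₁, h₂, land_bit]

theorem iteWord_circ {q : QState} {n : ℕ} {c : Bit} {xs ys : Word} (hc : c.Below q.qubits)
    (h : WordOK q.qubits n xs) (h' : WordOK q.qubits n ys) :
    Circ q (iteWord c xs ys) (21 * n) (fun N z => WordOK N n z)
      (fun x z => valW x z = if c.val x then valW x xs else valW x ys) := by
  induction xs generalizing q n ys with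
  | nil =>
    obtain rfl : 0 = n := h.1
    obtain rfl : ys = [] := List.length_eq_zero_iff.mp h'.1
    exact Circ.pure (wordOK_nil _) fun x => by simp
  | cons a xs ih =>
    obtain ⟨m, rfl, ha, h⟩ := h.of_cons
    obtain _ | ⟨b, ys⟩ := ys
    · cases h'.1
    obtain ⟨_, e, hb, h'⟩ := h'.of_cons
    cases e
    refine Circ.le (Circ.bind (gIte_circ hc ha hb) fun d q₁ l₁ hd => Circ.bind
      (ih (hc.mono l₁) (h.mono l₁) (h'.mono l₁)) fun z q₂ l₂ hz =>
        Circ.pure (.cons (hd.mono l₂) hz) fun x h₁ h₂ => ?_) (by omega : 21 + (21 * m + 0) ≤ _)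
    simp only [valW, h₁, h₂]
    cases c.val x <;> simp

theorem iteWords_circ {q : QState} {e : ℕ} {c : Bit} {xs ys : Words} (hc : c.Below q.qubits)
    (hl : xs.length = ys.length) (h : ∀ z ∈ xs, WordOK q.qubits e z)
    (h' : ∀ z ∈ ys, WordOK q.qubits e z) :
    Circ q (iteWords c xs ys) (xs.length * (21 * e + 1))
      (fun N zs => zs.length = xs.length ∧ ∀ z ∈ zs, WordOK N e z)
      (fun x zs => ∀ a, valW x (zs.getD a []) =
        if c.val x then valW x (xs.getD a []) else valW x (ys.getD a [])) := by
  induction xs generalizing q ys with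
  | nil =>
    obtain rfl : ys = [] := List.length_eq_zero_iff.mp hl.symm
    exact Circ.le (Circ.pure (by simp) fun x a => by simp) (Nat.zero_le _)
  | cons a xs ih =>
    obtain _ | ⟨b, ys⟩ := ys
    · cases hl
    refine Circ.charge_bind (k := 21 * e + (xs.length * (21 * e + 1) + 0)) (fun q₀ e₀ => ?_)
      (by rw [List.length_cons, Nat.succ_mul xs.length]; omega)
    rw [← e₀] at hc h h'
    refine Circ.bind (iteWord_circ hc (h a (by simp)) (h' b (by simp))) fun d q₁ l₁ hd =>
      Circ.bind (ih (hc.mono l₁) (by simpa using hl)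
        (fun z hz => (h z (by simp [hz])).mono l₁) (fun z hz => (h' z (by simp [hz])).mono l₁))
      fun zs q₂ l₂ hzs => Circ.pure ⟨by simp [hzs.1], ?_⟩ fun x h₁ h₂ i => ?_
    · intro z hz
      rcases List.mem_cons.mp hz with rfl | hz
      · exact hd.mono l₂
      · exact hzs.2 z hz
    · cases i with
      | zero => exact h₂
      | succ i => exact h₁ i

theorem allOne_circ {q : QState} {n : ℕ} {xs : Word} (h : WordOK q.qubits n xs) :
    Circ q (allOne xs) (6 * n) (fun N z => z.Below N)
      (fun x z => z.val x = decide (valW x xs + 1 = 2 ^ n)) := by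
  induction xs generalizing q n with
  | nil =>
    obtain rfl : 0 = n := h.1
    exact Circ.pure trivial fun x => rfl
  | cons b xs ih =>
    obtain ⟨m, rfl, hb, h⟩ := h.of_cons
    refine Circ.le (Circ.bind (ih h) fun c q₁ l₁ hc => (gAnd_circ (hb.mono l₁) hc).imp
      (fun _ _ => id) fun _ x z _ h₁ h₂ => ?_) (by omega : 6 * m + 6 ≤ _)
    rw [h₁, h₂, valW, pow_succ]
    cases b.val x
    · simp; omega
    · simp; omega

theorem someOne_circ {q : QState} {n : ℕ} {xs : Word} (h : WordOK q.qubits n xs) :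
    Circ q (someOne xs) (8 * n) (fun N z => z.Below N)
      (fun x z => z.val x = decide (valW x xs ≠ 0)) := by
  induction xs generalizing q n with
  | nil =>
    obtain rfl : 0 = n := h.1
    exact Circ.pure trivial fun x => rfl
  | cons b xs ih =>
    obtain ⟨m, rfl, hb, h⟩ := h.of_cons
    refine Circ.le (Circ.bind (ih h) fun c q₁ l₁ hc => (gOr_circ (hb.mono l₁) hc).imp
      (fun _ _ => id) fun _ x z _ h₁ h₂ => ?_) (by omega : 8 * m + 8 ≤ _)
    rw [h₁, h₂, valW]
    cases b.val x <;> simp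

theorem eqWord_circ {q : QState} {n : ℕ} {xs ys : Word} (h : WordOK q.qubits n xs)
    (h' : WordOK q.qubits n ys) :
    Circ q (eqWord xs ys) (30 * n) (fun N z => z.Below N)
      (fun x z => z.val x = decide (valW x xs = valW x ys)) := by
  induction xs generalizing q n ys with
  | nil =>
    obtain rfl : 0 = n := h.1
    obtain rfl : ys = [] := List.length_eq_zero_iff.mp h'.1
    exact Circ.pure trivial fun x => by simp [Bit.val]
  | cons a xs ih =>
    obtain ⟨m, rfl, ha, h⟩ := h.of_cons
    obtain _ | ⟨b, ys⟩ := ys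
    · cases h'.1
    obtain ⟨_, e, hb, h'⟩ := h'.of_cons
    cases e
    refine Circ.le (Circ.bind (gXor_circ ha hb) fun d q₁ l₁ hd => Circ.bind
      (ih (h.mono l₁) (h'.mono l₁)) fun c q₂ l₂ hc => (gInhibit_circ (hd.mono l₂) hc).imp
        (fun _ _ => id) fun _ x z _ h₁ h₂ h₃ => ?_) (by omega : 23 + (30 * m + 7) ≤ _)
    rw [h₁, h₂, h₃, valW, valW]
    cases a.val x <;> cases b.val x <;> simp <;> omega

theorem addCarry_circ {q : QState} {n : ℕ} {xs ys : Word} {c : Bit} (h : WordOK q.qubits n xs)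
    (h' : WordOK q.qubits n ys) (hc : c.Below q.qubits) :
    Circ q (addCarry xs ys c) (66 * n) (fun N z => WordOK N n z.1 ∧ z.2.Below N)
      (fun x z => valW x z.1 + 2 ^ n * (z.2.val x).toNat =
        valW x xs + valW x ys + (c.val x).toNat) := by
  induction xs generalizing q n ys c with
  | nil =>
    obtain rfl : 0 = n := h.1
    obtain rfl : ys = [] := List.length_eq_zero_iff.mp h'.1
    exact Circ.pure ⟨wordOK_nil _, hc⟩ fun x => by simp [valW]
  | cons a xs ih =>
    obtain ⟨m, rfl, ha, h⟩ := h.of_cons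
    obtain _ | ⟨b, ys⟩ := ys
    · cases h'.1
    obtain ⟨_, e, hb, h'⟩ := h'.of_cons
    cases e
    refine Circ.le (Circ.bind (gXor_circ ha hb) fun d q₁ l₁ hd => Circ.bind
      (gXor_circ hd (hc.mono l₁)) fun s q₂ l₂ hs => Circ.bind
      (gAnd_circ (ha.mono (l₁.trans l₂)) (hb.mono (l₁.trans l₂))) fun u q₃ l₃ hu => Circ.bind
      (gAnd_circ (hd.mono (l₂.trans l₃)) (hc.mono ((l₁.trans l₂).trans l₃))) fun v q₄ l₄ hv =>
      Circ.bind (gOr_circ (hu.mono l₄) hv) fun o q₅ l₅ ho => Circ.bind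
      (ih (h.mono (by omega)) (h'.mono (by omega)) ho) fun z q₆ l₆ hz => ?_)
      (by omega : 23 + (23 + (6 + (6 + (8 + (66 * m + 0))))) ≤ _)
    obtain ⟨z, o'⟩ := z
    refine Circ.pure ⟨.cons (hs.mono (by omega)) hz.1, hz.2⟩ fun x e₁ e₂ e₃ e₄ e₅ e₆ => ?_
    simp only at e₁ ⊢
    rw [valW, valW, valW, pow_succ, e₅, e₆]
    rw [e₂, e₃, e₄, e₆] at e₁
    rw [mul_comm (2 ^ m) 2, mul_assoc]
    revert e₁
    generalize 2 ^ m * _ = t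
    cases a.val x <;> cases b.val x <;> cases c.val x <;> simp <;> omega

theorem subCarry_circ {q : QState} {n : ℕ} {xs ys : Word} (h : WordOK q.qubits n xs)
    (h' : WordOK q.qubits n ys) :
    Circ q (subCarry xs ys) (72 * n) (fun N z => WordOK N n z.1 ∧ z.2.Below N)
      (fun x z => valW x z.1 + 2 ^ n * (z.2.val x).toNat + valW x ys = valW x xs + 2 ^ n) := by
  refine Circ.le (Circ.bind (notWord_circ h') fun z q₁ l₁ hz => (addCarry_circ (h.mono l₁) hz
    (c := .const true) trivial).imp (fun _ _ => id) fun _ x s _ h₁ h₂ => ?_)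
    (by omega : 6 * n + 66 * n ≤ _)
  simp only [Bit.val_const, Bool.toNat_true] at h₁
  omega

theorem ltWord_circ {q : QState} {n : ℕ} {xs ys : Word} (h : WordOK q.qubits n xs)
    (h' : WordOK q.qubits n ys) :
    Circ q (ltWord xs ys) (72 * n + 6) (fun N z => z.Below N)
      (fun x z => z.val x = decide (valW x xs < valW x ys)) := by
  refine Circ.bind (subCarry_circ h h') fun z q₁ l₁ hz => ?_
  obtain ⟨s, o⟩ := z
  refine (gNot_circ hz.2).imp (fun _ _ => id) fun _ x s' _ h₁ h₂ => ?_
  have h₃ := hz.1.lt x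
  have h₄ := h.lt x
  have h₅ := h'.lt x
  rw [h₁]
  simp only at h₂ h₃
  revert h₂
  cases o.val x <;> simp <;> omega

/-- Multiplication by shifting and adding, modulo `2 ^ n`. -/
theorem mulAdd_circ {q : QState} {n l : ℕ} {xs ys acc : Word} (h : WordOK q.qubits n xs)
    (h' : WordOK q.qubits l ys) (ha : WordOK q.qubits n acc) :
    Circ q (mulAdd xs ys acc) (l * (89 * n)) (fun N z => WordOK N n z)
      (fun x z => valW x z = (valW x acc + valW x xs * valW x ys) % 2 ^ n) := by
  induction ys generalizing q l xs acc with
  | nil =>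
    obtain rfl : 0 = l := h'.1
    exact Circ.le (Circ.pure ha fun x => by
      rw [valW, Nat.mul_zero, Nat.add_zero, Nat.mod_eq_of_lt (ha.lt x)]) (Nat.zero_le _)
  | cons y ys ih =>
    obtain ⟨m, rfl, hy, h'⟩ := h'.of_cons
    have hn := h.1
    refine Circ.le (Circ.bind (constWord_circ q _ false) fun z₀ q₁ l₁ hz₀ => Circ.bind
      (iteWord_circ (hy.mono l₁) (h.mono l₁) (by rw [hz₀, hn]; exact wordOK_replicate _ _ _))
      fun r q₂ l₂ hr => Circ.bind (addCarry_circ (c := .const false) (ha.mono (l₁.trans l₂)) hr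
        trivial) fun s q₃ l₃ hs => ?_)
      (by rw [hn, Nat.succ_mul m]; omega : xs.length + (21 * n + (66 * n + (m * (89 * n) + n))) ≤ _)
    obtain ⟨s, o⟩ := s
    have hd : WordOK q₃.qubits n (Bit.const false :: xs).dropLast := by
      refine ⟨by simp [hn], fun b hb => ?_⟩
      rcases List.mem_cons.mp (List.mem_of_mem_dropLast hb) with rfl | hb
      · trivial
      · exact (h.2 b hb).mono (by omega)
    refine Circ.charge_bind (k := m * (89 * n)) (fun q₄ e₄ => ?_) (by omega)
    refine (ih (by rw [e₄]; exact hd) (h'.mono (by omega)) (by rw [e₄]; exact hs.1)).imp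
      (fun _ _ => id) fun _ x z _ e₁ e₂ e₃ e₅ => ?_
    have hdv : valW x (Bit.const false :: xs).dropLast = 2 * valW x xs % 2 ^ n := by
      rw [List.dropLast_eq_take, valW_take, List.length_cons, Nat.add_sub_cancel, hn, valW]
      simp [Bit.val]
    rw [e₁, hdv]
    simp only [Bit.val_const, Bool.toNat_false, Nat.add_zero] at e₂
    have e₆ : valW x s ≡ valW x acc + (y.val x).toNat * valW x xs [MOD 2 ^ n] := by
      have : valW x s ≡ valW x s + 2 ^ n * (o.val x).toNat [MOD 2 ^ n] := by
        simp [Nat.ModEq]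
      refine this.trans ?_
      rw [e₂, e₃, hz₀, valW_replicate_false]
      cases y.val x <;> simp <;> rfl
    have e₇ : 2 * valW x xs % 2 ^ n * valW x ys ≡ 2 * valW x xs * valW x ys [MOD 2 ^ n] :=
      (Nat.mod_modEq _ _).mul_right _
    refine (e₆.add e₇).trans ?_
    rw [valW]
    refine congrArg (· % 2 ^ n) ?_
    ring

/-! ### Division -/

/-- Is `q * y + r = x`, in twice the number of bits? -/
def checkProduct (w : ℕ) (x y q r : Word) : QM Bit := do
  let zero ← constWord w false
  let zero₂ ← constWord (2 * w) false
  charge (6 * w)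
  let p ← mulAdd (y ++ zero) q zero₂
  let (s, _) ← addCarry p (r ++ zero) (.const false)
  eqWord s (x ++ zero)

/-- Is `r < y`, or all bits of `q` are `1` if `y` is zero? -/
def checkRemainder (y q r : Word) : QM Bit := do
  let nonzero ← someOne y
  let lt ← ltWord r y
  let ones ← allOne q
  gIte nonzero lt ones

/-- Division consists of new words and the constraints `checkProduct` and `checkRemainder`. -/
theorem divWord_eq (w : ℕ) (x y : Word) : divWord w x y = (do
    let q ← newWord w
    let r ← newWord w
    let e ← checkProduct w x y q r
    assertTrue e
    let ok ← checkRemainder y q r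
    assertTrue ok
    return (q, r)) := rfl

theorem checkProduct_circ {s : QState} {w : ℕ} {x y q r : Word} (hx : WordOK s.qubits w x)
    (hy : WordOK s.qubits w y) (hq : WordOK s.qubits w q) (hr : WordOK s.qubits w r) :
    Circ s (checkProduct w x y q r) (201 * w + w * (89 * (2 * w))) (fun N z => z.Below N)
      (fun a z => z.val a = decide (valW a q * valW a y + valW a r = valW a x)) := by
  refine Circ.le (Circ.bind (constWord_circ s w false) fun zero s₁ l₁ h₁ => Circ.bind
    (constWord_circ s₁ (2 * w) false) fun zero₂ s₂ l₂ h₂ => Circ.charge_bind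
      (k := w * (89 * (2 * w)) + (66 * (2 * w) + 30 * (2 * w))) (fun s₃ e₃ => ?_) le_rfl)
      (by omega)
  have hz : WordOK s₃.qubits w zero := by rw [h₁]; exact wordOK_replicate _ _ _
  have pad : ∀ {z : Word}, WordOK s.qubits w z → WordOK s₃.qubits (2 * w) (z ++ zero) := by
    intro z h
    rw [two_mul]
    exact (h.mono (by omega)).append hz
  refine Circ.bind (mulAdd_circ (pad hy) (hq.mono (by omega))
    (by rw [h₂]; exact wordOK_replicate _ _ _)) fun p s₄ l₄ h₄ => Circ.bind
    (addCarry_circ (c := .const false) h₄ ((pad hr).mono l₄) trivial) fun t s₅ l₅ h₅ => ?_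
  obtain ⟨t, o⟩ := t
  refine (eqWord_circ h₅.1 ((pad hx).mono (l₄.trans l₅))).imp (fun _ _ => id)
    fun _ a z _ e₁ e₂ e₃ _ _ => ?_
  have hv : ∀ z : Word, valW a (z ++ zero) = valW a z := by
    intro z
    rw [valW_append, h₁, valW_replicate_false, Nat.mul_zero, Nat.add_zero]
  -- The product and the sum do not overflow in `2 * w` bits.
  have hqy : valW a q * valW a y + valW a r < 2 ^ (2 * w) := by
    have h1 := hq.lt a
    have h2 := hy.lt a
    have h3 := hr.lt a
    have h4 : valW a q * valW a y + valW a q ≤ 2 ^ w * (2 ^ w - 1) + (2 ^ w - 1) - (2 ^ w - 1) := by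
      calc valW a q * valW a y + valW a q = valW a q * (valW a y + 1) := by ring
        _ ≤ (2 ^ w - 1) * 2 ^ w := Nat.mul_le_mul (by omega) h2
        _ = _ := by rw [Nat.add_sub_cancel, Nat.mul_comm]
    rw [two_mul, pow_add]
    have h5 : 2 ^ w * (2 ^ w - 1) + 2 ^ w = 2 ^ w * 2 ^ w := by
      rw [Nat.mul_sub, Nat.mul_one, Nat.sub_add_cancel (Nat.le_mul_self _)]
    omega
  have h₆ := h₅.1.lt a
  rw [e₁, hv]
  simp only [hv, h₂, valW_replicate_false, Bit.val_const, Bool.toNat_false, Nat.zero_add,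
    Nat.add_zero] at e₂ e₃ h₆
  rw [Nat.mul_comm (valW a y), Nat.mod_eq_of_lt (by omega)] at e₃
  rw [e₃] at e₂
  have ho : o.val a = false := by
    cases h : o.val a
    · rfl
    · rw [h] at e₂
      simp at e₂
      omega
  rw [ho] at e₂
  simp at e₂
  rw [e₂]

theorem checkRemainder_circ {s : QState} {w : ℕ} {y q r : Word}
    (hy : WordOK s.qubits w y) (hq : WordOK s.qubits w q) (hr : WordOK s.qubits w r) :
    Circ s (checkRemainder y q r) (86 * w + 27) (fun N z => z.Below N)
      (fun a z => z.val a = decide (if valW a y ≠ 0 then valW a r < valW a y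
        else valW a q + 1 = 2 ^ w)) := by
  refine Circ.le (Circ.bind (someOne_circ hy) fun n s₁ l₁ h₁ => Circ.bind
    (ltWord_circ (hr.mono l₁) (hy.mono l₁)) fun l s₂ l₂ h₂ => Circ.bind
    (allOne_circ (hq.mono (l₁.trans l₂))) fun o s₃ l₃ h₃ =>
      (gIte_circ (h₁.mono (by omega)) (h₂.mono l₃) h₃).imp (fun _ _ => id)
        fun _ a z _ e₁ e₂ e₃ e₄ => ?_) (by omega : 8 * w + (72 * w + 6 + (6 * w + 21)) ≤ _)
  rw [e₁, e₂, e₃, e₄]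
  by_cases h : valW a y = 0 <;> simp [h]

/-- Division is a circuit although it is built from constraints: for any operands, the constraints
have exactly one solution. -/
theorem divWord_circ {q : QState} {w : ℕ} {x y : Word} (hx : WordOK q.qubits w x)
    (hy : WordOK q.qubits w y) :
    Circ q (divWord w x y) (289 * w + w * (89 * (2 * w)) + 31)
      (fun N z => WordOK N w z.1 ∧ WordOK N w z.2)
      (fun a z => if valW a y = 0 then valW a z.1 = 2 ^ w - 1 ∧ valW a z.2 = valW a x
        else valW a z.1 = valW a x / valW a y ∧ valW a z.2 = valW a x % valW a y) := by
  -- The values of the operands are fixed first, since they determine those of the new words.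
  have key : ∀ X Y : ℕ, X < 2 ^ w → Spec q (divWord w x y) (289 * w + w * (89 * (2 * w)) + 31)
      (fun N z => WordOK N w z.1 ∧ WordOK N w z.2) (fun a => valW a x = X ∧ valW a y = Y)
      (fun _ _ => True)
      (fun a z => if valW a y = 0 then valW a z.1 = 2 ^ w - 1 ∧ valW a z.2 = valW a x
        else valW a z.1 = valW a x / valW a y ∧ valW a z.2 = valW a x % valW a y) := by
    intro X Y hX
    rw [divWord_eq]
    have hw : 0 < 2 ^ w := by positivity
    -- Quotient and remainder for the values `X` and `Y`, with the conventions of BTOR2 for `Y = 0`.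
    obtain ⟨U, hU⟩ : ∃ U, U = if Y = 0 then 2 ^ w - 1 else X / Y := ⟨_, rfl⟩
    obtain ⟨R, hR⟩ : ∃ R, R = if Y = 0 then X else X % Y := ⟨_, rfl⟩
    have hU' : U < 2 ^ w := by
      rw [hU]
      split_ifs
      · omega
      · exact (Nat.div_le_self _ _).trans_lt hX
    have hR' : R < 2 ^ w := by
      rw [hR]
      split_ifs
      · omega
      · exact (Nat.mod_le _ _).trans_lt hX
    refine Spec.le (k := w + (w + (201 * w + w * (89 * (2 * w)) + (2 + (86 * w + 27 + (2 + 0))))))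
      ?_ (by omega)
    refine Spec.bind (newWord_spec ?_ w U hU') fun u q₁ l₁ hu => ?_
    · intro a b h hab
      rwa [← hx.agree h, ← hy.agree h]
    refine Spec.bind ((newWord_spec ?_ w R hR').pre fun _ h => h.2) fun r q₂ l₂ hr => ?_
    · intro a b h hab
      rwa [← (hx.mono l₁).agree h, ← (hy.mono l₁).agree h, ← hu.agree h]
    -- From here on, `x`, `y`, `u` and `r` keep their values.
    have hT : ∀ N, q₂.qubits ≤ N → Stable N fun a =>
        ((valW a x = X ∧ valW a y = Y) ∧ valW a u = U) ∧ valW a r = R := by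
      intro N hN a b h hab
      rwa [← (hx.mono (l₁.trans (l₂.trans hN))).agree h,
        ← (hy.mono (l₁.trans (l₂.trans hN))).agree h, ← (hu.mono (l₂.trans hN)).agree h,
        ← (hr.mono hN).agree h]
    refine Spec.bind (((checkProduct_circ (hx.mono (l₁.trans l₂)) (hy.mono (l₁.trans l₂))
      (hu.mono l₂) hr).frame (hT _ le_rfl)).pre fun _ h => h.2) fun e q₃ l₃ he => ?_
    refine Spec.bind (((assertTrue_spec he).frame (hT _ l₃)).pre fun a h => ⟨?_, h.2⟩)
      fun _ q₄ l₄ _ => ?_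
    · obtain ⟨h1, ⟨⟨h2, h3⟩, h4⟩, h5⟩ := h
      rw [h1, h2, h3, h4, h5, hU, hR]
      by_cases hY : Y = 0
      · simp [hY]
      · simp [hY, Nat.div_add_mod']
    refine Spec.bind (((checkRemainder_circ (hy.mono (by omega)) (hu.mono (by omega))
      (hr.mono (by omega))).frame (hT _ (l₃.trans l₄))).pre fun _ h => h.2.2) fun o q₅ l₅ ho => ?_
    refine Spec.bind ((assertTrue_spec ho).pre fun a h => ?_) fun _ q₆ l₆ _ => Spec.pure
      ⟨hu.mono (by omega), hr.mono (by omega)⟩ (fun _ _ => trivial) fun a => ?_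
    · obtain ⟨h1, ⟨⟨h2, h3⟩, h4⟩, h5⟩ := h
      rw [h1, h3, h4, h5, hU, hR]
      by_cases hY : Y = 0
      · simp [hY]; omega
      · simp [hY, Nat.mod_lt _ (Nat.pos_of_ne_zero hY)]
    · intro h₁ h₂ h₃ h₄ _ _
      rw [h₁] at h₂
      rw [h₃] at h₄
      have h₅ := of_decide_eq_true h₂.symm
      have h₆ := of_decide_eq_true h₄.symm
      by_cases hY : valW a y = 0
      · rw [if_neg (by simpa using hY)] at h₅
        rw [hY] at h₆
        rw [if_pos hY]
        have h₇ : valW a u = 2 ^ w - 1 := by omega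
        exact ⟨h₇, by simpa using h₆⟩
      · rw [if_pos hY] at h₅
        rw [if_neg hY, eq_comm, eq_comm (a := valW a r), Nat.div_mod_unique
          (Nat.pos_of_ne_zero hY)]
        exact ⟨by rw [← h₆]; ring, h₅⟩
  refine ⟨(key 0 0 (by positivity)).grows, (key 0 0 (by positivity)).steps,
    (key 0 0 (by positivity)).valid, (key 0 0 (by positivity)).sound, fun hq a _ => ?_⟩
  exact (key _ _ (hx.lt a)).total hq a ⟨rfl, rfl⟩

/-! ### Memory access -/

theorem toNat_ofInt_natCast {k a : ℕ} (h : a < 2 ^ k) : (BitVec.ofInt k (a : ℤ)).toNat = a := by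
  rw [BitVec.ofInt_natCast, BitVec.toNat_ofNat, Nat.mod_eq_of_lt h]

theorem readWord_circ {q : QState} {k e a : ℕ} {idx acc : Word} {xs : Words}
    (hi : WordOK q.qubits k idx) (hxs : ∀ z ∈ xs, WordOK q.qubits e z)
    (hacc : WordOK q.qubits e acc)
    (ha : a + xs.length ≤ 2 ^ k) :
    Circ q (readWord k idx a xs acc) (xs.length * (31 * k + 21 * e)) (fun N z => WordOK N e z)
      (fun x z => valW x z = if a ≤ valW x idx ∧ valW x idx < a + xs.length then
        valW x (xs.getD (valW x idx - a) []) else valW x acc) := by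
  induction xs generalizing q a acc with
  | nil =>
    refine Circ.le (Circ.pure hacc fun x => ?_) (Nat.zero_le _)
    rw [if_neg (by simp)]
  | cons z xs ih =>
    rw [List.length_cons] at ha ⊢
    refine Circ.le (Circ.bind (intWord_circ q k a) fun c q₁ l₁ hc => Circ.bind
      (eqWord_circ (hi.mono l₁) hc) fun b q₂ l₂ hb => Circ.bind
      (iteWord_circ hb ((hxs z (by simp)).mono (l₁.trans l₂)) (hacc.mono (l₁.trans l₂)))
      fun d q₃ l₃ hd => (ih (hi.mono (by omega))
        (fun z hz => (hxs z (by simp [hz])).mono (by omega))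
        hd (by omega)).imp (fun _ _ => id) fun _ x r _ e₁ e₂ e₃ e₄ => ?_)
      (by rw [Nat.succ_mul xs.length]; omega :
        k + (30 * k + (21 * e + xs.length * (31 * k + 21 * e))) ≤ _)
    rw [toNat_ofInt_natCast (by omega)] at e₄
    rw [e₄] at e₃
    rw [e₁, e₂, e₃]
    rcases lt_trichotomy (valW x idx) a with h | h | h
    · rw [if_neg (by omega), if_neg (by simpa using h.ne), if_neg (by omega)]
    · rw [if_neg (by omega), if_pos (by simpa using h), if_pos (by omega), h, Nat.sub_self]
      rfl
    · by_cases h' : valW x idx < a + (xs.length + 1)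
      · rw [if_pos (by omega), if_pos (by omega),
          show valW x idx - a = valW x idx - (a + 1) + 1 by omega]
        rfl
      · rw [if_neg (by omega), if_neg (by simpa using h.ne'), if_neg (by omega)]

theorem writeWord_circ {q : QState} {k e a : ℕ} {idx val : Word} {xs : Words}
    (hi : WordOK q.qubits k idx) (hxs : ∀ z ∈ xs, WordOK q.qubits e z)
    (hval : WordOK q.qubits e val)
    (ha : a + xs.length ≤ 2 ^ k) :
    Circ q (writeWord k idx val a xs) (xs.length * (31 * k + 21 * e))
      (fun N zs => zs.length = xs.length ∧ ∀ z ∈ zs, WordOK N e z)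
      (fun x zs => ∀ i < xs.length, valW x (zs.getD i []) =
        if a + i = valW x idx then valW x val else valW x (xs.getD i [])) := by
  induction xs generalizing q a with
  | nil => exact Circ.le (Circ.pure (by simp) fun x => by simp) (Nat.zero_le _)
  | cons z xs ih =>
    rw [List.length_cons] at ha ⊢
    refine Circ.le (Circ.bind (intWord_circ q k a) fun c q₁ l₁ hc => Circ.bind
      (eqWord_circ (hi.mono l₁) hc) fun b q₂ l₂ hb => Circ.bind
      (iteWord_circ hb (hval.mono (l₁.trans l₂)) ((hxs z (by simp)).mono (l₁.trans l₂)))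
      fun d q₃ l₃ hd => Circ.bind (ih (hi.mono (by omega))
        (fun z hz => (hxs z (by simp [hz])).mono (by omega))
        (hval.mono (by omega)) (by omega : a + 1 + _ ≤ _)) fun zs q₄ l₄ hzs =>
        Circ.pure ⟨by simp [hzs.1], ?_⟩ fun x e₁ e₂ e₃ e₄ => ?_)
      (by rw [Nat.succ_mul xs.length]; omega :
        k + (30 * k + (21 * e + (xs.length * (31 * k + 21 * e) + 0))) ≤ _)
    · intro y hy
      rcases List.mem_cons.mp hy with rfl | hy
      · exact hd.mono l₄
      · exact hzs.2 y hy
    · rw [toNat_ofInt_natCast (by omega)] at e₄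
      rw [e₄] at e₃
      intro i hi
      cases i with
      | zero =>
        rw [List.getD_cons_zero, List.getD_cons_zero, e₂, e₃]
        simp [eq_comm]
      | succ i =>
        rw [List.getD_cons_succ, List.getD_cons_succ, e₁ i (by omega)]
        simp only [show a + 1 + i = a + (i + 1) by omega]

/-! ### Circuits for the operators -/

theorem toNat_ofNat_valW {N w : ℕ} {z : Word} (h : WordOK N w z) (a : Asg) :
    (BitVec.ofNat w (valW a z)).toNat = valW a z := by
  rw [BitVec.toNat_ofNat, Nat.mod_eq_of_lt (h.lt a)]

theorem add_eq_mod {n s c t : ℕ} (hs : s < 2 ^ n) (h : s + 2 ^ n * c = t) : s = t % 2 ^ n := by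
  rw [← h, Nat.add_mul_mod_self_left, Nat.mod_eq_of_lt hs]

theorem buildBinary_circ {q : QState} (op : BinOp) {w : ℕ} {x y : Word}
    (hx : WordOK q.qubits w x) (hy : WordOK q.qubits w y) :
    Circ q (buildBinary op w x y) (300 * w + w * (89 * (2 * w)) + 31) (fun N z => WordOK N w z)
      (fun a z => BitVec.ofNat w (valW a z) =
        op.eval (BitVec.ofNat w (valW a x)) (BitVec.ofNat w (valW a y))) := by
  cases op with
  | add =>
    refine Circ.le (Circ.bind (addCarry_circ (c := .const false) hx hy trivial) fun z q₁ l₁ hz =>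
      Circ.pure hz.1 fun a e => ?_) (by omega : 66 * w + 0 ≤ _)
    apply BitVec.eq_of_toNat_eq
    rw [BinOp.eval, BitVec.toNat_add, toNat_ofNat_valW hz.1, toNat_ofNat_valW hx,
      toNat_ofNat_valW hy]
    simp only [Bit.val_const, Bool.toNat_false, Nat.add_zero] at e
    exact add_eq_mod (hz.1.lt a) e
  | sub =>
    refine Circ.le (Circ.bind (subCarry_circ hx hy) fun z q₁ l₁ hz =>
      Circ.pure hz.1 fun a e => ?_) (by omega : 72 * w + 0 ≤ _)
    apply BitVec.eq_of_toNat_eq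
    rw [BinOp.eval, BitVec.toNat_sub, toNat_ofNat_valW hz.1, toNat_ofNat_valW hx,
      toNat_ofNat_valW hy]
    have := hy.lt a
    exact add_eq_mod (c := (z.2.val a).toNat) (hz.1.lt a) (by omega)
  | mul =>
    refine Circ.le (Circ.bind (constWord_circ q w false) fun z q₁ l₁ hz =>
      (mulAdd_circ (hx.mono l₁) (hy.mono l₁) (by rw [hz]; exact wordOK_replicate _ _ _)).imp
        (fun _ _ => id) fun _ a r hr e _ => ?_) (by
          have : w * (89 * w) ≤ w * (89 * (2 * w)) := Nat.mul_le_mul_left _ (by omega)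
          omega : w + w * (89 * w) ≤ _)
    apply BitVec.eq_of_toNat_eq
    rw [BinOp.eval, BitVec.toNat_mul, toNat_ofNat_valW hr, toNat_ofNat_valW hx,
      toNat_ofNat_valW hy, e, hz, valW_replicate_false, Nat.zero_add]
  | udiv =>
    refine Circ.le (Circ.bind (divWord_circ hx hy) fun z q₁ l₁ hz =>
      Circ.pure hz.1 fun a e => ?_) (by omega : _ + 0 ≤ _)
    have h0 : BitVec.ofNat w (valW a y) = 0#w ↔ valW a y = 0 := by
      rw [← BitVec.toNat_inj, toNat_ofNat_valW hy, BitVec.toNat_zero]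
    apply BitVec.eq_of_toNat_eq
    rw [BinOp.eval, toNat_ofNat_valW hz.1]
    by_cases h : valW a y = 0
    · rw [if_pos h] at e
      rw [if_pos (h0.mpr h), e.1, BitVec.toNat_allOnes]
    · rw [if_neg h] at e
      rw [if_neg (h0.not.mpr h), e.1, BitVec.toNat_udiv, toNat_ofNat_valW hx, toNat_ofNat_valW hy]
  | urem =>
    refine Circ.le (Circ.bind (divWord_circ hx hy) fun z q₁ l₁ hz =>
      Circ.pure hz.2 fun a e => ?_) (by omega : _ + 0 ≤ _)
    have h0 : BitVec.ofNat w (valW a y) = 0#w ↔ valW a y = 0 := by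
      rw [← BitVec.toNat_inj, toNat_ofNat_valW hy, BitVec.toNat_zero]
    apply BitVec.eq_of_toNat_eq
    rw [BinOp.eval, toNat_ofNat_valW hz.2]
    by_cases h : valW a y = 0
    · rw [if_pos h] at e
      rw [if_pos (h0.mpr h), e.2, toNat_ofNat_valW hx]
    · rw [if_neg h] at e
      rw [if_neg (h0.not.mpr h), e.2, BitVec.toNat_umod, toNat_ofNat_valW hx, toNat_ofNat_valW hy]
  | and =>
    refine Circ.le ((andWord_circ hx hy).imp (fun _ _ => id) fun _ a r hr e => ?_)
      (by omega : 6 * w ≤ _)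
    apply BitVec.eq_of_toNat_eq
    rw [BinOp.eval, BitVec.toNat_and, toNat_ofNat_valW hr, toNat_ofNat_valW hx,
      toNat_ofNat_valW hy, e]

theorem buildCompare_circ {q : QState} (op : CmpOp) {w : ℕ} {x y : Word}
    (hx : WordOK q.qubits w x) (hy : WordOK q.qubits w y) :
    Circ q (buildCompare op x y) (72 * w + 12) (fun N z => z.Below N)
      (fun a z => z.val a =
        op.eval (BitVec.ofNat w (valW a x)) (BitVec.ofNat w (valW a y))) := by
  have heq : ∀ a, BitVec.ofNat w (valW a x) = BitVec.ofNat w (valW a y) ↔ valW a x = valW a y := by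
    intro a
    rw [← BitVec.toNat_inj, toNat_ofNat_valW hx, toNat_ofNat_valW hy]
  cases op with
  | eq =>
    refine Circ.le ((eqWord_circ hx hy).imp (fun _ _ => id) fun _ a r hr e => ?_)
      (by omega : 30 * w ≤ _)
    rw [e, CmpOp.eval]
    exact decide_eq_decide.mpr (heq a).symm
  | neq =>
    refine Circ.le (Circ.bind (eqWord_circ hx hy) fun z q₁ l₁ hz => (gNot_circ hz).imp
      (fun _ _ => id) fun _ a r hr e e' => ?_) (by omega : 30 * w + 6 ≤ _)
    rw [e, e', CmpOp.eval]
    simp [heq]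
  | ult =>
    refine Circ.le ((ltWord_circ hx hy).imp (fun _ _ => id) fun _ a r hr e => ?_)
      (by omega : 72 * w + 6 ≤ _)
    rw [e, CmpOp.eval]
    exact decide_eq_decide.mpr (by rw [BitVec.lt_def, toNat_ofNat_valW hx, toNat_ofNat_valW hy])
  | ulte =>
    refine Circ.le (Circ.bind (ltWord_circ hy hx) fun z q₁ l₁ hz => (gNot_circ hz).imp
      (fun _ _ => id) fun _ a r hr e e' => ?_) (by omega : 72 * w + 6 + 6 ≤ _)
    rw [e, e', CmpOp.eval, ← decide_not]
    exact decide_eq_decide.mpr (by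
      rw [BitVec.le_def, toNat_ofNat_valW hx, toNat_ofNat_valW hy, not_lt])
  | ugt =>
    refine Circ.le ((ltWord_circ hy hx).imp (fun _ _ => id) fun _ a r hr e => ?_)
      (by omega : 72 * w + 6 ≤ _)
    rw [e, CmpOp.eval]
    exact decide_eq_decide.mpr (by rw [BitVec.lt_def, toNat_ofNat_valW hx, toNat_ofNat_valW hy])
  | ugte =>
    refine Circ.le (Circ.bind (ltWord_circ hx hy) fun z q₁ l₁ hz => (gNot_circ hz).imp
      (fun _ _ => id) fun _ a r hr e e' => ?_) (by omega : 72 * w + 6 + 6 ≤ _)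
    rw [e, e', CmpOp.eval, ← decide_not]
    exact decide_eq_decide.mpr (by
      rw [BitVec.le_def, toNat_ofNat_valW hx, toNat_ofNat_valW hy, not_lt])

/-! ### Circuits for values -/

/-- The number of bits of the words of a value. -/
def Srt.elt : Srt → ℕ
  | .bitvec w => w
  | .array _ e => e

/-- The words `z`, over the first `N` qubits, represent a value of sort `s`. -/
def Shape (N : ℕ) (s : Srt) (z : Words) : Prop :=
  z.length = s.words ∧ ∀ y ∈ z, WordOK N s.elt y

/-- The value of sort `s` that words represent. -/
def decode (x : Asg) : (s : Srt) → Words → s.Val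
  | .bitvec w, z => BitVec.ofNat w (valW x (z.headD []))
  | .array _ e, z => fun a => BitVec.ofNat e (valW x (z.getD a.toNat []))

theorem headD_eq_getD {α : Type} (l : List α) (a : α) : l.headD a = l.getD 0 a := by
  cases l <;> rfl

theorem Shape.mono {N M : ℕ} {s : Srt} {z : Words} (h : Shape N s z) (hN : N ≤ M) : Shape M s z :=
  ⟨h.1, fun y hy => (h.2 y hy).mono hN⟩

theorem Shape.getD {N : ℕ} {s : Srt} {z : Words} (h : Shape N s z) {a : ℕ} (ha : a < s.words) :
    WordOK N s.elt (z.getD a []) := by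
  rw [List.getD_eq_getElem _ _ (by rw [h.1]; exact ha)]
  exact h.2 _ (List.getElem_mem _)

theorem Shape.word {N w : ℕ} {z : Words} (h : Shape N (.bitvec w) z) : WordOK N w (z.headD []) := by
  rw [headD_eq_getD]
  exact h.getD Nat.zero_lt_one

theorem WordOK.shape {N w : ℕ} {z : Word} (h : WordOK N w z) : Shape N (.bitvec w) [z] :=
  ⟨rfl, by simpa [Srt.elt] using h⟩

theorem Shape.agree {N : ℕ} {s : Srt} {z : Words} (h : Shape N s z) {x y : Asg}
    (hxy : Agree N x y) : decode x s z = decode y s z := by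
  cases s with
  | bitvec w => exact congrArg (BitVec.ofNat w) (h.word.agree hxy)
  | array k e =>
    funext a
    exact congrArg (BitVec.ofNat e) ((h.getD a.isLt).agree hxy)

theorem decode_ite {x : Asg} {c : Bool} {s : Srt} {z u v : Words}
    (h : ∀ a, valW x (z.getD a []) = if c then valW x (u.getD a []) else valW x (v.getD a [])) :
    decode x s z = if c then decode x s u else decode x s v := by
  cases s with
  | bitvec w =>
    simp only [decode, headD_eq_getD, h]
    cases c <;> rfl
  | array k e =>
    funext a
    simp only [decode, h]
    cases c <;> rfl

theorem ofNat_one_eq_iff {N : ℕ} {x : Asg} {z : Word} (h : WordOK N 1 z) :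
    BitVec.ofNat 1 (valW x z) = 1#1 ↔ (z.headD (.const false)).val x = true := by
  obtain _ | ⟨b, _ | ⟨c, z⟩⟩ := z
  · cases h.1
  · simp only [valW, List.headD_cons]
    cases b.val x <;> simp
  · cases h.1

theorem WordOK.head {N : ℕ} {z : Word} (h : WordOK N 1 z) : (z.headD (.const false)).Below N := by
  obtain _ | ⟨b, z⟩ := z
  · trivial
  · exact h.2 b (by simp)

theorem ofBool_eq_ofNat (x : Asg) (b : Bit) :
    BitVec.ofNat 1 (valW x [b]) = BitVec.ofBool (b.val x) := by
  simp only [valW]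
  cases b.val x <;> rfl

/-- The value of the line `l` if `z` is the circuit built for it. -/
def lineValue (x : Asg) (l : Line) (z : Words) : Value :=
  match l.sort with
  | some s => ⟨s, decode x s z⟩
  | none => ⟨.bitvec 1, 0#1⟩

theorem lineValue_of_sort {x : Asg} {l : Line} {z : Words} {s : Srt} (h : l.sort = some s) :
    lineValue x l z = ⟨s, decode x s z⟩ := by
  rw [lineValue, h]

/-- The values of lines that are represented by the circuits built for them. -/
def decodeEnv (x : Asg) (B : Model) (env : List Words) : List Value :=
  List.zipWith (lineValue x) B env

/-- The circuits in `env` have the sorts of the lines of `B` that they have been built for. -/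
def EnvOK (N : ℕ) (B : Model) (env : List Words) : Prop :=
  ∀ j < env.length, ∀ s, (B[j]?).bind Line.sort = some s → Shape N s (env.getD j [])

theorem EnvOK.mono {N M : ℕ} {B : Model} {env : List Words} (h : EnvOK N B env) (hN : N ≤ M) :
    EnvOK M B env :=
  fun j hj s hs => (h j hj s hs).mono hN

theorem Value.as_mk (s : Srt) (v : s.Val) : Value.as ⟨s, v⟩ s = v := by
  simp [Value.as]

theorem valueAt_decodeEnv {x : Asg} {B : Model} {env : List Words} {j : ℕ} {l : Line}
    (hj : j < env.length) (hl : B[j]? = some l) :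
    valueAt (decodeEnv x B env) j = lineValue x l (env.getD j []) := by
  have : j < B.length := (List.getElem?_eq_some_iff.mp hl).1
  rw [valueAt, decodeEnv, List.getD_eq_getElem _ _ (by simp [*]), List.getElem_zipWith,
    List.getD_eq_getElem _ _ hj]
  rw [List.getElem?_eq_getElem this] at hl
  rw [Option.some.inj hl]

theorem operand_decodeEnv {x : Asg} {B : Model} {env : List Words} {j : ℕ} {s : Srt}
    (hj : j < env.length) (hs : (B[j]?).bind Line.sort = some s) :
    operand (decodeEnv x B env) s j = decode x s (env.getD j []) := by
  obtain ⟨l, hl, hs⟩ := Option.bind_eq_some_iff.mp hs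
  rw [operand, valueAt_decodeEnv hj hl, lineValue_of_sort hs, Value.as_mk]

/-! ### Sizes -/

theorem le_foldr_max {l : List ℕ} {a : ℕ} (h : a ∈ l) : a ≤ l.foldr max 1 := by
  induction l with
  | nil => cases h
  | cons b l ih =>
    rcases List.mem_cons.mp h with rfl | h
    · exact le_max_left _ _
    · exact (ih h).trans (le_max_right _ _)

theorem one_le_foldr_max (l : List ℕ) : 1 ≤ l.foldr max 1 := by
  induction l with
  | nil => exact le_rfl
  | cons b l ih => exact ih.trans (le_max_right _ _)

theorem mem_sorts {B : Model} {j : ℕ} {s : Srt} (h : (B[j]?).bind Line.sort = some s) :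
    s ∈ B.filterMap Line.sort := by
  obtain ⟨l, hl, hs⟩ := Option.bind_eq_some_iff.mp h
  exact List.mem_filterMap.mpr ⟨l, List.mem_of_getElem? hl, hs⟩

theorem width_le_wordSize {B : Model} {j : ℕ} {s : Srt} (h : (B[j]?).bind Line.sort = some s) :
    s.width ≤ B.wordSize :=
  le_foldr_max (List.mem_map_of_mem (mem_sorts h))

theorem words_le_memorySize {B : Model} {j : ℕ} {s : Srt} (h : (B[j]?).bind Line.sort = some s) :
    s.words ≤ B.memorySize :=
  le_foldr_max (List.mem_map_of_mem (mem_sorts h))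

/-- The bound for the number of steps for a line, up to a constant. -/
def Model.unit (B : Model) : ℕ := B.memorySize * B.wordSize ^ 2

theorem one_le_unit (B : Model) : 1 ≤ B.unit :=
  Nat.mul_pos (one_le_foldr_max _) (pow_pos (one_le_foldr_max _) 2)

theorem mul_le_unit {B : Model} {m w : ℕ} (hm : m ≤ B.memorySize) (hw : w ≤ B.wordSize) :
    m * w ≤ B.unit :=
  Nat.mul_le_mul hm (hw.trans (Nat.le_self_pow two_ne_zero _))

theorem le_unit {B : Model} {w : ℕ} (hw : w ≤ B.wordSize) : w ≤ B.unit := by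
  simpa using mul_le_unit (one_le_foldr_max _) hw

theorem mul_self_le_unit {B : Model} {w : ℕ} (hw : w ≤ B.wordSize) : w * w ≤ B.unit := by
  calc w * w ≤ B.wordSize ^ 2 := by rw [sq]; exact Nat.mul_le_mul hw hw
    _ ≤ B.unit := Nat.le_mul_of_pos_left _ (one_le_foldr_max _)

/-! ### Circuits for the lines of a model -/

section

variable {β : Type} {q : QState} {env : List Words} {x : Nid} {k : ℕ} {V : ℕ → β → Prop}
  {S : Asg → β → Prop}

theorem Circ.fetch_bind {f : Words → QM β}
    (hf : ∀ q', q'.qubits = q.qubits → Circ q' (f (env.getD x [])) k V S) :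
    Circ q (fetch env x >>= f) (1 + k) V S :=
  Circ.charge_bind (f := fun _ => f (env.getD x [])) hf le_rfl

theorem Circ.fetchWord_bind {f : Word → QM β}
    (hf : ∀ q', q'.qubits = q.qubits → Circ q' (f ((env.getD x []).headD [])) k V S) :
    Circ q (fetchWord env x >>= f) (1 + k) V S :=
  Circ.charge_bind (f := fun _ => f ((env.getD x []).headD [])) hf le_rfl

theorem Circ.fetchBit_bind {f : Bit → QM β} (hf : ∀ q', q'.qubits = q.qubits →
      Circ q' (f (((env.getD x []).headD []).headD (.const false))) k V S) :
    Circ q (fetchBit env x >>= f) (1 + k) V S :=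
  Circ.charge_bind (f := fun _ => f (((env.getD x []).headD []).headD (.const false))) hf le_rfl

theorem Circ.constWord_bind {f : Word → QM β} {w : ℕ} {b : Bool} (hf : ∀ q', q'.qubits = q.qubits →
      Circ q' (f (List.replicate w (.const b))) k V S) :
    Circ q (constWord w b >>= f) (w + k) V S :=
  Circ.charge_bind (f := fun _ => f (List.replicate w (.const b))) hf le_rfl

theorem Circ.intWord_bind {f : Word → QM β} {w : ℕ} {c : ℤ} (hf : ∀ q', q'.qubits = q.qubits →
      Circ q' (f (intBits w c)) k V S) :
    Circ q (intWord w c >>= f) (w + k) V S :=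
  Circ.charge_bind (f := fun _ => f (intBits w c)) hf le_rfl

end

/-- The operand `x` of a line, of sort `s`: its circuit represents its value, and its size is
bounded by that of the model. -/
structure Arg (N : ℕ) (B : Model) (env : List Words) (x : Nid) (s : Srt) : Prop where
  shape : Shape N s (env.getD x [])
  value : ∀ a, operand (decodeEnv a B env) s x = decode a s (env.getD x [])
  width : s.width ≤ B.wordSize
  words : s.words ≤ B.memorySize

/-- The program `p` builds the circuit of the line `l`. -/
abbrev LineCirc (q : QState) (B : Model) (env : List Words) (l : Line) (p : QM Words) (k : ℕ) :
    Prop :=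
  Circ q p k (fun N z => ∀ s, l.sort = some s → Shape N s z)
    (fun x z => ∀ σ ι, lineValue x l z = l.eval σ ι (decodeEnv x B env))

section

variable {q : QState} {B : Model} {env : List Words} {l : Line}

/-- Building the circuit of a bitvector line from a word. -/
theorem LineCirc.of_word {w k : ℕ} {p : QM Word} {S : Asg → Word → Prop}
    (hs : l.sort = some (.bitvec w)) (hp : Circ q p k (fun N z => WordOK N w z) S)
    (hS : ∀ a z N, WordOK N w z → S a z → ∀ σ ι,
      (⟨.bitvec w, BitVec.ofNat w (valW a z)⟩ : Value) = l.eval σ ι (decodeEnv a B env)) :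
    LineCirc q B env l (p >>= fun z => pure [z]) k := by
  refine Circ.map (fun z => [z]) (hp.imp (fun _ _ => id) (S' := fun a z => ∀ σ ι,
    (⟨.bitvec w, BitVec.ofNat w (valW a z)⟩ : Value) = l.eval σ ι (decodeEnv a B env))
    fun N a z hz h => hS a z N hz h) (fun N z hz s hs' => ?_) fun a z h σ ι => ?_
  · rw [hs] at hs'
    obtain rfl := Option.some.inj hs'
    exact hz.shape
  · rw [lineValue_of_sort hs]
    exact h σ ι

variable (i : ℕ) (prev : Option (List Words))

theorem lineCirc_constd (w : ℕ) (c : ℤ) :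
    LineCirc q B env (.constd w c) (buildLine B i prev env (.constd w c)) w :=
  LineCirc.of_word rfl (intWord_circ q w c) fun a z N hz h σ ι => by
    rw [h, BitVec.ofNat_toNat, BitVec.setWidth_eq]
    rfl

theorem lineCirc_binary (op : BinOp) {w : ℕ} {x y : Nid} (hx : Arg q.qubits B env x (.bitvec w))
    (hy : Arg q.qubits B env y (.bitvec w)) :
    LineCirc q B env (.binary op w x y) (buildLine B i prev env (.binary op w x y))
      (1 + (1 + (300 * w + w * (89 * (2 * w)) + 31))) :=
  Circ.fetchWord_bind fun q₁ e₁ => Circ.fetchWord_bind fun q₂ e₂ => LineCirc.of_word rfl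
    (buildBinary_circ op (hx.shape.word.mono (by omega)) (hy.shape.word.mono (by omega)))
    fun a z N hz h σ ι => by
      rw [h, Line.eval, hx.value, hy.value]
      rfl

theorem lineCirc_compare (op : CmpOp) {w : ℕ} {x y : Nid} (hx : Arg q.qubits B env x (.bitvec w))
    (hy : Arg q.qubits B env y (.bitvec w)) :
    LineCirc q B env (.compare op w x y) (buildLine B i prev env (.compare op w x y))
      (1 + (1 + (72 * w + 12))) := by
  refine Circ.fetchWord_bind fun q₁ e₁ => Circ.fetchWord_bind fun q₂ e₂ => Circ.map _
    (buildCompare_circ op (hx.shape.word.mono (by omega)) (hy.shape.word.mono (by omega)))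
    (fun N z hz s hs => ?_) fun a z h σ ι => ?_
  · obtain rfl := Option.some.inj hs
    exact WordOK.shape ⟨rfl, by simpa using hz⟩
  · rw [lineValue_of_sort rfl, Line.eval, hx.value, hy.value]
    refine congrArg (Sigma.mk (Srt.bitvec 1)) ?_
    refine (ofBool_eq_ofNat a z).trans ?_
    rw [h]
    rfl

theorem lineCirc_not {w : ℕ} {x : Nid} (hx : Arg q.qubits B env x (.bitvec w)) :
    LineCirc q B env (.not w x) (buildLine B i prev env (.not w x)) (1 + 6 * w) := by
  refine Circ.fetchWord_bind fun q₁ e₁ => LineCirc.of_word rfl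
    (notWord_circ (hx.shape.word.mono (by omega))) fun a z N hz h σ ι => ?_
  rw [Line.eval, hx.value]
  refine congrArg (Sigma.mk (Srt.bitvec w)) (BitVec.eq_of_toNat_eq ?_)
  refine (toNat_ofNat_valW hz a).trans ?_
  refine Eq.trans ?_ BitVec.toNat_not.symm
  refine Eq.trans ?_ (congrArg (2 ^ w - 1 - ·) (toNat_ofNat_valW hx.shape.word a).symm)
  omega

theorem lineCirc_inc {w : ℕ} {x : Nid} (hx : Arg q.qubits B env x (.bitvec w)) :
    LineCirc q B env (.inc w x) (buildLine B i prev env (.inc w x))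
      (w + (1 + (300 * w + w * (89 * (2 * w)) + 31))) := by
  refine Circ.intWord_bind fun q₁ e₁ => Circ.fetchWord_bind fun q₂ e₂ => ?_
  refine LineCirc.of_word (p := buildBinary .add w ((env.getD x []).headD []) (intBits w 1)) rfl
    (buildBinary_circ .add (hx.shape.word.mono (by omega)) (wordOK_intBits _ _ _))
    fun a z N hz h σ ι => ?_
  rw [Line.eval, hx.value, h, valW_intBits, BitVec.ofNat_toNat, BitVec.setWidth_eq]
  rfl

theorem lineCirc_uext {v b : ℕ} {x : Nid} (hx : Arg q.qubits B env x (.bitvec v)) :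
    LineCirc q B env (.uext v b x) (buildLine B i prev env (.uext v b x)) (b + (v + (1 + 0))) := by
  refine Circ.constWord_bind fun q₁ e₁ => Circ.charge_bind (fun q₂ e₂ => Circ.fetchWord_bind
    fun q₃ e₃ => ?_) le_rfl
  have hz := hx.shape.word
  have e : q₃.qubits = q.qubits := e₃.trans (e₂.trans e₁)
  refine LineCirc.of_word (l := .uext v b x)
    (p := pure ((env.getD x []).headD [] ++ List.replicate b (.const false)))
    (S := fun a z => valW a z = valW a ((env.getD x []).headD [])) rfl
    (Circ.pure ((hz.mono e.ge).append (wordOK_replicate _ _ _)) fun a => ?_)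
    fun a z N hz' h σ ι => ?_
  · rw [valW_append, valW_replicate_false, Nat.mul_zero, Nat.add_zero]
  · rw [Line.eval, hx.value]
    refine congrArg (Sigma.mk (Srt.bitvec (v + b))) (BitVec.eq_of_toNat_eq ?_)
    refine (toNat_ofNat_valW hz' a).trans ?_
    rw [h, BitVec.toNat_setWidth]
    refine Eq.trans ?_ (congrArg (· % 2 ^ (v + b)) (toNat_ofNat_valW hz a).symm)
    rw [← h]
    exact (Nat.mod_eq_of_lt (hz'.lt a)).symm

theorem lineCirc_slice {v u l : ℕ} {x : Nid} (hx : Arg q.qubits B env x (.bitvec v))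
    (hu : u < v) (hl : l ≤ u) :
    LineCirc q B env (.slice v u l x) (buildLine B i prev env (.slice v u l x)) (v + (1 + 0)) := by
  refine Circ.charge_bind (fun q₂ e₂ => Circ.fetchWord_bind fun q₃ e₃ => ?_) le_rfl
  have hz := hx.shape.word
  have e : q₃.qubits = q.qubits := e₃.trans e₂
  refine LineCirc.of_word (l := .slice v u l x)
    (p := pure ((((env.getD x []).headD []).drop l).take (u - l + 1)))
    (S := fun a z => valW a z = valW a ((env.getD x []).headD []) / 2 ^ l % 2 ^ (u - l + 1)) rfl
    (Circ.pure ⟨?_, fun b hb => ?_⟩ fun a => ?_) fun a z N hz' h σ ι => ?_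
  · rw [List.length_take, List.length_drop, hz.1]
    omega
  · exact (hz.2 b (List.mem_of_mem_drop (List.mem_of_mem_take hb))).mono e.ge
  · rw [valW_take, valW_drop]
  · rw [Line.eval, hx.value]
    refine congrArg (Sigma.mk (Srt.bitvec (u - l + 1))) (BitVec.eq_of_toNat_eq ?_)
    refine (toNat_ofNat_valW hz' a).trans ?_
    rw [h, BitVec.extractLsb_toNat, Nat.shiftRight_eq_div_pow]
    exact congrArg (· / 2 ^ l % 2 ^ (u - l + 1)) (toNat_ofNat_valW hz a).symm

theorem lineCirc_ite {s : Srt} {c x y : Nid} (hc : Arg q.qubits B env c (.bitvec 1))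
    (hx : Arg q.qubits B env x s) (hy : Arg q.qubits B env y s) :
    LineCirc q B env (.ite s c x y) (buildLine B i prev env (.ite s c x y))
      (1 + (1 + (1 + s.words * (21 * s.elt + 1)))) := by
  refine Circ.fetchBit_bind fun q₁ e₁ => Circ.fetch_bind fun q₂ e₂ =>
    Circ.fetch_bind fun q₃ e₃ => ?_
  rw [← hx.shape.1]
  refine (iteWords_circ (e := s.elt) (hc.shape.word.head.mono (by omega))
    (hx.shape.1.trans hy.shape.1.symm) (fun z hz => (hx.shape.2 z hz).mono (by omega))
    fun z hz => (hy.shape.2 z hz).mono (by omega)).imp (fun N z hz s' hs' => ?_)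
      fun N a z hz h σ ι => ?_
  · obtain rfl := Option.some.inj hs'
    exact ⟨hz.1.trans hx.shape.1, hz.2⟩
  · rw [lineValue_of_sort rfl, Line.eval, hc.value, hx.value, hy.value, decode_ite h]
    exact congrArg (Sigma.mk s) (if_congr (ofNat_one_eq_iff hc.shape.word).symm rfl rfl)

theorem lineCirc_read {k e : ℕ} {mem idx : Nid} (hm : Arg q.qubits B env mem (.array k e))
    (hi : Arg q.qubits B env idx (.bitvec k)) :
    LineCirc q B env (.read k e mem idx) (buildLine B i prev env (.read k e mem idx))
      (e + (1 + (1 + 2 ^ k * (31 * k + 21 * e)))) := by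
  refine Circ.constWord_bind fun q₁ e₁ => Circ.fetchWord_bind fun q₂ e₂ => Circ.fetch_bind
    fun q₃ e₃ => ?_
  have hlen : (env.getD mem []).length = 2 ^ k := hm.shape.1
  rw [← hlen]
  refine LineCirc.of_word rfl (readWord_circ (a := 0) (hi.shape.word.mono (by omega))
    (fun z hz => (hm.shape.2 z hz).mono (by omega)) (wordOK_replicate _ _ _)
    (by rw [Nat.zero_add]; exact hlen.le)) fun a z N hz' h σ ι => ?_
  have hlt := hi.shape.word.lt a
  rw [if_pos ⟨Nat.zero_le _, by omega⟩, Nat.sub_zero] at h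
  rw [Line.eval, hm.value, hi.value, h, ← toNat_ofNat_valW hi.shape.word a]
  rfl

theorem lineCirc_write {k e : ℕ} {mem idx val : Nid} (hm : Arg q.qubits B env mem (.array k e))
    (hi : Arg q.qubits B env idx (.bitvec k)) (hv : Arg q.qubits B env val (.bitvec e)) :
    LineCirc q B env (.write k e mem idx val) (buildLine B i prev env (.write k e mem idx val))
      (1 + (1 + (1 + 2 ^ k * (31 * k + 21 * e)))) := by
  refine Circ.fetchWord_bind fun q₁ e₁ => Circ.fetchWord_bind fun q₂ e₂ => Circ.fetch_bind
    fun q₃ e₃ => ?_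
  have hlen : (env.getD mem []).length = 2 ^ k := hm.shape.1
  rw [← hlen]
  refine (writeWord_circ (a := 0) (e := e) (hi.shape.word.mono (by omega))
    (fun z hz => (hm.shape.2 z hz).mono (by omega)) (hv.shape.word.mono (by omega))
    (by rw [Nat.zero_add]; exact hlen.le)).imp (fun N z hz s' hs' => ?_)
      fun N a z hz h σ ι => ?_
  · obtain rfl := Option.some.inj hs'
    exact ⟨hz.1.trans hm.shape.1, hz.2⟩
  · rw [lineValue_of_sort rfl, Line.eval, hm.value, hi.value, hv.value]
    refine congrArg (Sigma.mk (Srt.array k e)) (funext fun b => ?_)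
    have hb := h b.toNat (by rw [hlen]; exact b.isLt)
    change BitVec.ofNat e (valW a (z.getD b.toNat [])) = _
    rw [hb, Nat.zero_add]
    have : b = decode a (.bitvec k) (env.getD idx []) ↔
        b.toNat = valW a ((env.getD idx []).headD []) := by
      rw [← toNat_ofNat_valW hi.shape.word a, BitVec.toNat_inj]
      rfl
    by_cases hc : b.toNat = valW a ((env.getD idx []).headD [])
    · rw [if_pos hc, if_pos (this.mpr hc)]
      rfl
    · rw [if_neg hc, if_neg (this.not.mpr hc)]
      rfl

theorem words_mul_elt_le {s : Srt} {j : Nid} (h : (B[j]?).bind Line.sort = some s) :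
    s.words * s.elt ≤ B.unit := by
  refine mul_le_unit (words_le_memorySize h) (le_trans ?_ (width_le_wordSize h))
  cases s with
  | bitvec w => exact le_rfl
  | array k e => exact le_max_right _ _

/-- All lines other than input and state variables are circuits. -/
theorem buildLine_circ (hB : B.WF) (hl : B[env.length]? = some l) (henv : EnvOK q.qubits B env)
    (hst : ∀ s, l ≠ .state s) (hin : ∀ w, l ≠ .input w) :
    LineCirc q B env l (buildLine B i prev env l) (1000 * B.unit) := by
  obtain ⟨-, hop, hside⟩ := hB _ _ hl
  have arg : ∀ x s, (x, s) ∈ l.operands → Arg q.qubits B env x s := by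
    intro x s h
    obtain ⟨h1, h2⟩ := hop x s h
    exact ⟨henv x h1 s h2, fun a => operand_decodeEnv h1 h2, width_le_wordSize h2,
      words_le_memorySize h2⟩
  have hself : ∀ s, l.sort = some s → (B[env.length]?).bind Line.sort = some s := by
    intro s hs
    rw [hl]
    exact hs
  have hu := one_le_unit B
  cases l with
  | constd w c =>
    have h : w ≤ B.wordSize := width_le_wordSize (hself _ rfl)
    have := le_unit h
    exact (lineCirc_constd i prev w c).le (by omega)
  | binary op w x y =>
    have hx : Arg q.qubits B env x (.bitvec w) := arg x _ (by simp [Line.operands])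
    have hy : Arg q.qubits B env y (.bitvec w) := arg y _ (by simp [Line.operands])
    have h1 := le_unit (w := w) hx.width
    have h2 := mul_self_le_unit (w := w) hx.width
    have h3 : w * (89 * (2 * w)) = 178 * (w * w) := by ring
    exact (lineCirc_binary i prev op hx hy).le (by omega)
  | compare op w x y =>
    have hx : Arg q.qubits B env x (.bitvec w) := arg x _ (by simp [Line.operands])
    have hy : Arg q.qubits B env y (.bitvec w) := arg y _ (by simp [Line.operands])
    have h1 := le_unit (w := w) hx.width
    exact (lineCirc_compare i prev op hx hy).le (by omega)
  | not w x =>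
    have hx : Arg q.qubits B env x (.bitvec w) := arg x _ (by simp [Line.operands])
    have h1 := le_unit (w := w) hx.width
    exact (lineCirc_not i prev hx).le (by omega)
  | inc w x =>
    have hx : Arg q.qubits B env x (.bitvec w) := arg x _ (by simp [Line.operands])
    have h1 := le_unit (w := w) hx.width
    have h2 := mul_self_le_unit (w := w) hx.width
    have h3 : w * (89 * (2 * w)) = 178 * (w * w) := by ring
    exact (lineCirc_inc i prev hx).le (by omega)
  | uext v b x =>
    have hx : Arg q.qubits B env x (.bitvec v) := arg x _ (by simp [Line.operands])
    have h : v + b ≤ B.wordSize := width_le_wordSize (hself _ rfl)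
    have h1 := le_unit h
    exact (lineCirc_uext i prev hx).le (by omega)
  | slice v u l x =>
    have hx : Arg q.qubits B env x (.bitvec v) := arg x _ (by simp [Line.operands])
    have h1 := le_unit (w := v) hx.width
    exact (lineCirc_slice i prev hx hside.2 hside.1).le (by omega)
  | ite s c x y =>
    have hc : Arg q.qubits B env c (.bitvec 1) := arg c _ (by simp [Line.operands])
    have hx : Arg q.qubits B env x s := arg x _ (by simp [Line.operands])
    have hy : Arg q.qubits B env y s := arg y _ (by simp [Line.operands])
    have h1 := words_mul_elt_le (hself _ rfl)
    have h2 : s.words ≤ B.unit := by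
      simpa using mul_le_unit hx.words (one_le_foldr_max _ : 1 ≤ B.wordSize)
    have h3 : s.words * (21 * s.elt + 1) = 21 * (s.words * s.elt) + s.words := by ring
    exact (lineCirc_ite i prev hc hx hy).le (by omega)
  | read k e mem idx =>
    have hm : Arg q.qubits B env mem (.array k e) := arg mem _ (by simp [Line.operands])
    have hi : Arg q.qubits B env idx (.bitvec k) := arg idx _ (by simp [Line.operands])
    have h1 : 2 ^ k * k ≤ B.unit := mul_le_unit hm.words hi.width
    have he : e ≤ B.wordSize := le_trans (le_max_right k e) hm.width
    have h2 : 2 ^ k * e ≤ B.unit := mul_le_unit hm.words he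
    have h3 := le_unit he
    have h4 : 2 ^ k * (31 * k + 21 * e) = 31 * (2 ^ k * k) + 21 * (2 ^ k * e) := by ring
    exact (lineCirc_read i prev hm hi).le (by omega)
  | write k e mem idx val =>
    have hm : Arg q.qubits B env mem (.array k e) := arg mem _ (by simp [Line.operands])
    have hi : Arg q.qubits B env idx (.bitvec k) := arg idx _ (by simp [Line.operands])
    have hv : Arg q.qubits B env val (.bitvec e) := arg val _ (by simp [Line.operands])
    have h1 : 2 ^ k * k ≤ B.unit := mul_le_unit hm.words hi.width
    have h2 : 2 ^ k * e ≤ B.unit := mul_le_unit hm.words hv.width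
    have h4 : 2 ^ k * (31 * k + 21 * e) = 31 * (2 ^ k * k) + 21 * (2 ^ k * e) := by ring
    exact (lineCirc_write i prev hm hi hv).le (by omega)
  | state s => exact absurd rfl (hst s)
  | input w => exact absurd rfl (hin w)
  | init s st v => exact (Circ.pure (fun s hs => by cases hs) fun x σ ι => rfl).le (Nat.zero_le _)
  | next s st v => exact (Circ.pure (fun s hs => by cases hs) fun x σ ι => rfl).le (Nat.zero_le _)
  | bad c => exact (Circ.pure (fun s hs => by cases hs) fun x σ ι => rfl).le (Nat.zero_le _)

end

/-! ### Values of state variables -/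

theorem newValue_eq (s : Srt) : newValue s = newWords s.elt s.words := by cases s <;> rfl

/-- The number represented by the word at index `a` of a value. -/
def content : (s : Srt) → s.Val → ℕ → ℕ
  | .bitvec _, v, _ => v.toNat
  | .array k _, v, a => (v (BitVec.ofNat k a)).toNat

theorem content_lt (s : Srt) (v : s.Val) (a : ℕ) : content s v a < 2 ^ s.elt := by
  cases s <;> exact BitVec.isLt _

theorem decode_eq_of_content {x : Asg} {s : Srt} {z : Words} {v : s.Val}
    (h : ∀ a < s.words, valW x (z.getD a []) = content s v a) : decode x s z = v := by
  cases s with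
  | bitvec w =>
    have := h 0 Nat.zero_lt_one
    simp only [decode, headD_eq_getD, this, content, BitVec.ofNat_toNat, BitVec.setWidth_eq]
  | array k e =>
    funext a
    have := h a.toNat a.isLt
    simp only [decode, this, content, BitVec.ofNat_toNat, BitVec.setWidth_eq]

theorem Model.WF.of_init {B : Model} (hB : B.WF) {s : Srt} {j v : Nid} (h : Line.init s j v ∈ B) :
    B[j]? = some (.state s) ∧ v < j ∧ (B[v]?).bind Line.sort = some s := by
  obtain ⟨k, hk⟩ := List.mem_iff_getElem?.mp h
  obtain ⟨-, hop, hs⟩ := hB k _ hk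
  exact ⟨hs.1, hs.2, (hop v s (by simp [Line.operands])).2⟩

theorem Model.WF.of_next {B : Model} (hB : B.WF) {s : Srt} {j v : Nid} (h : Line.next s j v ∈ B) :
    B[j]? = some (.state s) ∧ (B[v]?).bind Line.sort = some s := by
  obtain ⟨k, hk⟩ := List.mem_iff_getElem?.mp h
  obtain ⟨-, hop, hs⟩ := hB k _ hk
  exact ⟨hs, (hop v s (by simp [Line.operands])).2⟩

theorem Model.WF.of_bad {B : Model} (hB : B.WF) {c : Nid} (h : Line.bad c ∈ B) :
    c < B.length ∧ (B[c]?).bind Line.sort = some (.bitvec 1) := by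
  obtain ⟨k, hk⟩ := List.mem_iff_getElem?.mp h
  obtain ⟨-, hop, -⟩ := hB k _ hk
  obtain ⟨h1, h2⟩ := hop c (.bitvec 1) (by simp [Line.operands])
  exact ⟨h1.trans (List.getElem?_eq_some_iff.mp hk).1, h2⟩

theorem exists_init_of_findSome? {B : Model} {j v : Nid}
    (h : B.findSome? (Line.initOf j) = some v) : ∃ s, Line.init s j v ∈ B := by
  obtain ⟨l, hl, h⟩ := List.exists_of_findSome?_eq_some h
  cases l with
  | init s st v' =>
    simp only [Line.initOf] at h
    split_ifs at h with hst
    obtain rfl := Option.some.inj h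
    exact ⟨s, hst ▸ hl⟩
  | _ => cases h

theorem exists_next_of_findSome? {B : Model} {j v : Nid}
    (h : B.findSome? (Line.nextOf j) = some v) : ∃ s, Line.next s j v ∈ B := by
  obtain ⟨l, hl, h⟩ := List.exists_of_findSome?_eq_some h
  cases l with
  | next s st v' =>
    simp only [Line.nextOf] at h
    split_ifs at h with hst
    obtain rfl := Option.some.inj h
    exact ⟨s, hst ▸ hl⟩
  | _ => cases h

theorem findSome?_of_mem {α β : Type} {f : α → Option β} {l : List α} {a : α} {b : β} (ha : a ∈ l)
    (hb : f a = some b) (hl : (l.filterMap f).length ≤ 1) : l.findSome? f = some b := by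
  have : b ∈ l.filterMap f := List.mem_filterMap.mpr ⟨a, ha, hb⟩
  rw [← List.head?_filterMap]
  rcases h : l.filterMap f with _ | ⟨c, _ | ⟨d, m⟩⟩
  · rw [h] at this
    cases this
  · rw [h] at this
    rw [List.head?_cons, List.mem_singleton.mp this]
  · rw [h] at hl
    simp at hl

theorem Model.WF.findSome?_init {B : Model} (hB : B.WF) {s : Srt} {j v : Nid}
    (h : Line.init s j v ∈ B) : B.findSome? (Line.initOf j) = some v :=
  findSome?_of_mem h (by simp [Line.initOf]) (hB j _ (hB.of_init h).1).2.2.1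

theorem Model.WF.findSome?_next {B : Model} (hB : B.WF) {s : Srt} {j v : Nid}
    (h : Line.next s j v ∈ B) : B.findSome? (Line.nextOf j) = some v :=
  findSome?_of_mem h (by simp [Line.nextOf]) (hB j _ (hB.of_next h).1).2.2.2.le

theorem Model.WF.exists_next {B : Model} (hB : B.WF) {s : Srt} {j : Nid}
    (h : B[j]? = some (.state s)) :
    ∃ v, B.findSome? (Line.nextOf j) = some v ∧ Line.next s j v ∈ B := by
  have hl := (hB j _ h).2.2.2
  have : ∃ v, B.findSome? (Line.nextOf j) = some v := by
    rw [← Option.isSome_iff_exists, ← List.head?_filterMap, List.isSome_head?]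
    intro h0
    rw [h0] at hl
    cases hl
  obtain ⟨v, hv⟩ := this
  obtain ⟨s', hs'⟩ := exists_next_of_findSome? hv
  have := (hB.of_next hs').1
  rw [h] at this
  cases this
  exact ⟨v, hv, hs'⟩

theorem Model.WF.init_of_findSome? {B : Model} (hB : B.WF) {s : Srt} {j v : Nid}
    (h : B[j]? = some (.state s)) (hv : B.findSome? (Line.initOf j) = some v) :
    Line.init s j v ∈ B := by
  obtain ⟨s', hs'⟩ := exists_init_of_findSome? hv
  have := (hB.of_init hs').1
  rw [h] at this
  cases this
  exact hs'

/-! ### The duplicates of a model -/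

/-- How the circuit of the state variable `j` arises: from its initial value, if there is one, in
the first duplicate, and from the output of the previous duplicate otherwise. -/
def Linked (B : Model) (prev : Option (List Words)) (env : List Words) (j : Nid) (z : Words) :
    Prop :=
  match prev with
  | none => ∀ v, B.findSome? (Line.initOf j) = some v → z = env.getD v []
  | some p => ∃ v, B.findSome? (Line.nextOf j) = some v ∧ z = p.getD v []

/-- The record `r` of the table of inputs belongs to the input variable with the circuit `z`. -/
def InputRecord (B : Model) (i : ℕ) (r : ℕ × Nid × List ℕ) (z : Words) : Prop :=
  r.1 = i ∧ z = [r.2.2.map .qubit] ∧ B[r.2.1]? = some (.input r.2.2.length)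

/-- The circuits `env` of the first lines of the `i`-th duplicate have been built, in the state `q`;
`ins` is the table of inputs of the previous duplicates. -/
structure DupOK (B : Model) (i : ℕ) (prev : Option (List Words)) (ins : List (ℕ × Nid × List ℕ))
    (env : List Words) (q : QState) : Prop where
  length : env.length ≤ B.length
  shape : EnvOK q.qubits B env
  link : ∀ j < env.length, ∀ s, B[j]? = some (.state s) → Linked B prev env j (env.getD j [])
  input : ∀ j < env.length, ∀ w, B[j]? = some (.input w) →
    ∃ qs, (i, j, qs) ∈ q.inputs ∧ InputRecord B i (i, j, qs) (env.getD j [])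
  record : ∀ r ∈ q.inputs, r ∈ ins ∨ r.2.1 < env.length ∧ InputRecord B i r (env.getD r.2.1 [])
  subset : ins ⊆ q.inputs

theorem DupOK.of_le {B : Model} {i : ℕ} {prev : Option (List Words)}
    {ins : List (ℕ × Nid × List ℕ)} {env : List Words} {q q' : QState}
    (h : DupOK B i prev ins env q) (hq : q.qubits ≤ q'.qubits) (hi : q'.inputs = q.inputs) :
    DupOK B i prev ins env q' :=
  ⟨h.length, h.shape.mono hq, h.link, by rw [hi]; exact h.input, by rw [hi]; exact h.record,
    by rw [hi]; exact h.subset⟩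

theorem getD_snoc_lt {α : Type} {l : List α} {a d : α} {j : ℕ} (h : j < l.length) :
    (l ++ [a]).getD j d = l.getD j d := by
  rw [List.getD_eq_getElem?_getD, List.getElem?_append_left h, ← List.getD_eq_getElem?_getD]

theorem getD_snoc_length {α : Type} (l : List α) (a d : α) : (l ++ [a]).getD l.length d = a := by
  simp [List.getD_eq_getElem?_getD]

/-- The circuit of the next line completes a duplicate by one more line. -/
theorem DupOK.snoc {B : Model} (hB : B.WF) {i : ℕ} {prev : Option (List Words)}
    {ins : List (ℕ × Nid × List ℕ)} {env : List Words} {q q' : QState}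
    (h : DupOK B i prev ins env q) {l : Line} (hl : B[env.length]? = some l) {z : Words}
    (hq : q.qubits ≤ q'.qubits) (hz : ∀ s, l.sort = some s → Shape q'.qubits s z)
    (hlink : ∀ s, l = .state s → Linked B prev env env.length z) (hsub : q.inputs ⊆ q'.inputs)
    (hin : ∀ w, l = .input w →
      ∃ qs, (i, env.length, qs) ∈ q'.inputs ∧ InputRecord B i (i, env.length, qs) z)
    (hrec : ∀ r ∈ q'.inputs, r ∈ q.inputs ∨ r.2.1 = env.length ∧ InputRecord B i r z) :
    DupOK B i prev ins (env ++ [z]) q' := by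
  have cases_lt : ∀ {j}, j < (env ++ [z]).length → j < env.length ∨ j = env.length := by
    intro j hj
    rw [List.length_append, List.length_singleton] at hj
    omega
  have hlen : (env ++ [z]).length = env.length + 1 := by simp
  refine ⟨?_, ?_, ?_, ?_, ?_, fun r hr => hsub (h.subset hr)⟩
  · rw [hlen]
    exact (List.getElem?_eq_some_iff.mp hl).1
  · intro j hj s hs
    rcases cases_lt hj with hj | rfl
    · rw [getD_snoc_lt hj]
      exact (h.shape j hj s hs).mono hq
    · rw [getD_snoc_length]
      rw [hl] at hs
      exact hz s hs
  · intro j hj s hs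
    have key : ∀ y, j ≤ env.length → Linked B prev env j y → Linked B prev (env ++ [z]) j y := by
      intro y hj hy
      cases prev with
      | some p => exact hy
      | none =>
        intro v hv
        rw [hy v hv, getD_snoc_lt]
        exact (hB.of_init (hB.init_of_findSome? hs hv)).2.1.trans_le hj
    rcases cases_lt hj with hj | rfl
    · rw [getD_snoc_lt hj]
      exact key _ hj.le (h.link j hj s hs)
    · rw [getD_snoc_length]
      rw [hl] at hs
      exact key _ le_rfl (hlink s (Option.some.inj hs))
  · intro j hj w hw
    rcases cases_lt hj with hj | rfl
    · rw [getD_snoc_lt hj]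
      obtain ⟨qs, h1, h2⟩ := h.input j hj w hw
      exact ⟨qs, hsub h1, h2⟩
    · rw [getD_snoc_length]
      rw [hl] at hw
      exact hin w (Option.some.inj hw)
  · intro r hr
    rcases hrec r hr with hr | ⟨h1, h2⟩
    · rcases h.record r hr with hr | ⟨h1, h2⟩
      · exact .inl hr
      · exact .inr ⟨by rw [hlen]; exact Nat.lt_succ_of_lt h1, by rw [getD_snoc_lt h1]; exact h2⟩
    · exact .inr ⟨by rw [hlen, h1]; exact Nat.lt_succ_self _,
        by rw [h1, getD_snoc_length]; exact h2⟩

/-- The qubits of input variables have the values `ι`, and those of state variables without initial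
values have, in the first duplicate, the values `σ`. -/
def Chosen (B : Model) (σ : Nid → Value) (ι : Nid → ℕ) (prev : Option (List Words)) (x : Asg)
    (j : Nid) (z : Words) : Prop :=
  (∀ w, B[j]? = some (.input w) → valW x (z.headD []) = ι j % 2 ^ w) ∧
  ∀ s, B[j]? = some (.state s) → prev = none → B.findSome? (Line.initOf j) = none →
    decode x s z = (σ j).as s

/-- The circuit `z` computes the value of line `j` from the values of the lines before it, unless
the line is an input or state variable. -/
def Computes (B : Model) (x : Asg) (env : List Words) (j : Nid) (z : Words) : Prop :=
  ∀ l, B[j]? = some l → (∀ s, l ≠ .state s) → (∀ w, l ≠ .input w) →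
    ∀ σ ι, lineValue x l z = l.eval σ ι ((decodeEnv x B env).take j)

theorem Chosen.congr {B : Model} {σ : Nid → Value} {ι : Nid → ℕ} {prev : Option (List Words)}
    {x y : Asg} {N : ℕ} {j : Nid} {z : Words} (h : Chosen B σ ι prev x j z) (hxy : Agree N x y)
    (hz : ∀ s, (B[j]?).bind Line.sort = some s → Shape N s z) : Chosen B σ ι prev y j z := by
  refine ⟨fun w hw => ?_, fun s hs h1 h2 => ?_⟩
  · rw [← (hz (.bitvec w) (by rw [hw]; rfl)).word.agree hxy]
    exact h.1 w hw
  · rw [← (hz s (by rw [hs]; rfl)).agree hxy]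
    exact h.2 s hs h1 h2

/-- New qubits for an input variable, with a record in the table of inputs. -/
theorem newInput_triple {q : QState} {T : Asg → Prop} (hT : Stable q.qubits T) (i j w v : ℕ) :
    Triple q (do
        let qs ← newQubits w
        charge (w + 1)
        modify fun q => { q with inputs := (i, j, qs) :: q.inputs }
        return [qs.map Bit.qubit]) (2 * w + 1)
      (fun q' z => q.qubits ≤ q'.qubits ∧ ∃ qs, q'.inputs = (i, j, qs) :: q.inputs ∧
        z = [qs.map .qubit] ∧ qs.length = w ∧ ∀ b ∈ qs, b < q'.qubits) T
      (fun x z => T x ∧ valW x (z.headD []) = v % 2 ^ w) (fun _ _ => True) := by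
  have h := newQubits_spec hT w (v % 2 ^ w) (Nat.mod_lt _ (by positivity))
  refine ⟨h.grows.trans ⟨le_rfl, id, fun _ => le_rfl, ?_⟩, ?_, ?_, fun _ _ => trivial, h.total⟩
  · have hr := h.valid.2.1
    change (out (newQubits w) q).2.qubits + (out (newQubits w) q).2.terms.length +
      (List.map (fun r : ℕ × Nid × List ℕ => r.2.2.length + 1)
        ((i, j, (out (newQubits w) q).1) :: (out (newQubits w) q).2.inputs)).sum +
      (out (newQubits w) q).2.steps ≤
      (out (newQubits w) q).2.qubits + (out (newQubits w) q).2.terms.length +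
      (List.map (fun r : ℕ × Nid × List ℕ => r.2.2.length + 1)
        (out (newQubits w) q).2.inputs).sum + ((out (newQubits w) q).2.steps + (w + 1))
    simp only [List.map_cons, List.sum_cons, hr]
    omega
  · have := h.steps
    change (out (newQubits w) q).2.steps + (w + 1) ≤ _
    omega
  · exact ⟨h.grows.qubits, _, congrArg _ h.valid.1, rfl, h.valid.2⟩

/-- Building the next line of a duplicate. Input variables and, in the first duplicate, state
variables without initial values can be given any values `ι` and `σ`. -/
theorem buildLine_triple {B : Model} (hB : B.WF) {i : ℕ} {prev : Option (List Words)}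
    {ins : List (ℕ × Nid × List ℕ)} {env : List Words} {q : QState}
    (h : DupOK B i prev ins env q) {l : Line} (hl : B[env.length]? = some l)
    (hprev : ∀ p, prev = some p → EnvOK q.qubits B p ∧ p.length = B.length)
    (σ : Nid → Value) (ι : Nid → ℕ) {T : Asg → Prop} (hT : Stable q.qubits T) :
    Triple q (buildLine B i prev env l) (1000 * B.unit)
      (fun q' z => q.qubits ≤ q'.qubits ∧ DupOK B i prev ins (env ++ [z]) q') T
      (fun x z => T x ∧ Chosen B σ ι prev x env.length z)
      (fun x z => Computes B x env env.length z) := by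
  have hu := one_le_unit B
  have hself : ∀ s, l.sort = some s → (B[env.length]?).bind Line.sort = some s := by
    intro s hs
    rw [hl]
    exact hs
  have hrec : ∀ {q' : QState} {z : Words}, q'.inputs = q.inputs → ∀ r ∈ q'.inputs,
      r ∈ q.inputs ∨ r.2.1 = env.length ∧ InputRecord B i r z := by
    intro q' z e r hr
    rw [e] at hr
    exact .inl hr
  by_cases hin : ∃ w, l = .input w
  · obtain ⟨w, rfl⟩ := hin
    have hw : w ≤ B.wordSize := width_le_wordSize (hself _ rfl)
    have := le_unit hw
    refine Triple.weaken (newInput_triple hT i env.length w (ι env.length)) (by omega) ?_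
      (fun _ => id) ?_ ?_
    · rintro q' z ⟨h1, qs, h2, h3, h4, h5⟩
      refine ⟨h1, h.snoc hB hl h1 (fun s hs => ?_) (fun s hs => by cases hs) (by simp [h2])
        (fun w' hw' => ⟨qs, by simp [h2], rfl, h3, by rw [hl, h4]⟩) fun r hr => ?_⟩
      · obtain rfl := Option.some.inj hs
        rw [h3]
        exact (wordOK_qubits ⟨h4, h5⟩).shape
      · rw [h2] at hr
        rcases List.mem_cons.mp hr with rfl | hr
        · exact .inr ⟨rfl, rfl, h3, by rw [hl, h4]⟩
        · exact .inl hr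
    · rintro q' x z - - ⟨h1, h2⟩
      refine ⟨h1, fun w' hw' => ?_, fun s hs => ?_⟩
      · rw [hl] at hw'
        cases hw'
        exact h2
      · rw [hl] at hs
        cases hs
    · intro q' x z _ _ l' hl' _ h2
      rw [hl] at hl'
      exact absurd (Option.some.inj hl').symm (h2 w)
  by_cases hst : ∃ s, l = .state s
  · obtain ⟨s, rfl⟩ := hst
    have hcomp : ∀ x z, Computes B x env env.length z := by
      intro x z l' hl' h1
      rw [hl] at hl'
      exact absurd (Option.some.inj hl').symm (h1 s)
    have hinput : ∀ w, B[env.length]? ≠ some (.input w) := by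
      intro w hw
      rw [hl] at hw
      cases hw
    -- A state variable is replaced by a circuit `z` that has been built before.
    have old : ∀ (env' : List Words) (v : Nid), Shape q.qubits s (env'.getD v []) →
        Linked B prev env env.length (env'.getD v []) →
        (prev = none → B.findSome? (Line.initOf env.length) ≠ none) →
        Triple q (charge 1 >>= fun _ => fetch env' v) (1000 * B.unit)
          (fun q' z => q.qubits ≤ q'.qubits ∧ DupOK B i prev ins (env ++ [z]) q') T
          (fun x z => T x ∧ Chosen B σ ι prev x env.length z)
          (fun x z => Computes B x env env.length z) := by
      intro env' v hs hlink hfree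
      have hc : Circ q (charge 1 >>= fun _ => fetch env' v) 2 (fun _ z => z = env'.getD v [])
          (fun _ _ => True) :=
        Circ.charge_bind (k := 1) (fun q' _ => Circ.charge_pure rfl (fun _ => trivial) le_rfl)
          le_rfl
      refine (Triple.of_spec (hc.frame hT)).weaken (by omega) ?_ (fun _ => id) ?_
        fun _ x z _ _ => hcomp x z
      · rintro q' z ⟨h1, h2, rfl⟩
        refine ⟨h1, h.snoc hB hl h1 (fun s' hs' => ?_) (fun _ _ => hlink) (by simp [h2])
          (fun w hw => by cases hw) (hrec h2)⟩
        cases hs'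
        exact hs.mono h1
      · rintro q' x z - - hx
        exact ⟨hx, fun w hw => absurd hw (hinput w), fun _ _ h1 h2 => absurd h2 (hfree h1)⟩
    cases prev with
    | some p =>
      obtain ⟨v, hv, hmem⟩ := hB.exists_next hl
      have e : buildLine B i (some p) env (.state s) = (charge 1 >>= fun _ => fetch p v) := by
        simp only [buildLine, hv]
      rw [e]
      obtain ⟨h1, h2⟩ := hprev p rfl
      have h3 := (hB.of_next hmem).2
      have h4 : v < B.length := by
        obtain ⟨l', hl', -⟩ := Option.bind_eq_some_iff.mp h3
        exact (List.getElem?_eq_some_iff.mp hl').1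
      exact old p v (h1 v (by rw [h2]; exact h4) s h3) ⟨v, hv, rfl⟩ (fun h => by cases h)
    | none =>
      cases hv : B.findSome? (Line.initOf env.length) with
      | some v =>
        have e : buildLine B i none env (.state s) = (charge 1 >>= fun _ => fetch env v) := by
          simp only [buildLine, hv]
        rw [e]
        obtain ⟨h1, h2, h3⟩ := hB.of_init (hB.init_of_findSome? hl hv)
        exact old env v (h.shape v h2 s h3) (fun v' hv' => by rw [hv] at hv'; cases hv'; rfl)
          fun _ => by rw [hv]; simp
      | none =>
        have e : buildLine B i none env (.state s) =
            (charge 1 >>= fun _ => newWords s.elt s.words) := by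
          simp only [buildLine, hv, newValue_eq]
        rw [e]
        have h1 := words_mul_elt_le (hself _ rfl)
        have hc : Free q (charge 1 >>= fun _ => newWords s.elt s.words) (1 + s.words * s.elt)
            (fun N z => z.length = s.words ∧ ∀ y ∈ z, WordOK N s.elt y) T
            (fun x z => T x ∧ ∀ a < s.words, valW x (z.getD a []) =
              content s ((σ env.length).as s) a) :=
          Free.bind ((Circ.charge q 1).frame hT) le_rfl fun _ q' h1 _ =>
            newWords_spec (fun x y hxy => hT x y (hxy.mono h1)) _ _ _ (content_lt _ _)
        refine (Triple.of_spec hc).weaken (by omega) ?_ (fun _ => id) ?_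
          fun _ x z _ _ => hcomp x z
        · rintro q' z ⟨h1, h2, hz⟩
          refine ⟨h1, h.snoc hB hl h1 (fun s' hs' => ?_) (fun _ _ v h => ?_) (by simp [h2])
            (fun w hw => by cases hw) (hrec h2)⟩
          · cases hs'
            exact hz
          · rw [hv] at h
            cases h
        · rintro q' x z - - ⟨hx, hz⟩
          refine ⟨hx, fun w hw => absurd hw (hinput w), fun s' hs' h1 h2 => ?_⟩
          rw [hl] at hs'
          cases hs'
          exact decode_eq_of_content hz
  · have hst' : ∀ s, l ≠ .state s := fun s hs => hst ⟨s, hs⟩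
    have hin' : ∀ w, l ≠ .input w := fun w hw => hin ⟨w, hw⟩
    refine (Triple.of_spec ((buildLine_circ i prev hB hl h.shape hst' hin').frame hT)).weaken
      le_rfl ?_ (fun _ => id) ?_ ?_
    · rintro q' z ⟨h1, h2, hz⟩
      exact ⟨h1, h.snoc hB hl h1 hz (fun s hs => absurd hs (hst' s)) (by simp [h2])
        (fun w hw => absurd hw (hin' w)) (hrec h2)⟩
    · rintro q' x z - - hx
      refine ⟨hx, fun w hw => ?_, fun s hs => ?_⟩
      · rw [hl] at hw
        exact absurd (Option.some.inj hw) (hin' w)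
      · rw [hl] at hs
        exact absurd (Option.some.inj hs) (hst' s)
    · intro q' x z _ hz l' hl' _ _ σ ι
      rw [hl] at hl'
      obtain rfl := Option.some.inj hl'
      rw [hz σ ι, List.take_of_length_le]
      rw [decodeEnv, List.length_zipWith]
      exact min_le_right _ _

theorem Chosen.stable {B : Model} {σ : Nid → Value} {ι : Nid → ℕ} {prev : Option (List Words)}
    {N : ℕ} {j : Nid} {z : Words} (hz : ∀ s, (B[j]?).bind Line.sort = some s → Shape N s z) :
    Stable N (fun x => Chosen B σ ι prev x j z) :=
  fun _ _ hxy h => h.congr hxy hz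

theorem getD_of_isPrefix {α : Type} {l m : List α} (h : l <+: m) {j : ℕ} (hj : j < l.length)
    (d : α) : m.getD j d = l.getD j d := by
  obtain ⟨t, rfl⟩ := h
  rw [List.getD_eq_getElem?_getD, List.getElem?_append_left hj, ← List.getD_eq_getElem?_getD]

theorem take_decodeEnv {x : Asg} {B : Model} {env e : List Words} (h : env <+: e) :
    (decodeEnv x B e).take env.length = (decodeEnv x B env).take env.length := by
  obtain ⟨t, rfl⟩ := h
  simp only [decodeEnv, List.take_zipWith, List.take_left', List.take_length]

theorem buildLines_triple {B : Model} (hB : B.WF) {i : ℕ} {prev : Option (List Words)}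
    {ins : List (ℕ × Nid × List ℕ)} (σ : Nid → Value) (ι : Nid → ℕ) :
    ∀ (ls : List Line) (env : List Words) (q : QState) (T : Asg → Prop), ls = B.drop env.length →
      DupOK B i prev ins env q →
      (∀ p, prev = some p → EnvOK q.qubits B p ∧ p.length = B.length) → Stable q.qubits T →
      Triple q (buildLines B i prev ls env) (ls.length * (1000 * B.unit + 1))
        (fun q' e => q.qubits ≤ q'.qubits ∧ env <+: e ∧ e.length = B.length ∧
          DupOK B i prev ins e q') T
        (fun x e => T x ∧ ∀ j, env.length ≤ j → j < B.length → Chosen B σ ι prev x j (e.getD j []))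
        (fun x e => ∀ j, env.length ≤ j → j < B.length → Computes B x e j (e.getD j [])) := by
  intro ls
  induction ls with
  | nil =>
    intro env q T hls henv hprev hT
    have h1 : env.length = B.length :=
      le_antisymm henv.length (List.drop_eq_nil_iff.mp hls.symm)
    exact ⟨Grows.refl q, by simp [buildLines, out, pure, StateT.pure],
      ⟨le_rfl, List.prefix_rfl, h1, henv⟩, fun x _ j hj hj' => by omega,
      fun _ x hx => ⟨x, Agree.refl _ x, rfl, hx, fun j hj hj' => by omega⟩⟩
  | cons l ls ih =>
    intro env q T hls henv hprev hT
    have hl : B[env.length]? = some l := by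
      have := congrArg (fun m => m[0]?) hls
      simpa using this.symm
    have hls' : ls = B.drop (env.length + 1) := by
      rw [← List.tail_drop, ← hls, List.tail_cons]
    refine (Triple.bind (k₂ := 1000 * B.unit + ls.length * (1000 * B.unit + 1))
      (Triple.of_spec ((Circ.charge q 1).frame hT)) fun h₁ => ?_).weaken (by
        rw [List.length_cons, Nat.succ_mul ls.length]; omega) (fun _ _ => id) (fun _ => id)
        (fun _ _ _ _ _ => id) (fun _ _ _ _ => id)
    have hT₁ := hT.mono h₁.1
    have hprev₁ : ∀ p, prev = some p → EnvOK (out (charge 1) q).2.qubits B p ∧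
        p.length = B.length := fun p hp => ⟨(hprev p hp).1.mono h₁.1, (hprev p hp).2⟩
    refine Triple.weaken (Triple.bind
      (buildLine_triple hB (henv.of_le h₁.1 h₁.2.1) hl hprev₁ σ ι hT₁)
      (V := fun q' e => q.qubits ≤ q'.qubits ∧ env <+: e ∧ e.length = B.length ∧
          DupOK B i prev ins e q')
      (F := fun x e => T x ∧
        ∀ j, env.length ≤ j → j < B.length → Chosen B σ ι prev x j (e.getD j []))
      (S := fun x e => ∀ j, env.length ≤ j → j < B.length → Computes B x e j (e.getD j []))
      fun h₂ => ?_) le_rfl (fun _ _ => id) (fun x hx => hx.2) (fun _ _ _ _ _ => id)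
      (fun _ _ _ _ h _ => h)
    obtain ⟨h₂, h₃⟩ := h₂
    generalize (out (buildLine B i prev env l) (out (charge 1) q).2).1 = z at h₃ ⊢
    generalize (out (buildLine B i prev env l) (out (charge 1) q).2).2 = q₂ at h₂ h₃ ⊢
    have hlen : (env ++ [z]).length = env.length + 1 := by simp
    have hz : ∀ s, (B[env.length]?).bind Line.sort = some s → Shape q₂.qubits s z := by
      intro s hs
      have := h₃.shape env.length (by omega) s hs
      rwa [getD_snoc_length] at this
    refine (ih (env ++ [z]) q₂ (fun x => T x ∧ Chosen B σ ι prev x env.length z)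
      (by rw [hlen]; exact hls') h₃
      (fun p hp => ⟨(hprev₁ p hp).1.mono h₂, (hprev₁ p hp).2⟩)
      ((hT₁.mono h₂).and (Chosen.stable hz))).weaken le_rfl ?_ (fun x hx => hx.2) ?_ ?_
    · rintro q' e ⟨h1, h2, h3⟩
      exact ⟨(h₁.1.trans h₂).trans h1, (List.prefix_append _ _).trans h2, h3⟩
    · rintro q' x e ⟨-, h2, -⟩ - ⟨⟨h3, h4⟩, h5⟩
      refine ⟨h3, fun j hj hj' => ?_⟩
      rcases hj.eq_or_lt with rfl | hj
      · rw [getD_of_isPrefix h2 (by omega), getD_snoc_length]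
        exact h4
      · exact h5 j (by omega) hj'
    · rintro q' x e ⟨-, h2, -⟩ h3 h4 j hj hj'
      rcases hj.eq_or_lt with rfl | hj
      · rw [getD_of_isPrefix h2 (by omega), getD_snoc_length]
        intro l' hl' h5 h6 σ' ι'
        rw [take_decodeEnv ((List.prefix_append _ _).trans h2)]
        exact h4 l' hl' h5 h6 σ' ι'
      · exact h3 j (by omega) hj'

/-- The bit of the one-bit line `c`. -/
def bitAt (env : List Words) (c : Nid) : Bit := ((env.getD c []).headD []).headD (.const false)

theorem buildBad_circ {env : List Words} : ∀ {ls : List Line} {q : QState} {acc : Bit},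
    acc.Below q.qubits → (∀ c, Line.bad c ∈ ls → (bitAt env c).Below q.qubits) →
    Circ q (buildBad env ls acc) (10 * ls.length) (fun N z => z.Below N)
      (fun x z => z.val x = true ↔
        acc.val x = true ∨ ∃ c, Line.bad c ∈ ls ∧ (bitAt env c).val x = true) := by
  intro ls
  induction ls with
  | nil =>
    intro q acc hacc _
    exact Circ.pure hacc fun x => by simp
  | cons l ls ih =>
    intro q acc hacc hls
    by_cases hl : ∃ c, l = .bad c
    · obtain ⟨c, rfl⟩ := hl
      refine Circ.charge_bind (c := 1) (k := 1 + (8 + 10 * ls.length)) (fun q₁ e₁ => ?_)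
        (by rw [List.length_cons]; omega)
      refine Circ.fetchBit_bind fun q₂ e₂ => ?_
      have e : q₂.qubits = q.qubits := e₂.trans e₁
      refine Circ.bind (gOr_circ (by rw [e]; exact hls c (by simp)) (by rwa [e]))
        fun a q₃ l₃ ha => ?_
      refine (ih ha fun c' hc' => (hls c' (by simp [hc'])).mono (by omega)).imp (fun _ _ => id)
        fun N x z _ h h' => ?_
      rw [h, h']
      change ((bitAt env c).val x || acc.val x) = true ∨ _ ↔ _
      rw [Bool.or_eq_true]
      constructor
      · rintro ((h | h) | ⟨c', h, h'⟩)
        · exact .inr ⟨c, by simp, h⟩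
        · exact .inl h
        · exact .inr ⟨c', by simp [h], h'⟩
      · rintro (h | ⟨c', h, h'⟩)
        · exact .inl (.inr h)
        · rcases List.mem_cons.mp h with h | h
          · cases h
            exact .inl (.inl h')
          · exact .inr ⟨c', h, h'⟩
    · have e : buildBad env (l :: ls) acc = (charge 1 >>= fun _ => buildBad env ls acc) := by
        cases l with
        | bad c => exact absurd ⟨c, rfl⟩ hl
        | _ => rfl
      rw [e]
      refine Circ.charge_bind (c := 1) (k := 10 * ls.length) (fun q₁ e₁ => ?_)
        (by rw [List.length_cons]; omega)
      refine (ih (by rwa [e₁]) fun c hc => by rw [e₁]; exact hls c (by simp [hc])).imp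
        (fun _ _ => id) fun N x z _ h => ?_
      have : ∀ c, Line.bad c ∈ l :: ls ↔ Line.bad c ∈ ls := fun c => by
        rw [List.mem_cons, or_iff_right]
        exact fun h => hl ⟨c, h.symm⟩
      simp only [h, this]

/-- One duplicate, with the OR circuit over its bad lines and `acc`. -/
def buildDuplicate (B : Model) (i : ℕ) (prev : Option (List Words)) (acc : Bit) :
    QM (List Words × Bit) := do
  let env ← buildLines B i prev B []
  let b ← buildBad env B acc
  return (env, b)

/-- The bound for the number of steps for a duplicate. -/
def Model.cost (B : Model) : ℕ := B.length * (1000 * B.unit + 1) + 10 * B.length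

theorem bitAt_below {B : Model} (hB : B.WF) {N : ℕ} {env : List Words} (henv : EnvOK N B env)
    (hlen : env.length = B.length) {c : Nid} (hc : Line.bad c ∈ B) : (bitAt env c).Below N := by
  obtain ⟨h1, h2⟩ := hB.of_bad hc
  exact (henv c (hlen ▸ h1) _ h2).word.head

theorem buildDuplicate_triple {B : Model} (hB : B.WF) {i : ℕ} {prev : Option (List Words)}
    {acc : Bit} {q : QState} (σ : Nid → Value) (ι : Nid → ℕ) {T : Asg → Prop}
    (hprev : ∀ p, prev = some p → EnvOK q.qubits B p ∧ p.length = B.length)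
    (hacc : acc.Below q.qubits) (hT : Stable q.qubits T) :
    Triple q (buildDuplicate B i prev acc) B.cost
      (fun q' a => q.qubits ≤ q'.qubits ∧ a.1.length = B.length ∧
        DupOK B i prev q.inputs a.1 q' ∧ a.2.Below q'.qubits) T
      (fun x a => T x ∧ ∀ j < B.length, Chosen B σ ι prev x j (a.1.getD j []))
      (fun x a => (∀ j < B.length, Computes B x a.1 j (a.1.getD j [])) ∧
        (a.2.val x = true ↔
          acc.val x = true ∨ ∃ c, Line.bad c ∈ B ∧ (bitAt a.1 c).val x = true)) := by
  have h0 : DupOK B i prev q.inputs [] q :=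
    ⟨Nat.zero_le _, fun _ hj => absurd hj (Nat.not_lt_zero _),
      fun _ hj => absurd hj (Nat.not_lt_zero _), fun _ hj => absurd hj (Nat.not_lt_zero _),
      fun r hr => .inl hr, fun r hr => hr⟩
  refine Triple.bind (buildLines_triple hB σ ι B [] q T rfl h0 hprev hT) fun h₁ => ?_
  obtain ⟨h1, -, h2, h3⟩ := h₁
  generalize (out (buildLines B i prev B []) q).1 = env at h2 h3 ⊢
  generalize (out (buildLines B i prev B []) q).2 = q₁ at h1 h3 ⊢
  have hs : Stable q₁.qubits
      (fun x => T x ∧ ∀ j < B.length, Chosen B σ ι prev x j (env.getD j [])) :=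
    (hT.mono h1).and fun x y hxy h j hj =>
      (h j hj).congr hxy fun s hs => h3.shape j (by omega) s hs
  have hc := Circ.map (V' := fun N a => a.1 = env ∧ a.2.Below N)
    (S' := fun x a => a.2.val x = true ↔
      acc.val x = true ∨ ∃ c, Line.bad c ∈ B ∧ (bitAt env c).val x = true)
    (fun b => (env, b)) (buildBad_circ (q := q₁) (env := env) (ls := B) (hacc.mono h1)
      fun c hc => bitAt_below hB h3.shape h2 hc) (fun _ _ h => ⟨rfl, h⟩) fun _ _ => id
  refine (Triple.of_spec (hc.frame hs)).weaken le_rfl ?_ ?_ ?_ ?_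
  · rintro q' ⟨e, b⟩ ⟨h4, h5, rfl, h6⟩
    exact ⟨h1.trans h4, h2, h3.of_le h4 h5, h6⟩
  · exact fun x hx => ⟨hx.2.1, fun j hj => hx.2.2 j (Nat.zero_le _) hj⟩
  · rintro q' x ⟨e, b⟩ ⟨-, -, rfl, -⟩ - h
    exact h
  · rintro q' x ⟨e, b⟩ ⟨-, -, rfl, -⟩ h h'
    exact ⟨fun j hj => h' j (Nat.zero_le _) hj, h⟩

/-- The circuits of the lines of the `k`-th duplicate. -/
def circuits (B : Model) (q : QState) (k : ℕ) : List Words := (out (buildDuplicates B k) q).1.1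

/-- The circuits of the duplicate before the `k`-th one. -/
def circuitsBefore (B : Model) (q : QState) : ℕ → Option (List Words)
  | 0 => none
  | k + 1 => some (circuits B q k)

/-- The duplicates up to the `i`-th one, built from the state `q`, are complete in the state
`q'`. -/
structure Complete (B : Model) (q : QState) (i : ℕ) (q' : QState) : Prop where
  length : ∀ k ≤ i, (circuits B q k).length = B.length
  shape : ∀ k ≤ i, EnvOK q'.qubits B (circuits B q k)
  link : ∀ k ≤ i, ∀ j s, B[j]? = some (.state s) →
    Linked B (circuitsBefore B q k) (circuits B q k) j ((circuits B q k).getD j [])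
  input : ∀ k ≤ i, ∀ j w, B[j]? = some (.input w) → ∃ qs, (k, j, qs) ∈ q'.inputs ∧
    InputRecord B k (k, j, qs) ((circuits B q k).getD j [])
  record : ∀ r ∈ q'.inputs, ∃ k ≤ i, r.2.1 < B.length ∧
    InputRecord B k r ((circuits B q k).getD r.2.1 [])

/-- The duplicates are built without penalty for any input and any initial values, and the bit they
return is the disjunction of all `bad` conditions. -/
theorem buildDuplicates_triple {B : Model} (hB : B.WF) {q : QState} (hq : q.inputs = [])
    (σ : Nid → Value) (I : Input) (i : ℕ) :
    Triple q (buildDuplicates B i) ((i + 1) * B.cost)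
      (fun q' a => Complete B q i q' ∧ a.2.Below q'.qubits) (fun _ => True)
      (fun x _ => ∀ k ≤ i, ∀ j < B.length,
        Chosen B σ (I k) (circuitsBefore B q k) x j ((circuits B q k).getD j []))
      (fun x a => (∀ k ≤ i, ∀ j < B.length,
          Computes B x (circuits B q k) j ((circuits B q k).getD j [])) ∧
        (a.2.val x = true ↔
          ∃ k ≤ i, ∃ c, Line.bad c ∈ B ∧ (bitAt (circuits B q k) c).val x = true)) := by
  induction i with
  | zero =>
    have h := buildDuplicate_triple (i := 0) (prev := none) (acc := .const false) hB (q := q) σ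
      (I 0) (T := fun _ => True) (fun p hp => by cases hp) trivial fun _ _ _ _ => trivial
    have e : (out (buildDuplicate B 0 none (.const false)) q).1.1 = circuits B q 0 := rfl
    refine ⟨h.grows, h.steps.trans (by omega), ?_, ?_, ?_⟩
    · obtain ⟨-, h2, h3, h4⟩ := h.valid
      rw [e] at h2 h3
      refine ⟨⟨?_, ?_, ?_, ?_, ?_⟩, h4⟩
      · rintro k hk
        obtain rfl := Nat.le_zero.mp hk
        exact h2
      · rintro k hk
        obtain rfl := Nat.le_zero.mp hk
        exact h3.shape
      · rintro k hk j s hs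
        obtain rfl := Nat.le_zero.mp hk
        exact h3.link j (h2 ▸ (List.getElem?_eq_some_iff.mp hs).1) s hs
      · rintro k hk j w hw
        obtain rfl := Nat.le_zero.mp hk
        exact h3.input j (h2 ▸ (List.getElem?_eq_some_iff.mp hw).1) w hw
      · intro r hr
        rcases h3.record r hr with hr | ⟨h5, h6⟩
        · rw [hq] at hr
          cases hr
        · exact ⟨0, le_rfl, h2 ▸ h5, h6⟩
    · intro x hx
      obtain ⟨h1, h2⟩ := h.sound x hx
      refine ⟨fun k hk => ?_, h2.trans ?_⟩
      · obtain rfl := Nat.le_zero.mp hk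
        exact h1
      · constructor
        · rintro (h | h)
          · cases h
          · exact ⟨0, le_rfl, h⟩
        · rintro ⟨k, hk, h⟩
          obtain rfl := Nat.le_zero.mp hk
          exact .inr h
    · intro hu x _
      obtain ⟨y, h1, h2, -, h3⟩ := h.total hu x trivial
      refine ⟨y, h1, h2, fun k hk => ?_⟩
      obtain rfl := Nat.le_zero.mp hk
      exact h3
  | succ i ih =>
    -- The results have to be known for the statement to mention the circuits of the last duplicate.
    suffices h : Triple q (buildDuplicates B (i + 1)) ((i + 1) * B.cost + B.cost)
        (fun q' a => a.1 = circuits B q (i + 1) → Complete B q (i + 1) q' ∧ a.2.Below q'.qubits)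
        (fun _ => True)
        (fun x a => a.1 = circuits B q (i + 1) → ∀ k ≤ i + 1, ∀ j < B.length,
          Chosen B σ (I k) (circuitsBefore B q k) x j ((circuits B q k).getD j []))
        (fun x a => a.1 = circuits B q (i + 1) → (∀ k ≤ i + 1, ∀ j < B.length,
            Computes B x (circuits B q k) j ((circuits B q k).getD j [])) ∧
          (a.2.val x = true ↔
            ∃ k ≤ i + 1, ∃ c, Line.bad c ∈ B ∧ (bitAt (circuits B q k) c).val x = true)) by
      refine ⟨h.grows, h.steps.trans (by rw [Nat.succ_mul (i + 1)]), h.valid rfl,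
        fun x hx => h.sound x hx rfl, fun hu x hx => ?_⟩
      obtain ⟨y, h1, h2, h3⟩ := h.total hu x hx
      exact ⟨y, h1, h2, h3 rfl⟩
    refine Triple.bind
      (f := fun a => buildDuplicate B (i + 1) (some a.1) a.2) ih fun h₁ => ?_
    obtain ⟨h₁, h₂⟩ := h₁
    have hT : Stable (out (buildDuplicates B i) q).2.qubits (fun x => ∀ k ≤ i, ∀ j < B.length,
        Chosen B σ (I k) (circuitsBefore B q k) x j ((circuits B q k).getD j [])) :=
      fun x y hxy h k hk j hj => (h k hk j hj).congr hxy fun s hs =>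
        h₁.shape k hk j (by rw [h₁.length k hk]; exact hj) s hs
    refine (buildDuplicate_triple hB σ (I (i + 1)) (fun p hp => ?_) h₂ hT).weaken le_rfl
      ?_ (fun x hx => hx.2) ?_ ?_
    · cases hp
      exact ⟨h₁.shape i le_rfl, h₁.length i le_rfl⟩
    · rintro q' ⟨e, b⟩ ⟨h1, h2, h3, h4⟩ (rfl : e = _)
      have cases_le : ∀ {k}, k ≤ i + 1 → k ≤ i ∨ k = i + 1 := fun h => by omega
      refine ⟨⟨?_, ?_, ?_, ?_, ?_⟩, h4⟩
      · intro k hk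
        rcases cases_le hk with hk | rfl
        · exact h₁.length k hk
        · exact h2
      · intro k hk
        rcases cases_le hk with hk | rfl
        · exact (h₁.shape k hk).mono h1
        · exact h3.shape
      · intro k hk j s hs
        rcases cases_le hk with hk | rfl
        · exact h₁.link k hk j s hs
        · exact h3.link j (h2 ▸ (List.getElem?_eq_some_iff.mp hs).1) s hs
      · intro k hk j w hw
        rcases cases_le hk with hk | rfl
        · obtain ⟨qs, h5, h6⟩ := h₁.input k hk j w hw
          exact ⟨qs, h3.subset h5, h6⟩
        · exact h3.input j (h2 ▸ (List.getElem?_eq_some_iff.mp hw).1) w hw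
      · intro r hr
        rcases h3.record r hr with hr | ⟨h5, h6⟩
        · obtain ⟨k, hk, h⟩ := h₁.record r hr
          exact ⟨k, by omega, h⟩
        · exact ⟨i + 1, le_rfl, h2 ▸ h5, h6⟩
    · rintro q' x ⟨e, b⟩ - - ⟨h1, h2⟩ (rfl : e = _) k hk
      rcases hk.eq_or_lt with rfl | hk
      · exact h2
      · exact h1 k (by omega)
    · rintro q' x ⟨e, b⟩ - ⟨h1, h2⟩ ⟨h3, h4⟩ (rfl : e = _)
      refine ⟨fun k hk => ?_, h2.trans ?_⟩
      · rcases hk.eq_or_lt with rfl | hk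
        · exact h1
        · exact h3 k (by omega)
      · rw [h4]
        constructor
        · rintro (⟨k, hk, h⟩ | h)
          · exact ⟨k, by omega, h⟩
          · exact ⟨i + 1, le_rfl, h⟩
        · rintro ⟨k, hk, h⟩
          rcases hk.eq_or_lt with rfl | hk
          · exact .inr h
          · exact .inl ⟨k, by omega, h⟩

/-! ### Runs of a model -/

/-- Each line is evaluated from the values of the lines before it. -/
theorem Model.eval_spec (B : Model) (σ : Nid → Value) (ι : Nid → ℕ) :
    (B.eval σ ι).length = B.length ∧ ∀ (j : ℕ) (l : Line), B[j]? = some l →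
      (B.eval σ ι)[j]? = some (l.eval σ ι ((B.eval σ ι).take j)) := by
  induction B using List.reverseRecOn with
  | nil => exact ⟨rfl, fun j l h => by cases h⟩
  | append_singleton B a ih =>
    obtain ⟨h1, h2⟩ := ih
    have e : Model.eval (B ++ [a]) σ ι = Model.eval B σ ι ++ [a.eval σ ι (Model.eval B σ ι)] := by
      simp [Model.eval, List.foldl_append]
    refine ⟨by rw [e]; simp [h1], fun j l h => ?_⟩
    rw [e]
    rcases lt_or_ge j B.length with hj | hj
    · rw [List.getElem?_append_left hj] at h
      rw [List.getElem?_append_left (h1.symm ▸ hj), List.take_append_of_le_length (h1.symm ▸ hj.le)]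
      exact h2 j l h
    · obtain rfl : j = B.length := by
        have := (List.getElem?_eq_some_iff.mp h).1
        rw [List.length_append, List.length_singleton] at this
        omega
      rw [List.getElem?_concat_length] at h
      cases h
      rw [← h1, List.getElem?_concat_length, List.take_left']
      rfl

theorem valueAt_take {env : List Value} {v j : Nid} (h : v < j) :
    valueAt (env.take j) v = valueAt env v := by
  simp [valueAt, List.getD_eq_getElem?_getD, List.getElem?_take, h]

/-- If the circuits of a duplicate compute the values of their lines, and input and state variables
have the values `ι` and `σ`, then the duplicate evaluates the model. The values of state variables
may be given in terms of those of previous lines. -/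
theorem eval_eq_decodeEnv {B : Model} {σ : Nid → Value} {ι : Nid → ℕ} {x : Asg} {env : List Words}
    (hlen : env.length = B.length) (hc : ∀ j < B.length, Computes B x env j (env.getD j []))
    (hin : ∀ (j w : ℕ), B[j]? = some (.input w) → valW x ((env.getD j []).headD []) = ι j % 2 ^ w)
    (hst : ∀ (j : ℕ) (s : Srt), B[j]? = some (.state s) →
      (∀ v < j, valueAt (B.eval σ ι) v = valueAt (decodeEnv x B env) v) →
      (σ j).as s = decode x s (env.getD j [])) :
    B.eval σ ι = decodeEnv x B env := by
  obtain ⟨h1, h2⟩ := B.eval_spec σ ι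
  have h3 : (decodeEnv x B env).length = B.length := by simp [decodeEnv, hlen]
  suffices h : ∀ m ≤ B.length, (B.eval σ ι).take m = (decodeEnv x B env).take m by
    have := h B.length le_rfl
    rwa [List.take_of_length_le h1.le, List.take_of_length_le h3.le] at this
  intro m
  induction m with
  | zero => simp
  | succ m ih =>
    intro hm
    have ih := ih (by omega)
    obtain ⟨l, hl⟩ : ∃ l, B[m]? = some l := ⟨_, List.getElem?_eq_getElem hm⟩
    have h4 : (decodeEnv x B env)[m]? = some (lineValue x l (env.getD m [])) := by
      rw [decodeEnv, List.getElem?_zipWith, hl, List.getElem?_eq_getElem (by omega),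
        List.getD_eq_getElem _ _ (by omega)]
    rw [List.take_add_one, List.take_add_one, ih, h2 m l hl, h4, ih]
    congr 3
    have h5 : ((decodeEnv x B env).take m).length = m := by simp; omega
    by_cases hs : ∃ s, l = .state s
    · obtain ⟨s, rfl⟩ := hs
      rw [lineValue_of_sort rfl, Line.eval, h5, hst m s hl fun v hv => ?_]
      rw [← valueAt_take hv, ih, valueAt_take hv]
    by_cases hi : ∃ w, l = .input w
    · obtain ⟨w, rfl⟩ := hi
      rw [lineValue_of_sort rfl, Line.eval, h5, decode, hin m w hl]
      congr 1
      apply BitVec.eq_of_toNat_eq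
      simp
    · exact (hc m hm l hl (fun s h => hs ⟨s, h⟩) (fun w h => hi ⟨w, h⟩) σ ι).symm

theorem valW_qubits_eq_iff (x : Asg) (qs : List ℕ) (v : ℕ) :
    valW x (qs.map .qubit) = v % 2 ^ qs.length ↔
      ∀ (k : ℕ) (hk : k < qs.length), x qs[k] = v.testBit k := by
  have key : ∀ (k : ℕ) (hk : k < qs.length),
      (valW x (qs.map .qubit)).testBit k = x qs[k] := by
    intro k hk
    rw [testBit_valW]
    simp [List.getD_eq_getElem?_getD, hk, Bit.val]
  constructor
  · intro h k hk
    rw [← key k hk, h, Nat.testBit_mod_two_pow]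
    simp [hk]
  · intro h
    apply Nat.eq_of_testBit_eq
    intro k
    rw [Nat.testBit_mod_two_pow]
    by_cases hk : k < qs.length
    · rw [key k hk, h k hk]
      simp [hk]
    · have hlt := valW_lt_length x (qs.map .qubit)
      rw [List.length_map] at hlt
      rw [Nat.testBit_lt_two_pow (hlt.trans_le (Nat.pow_le_pow_right two_pos (not_lt.mp hk)))]
      simp [hk]

section

variable {B : Model} {q q' : QState} {n : ℕ} {I : Input} {x : Asg}

/-- The input qubits have the values that `I` gives to them if and only if the circuits of the input
variables do. -/
theorem Complete.agrees_iff (h : Complete B q n q') : q'.Agrees I x ↔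
    ∀ k ≤ n, ∀ (j w : ℕ), B[j]? = some (.input w) →
      valW x (((circuits B q k).getD j []).headD []) = I k j % 2 ^ w := by
  constructor
  · intro ha k hk j w hw
    obtain ⟨qs, h1, -, h2, h3⟩ := h.input k hk j w hw
    rw [hw] at h3
    cases h3
    simp only at h2
    rw [h2]
    exact (valW_qubits_eq_iff x qs _).mpr (ha _ h1)
  · intro ha r hr
    obtain ⟨k, hk, -, h1, h2, h3⟩ := h.record r hr
    have := ha k hk _ _ h3
    rw [h2] at this
    rw [h1]
    exact (valW_qubits_eq_iff x _ _).mp this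

theorem lineValue_congr {x : Asg} {B : Model} {i j : Nid} {s : Srt} {e e' : List Words}
    (hi : B[i]? = some (.state s)) (hj : (B[j]?).bind Line.sort = some s)
    (he : e.length = B.length) (he' : e'.length = B.length) (h : e.getD i [] = e'.getD j []) :
    valueAt (decodeEnv x B e) i = valueAt (decodeEnv x B e') j := by
  obtain ⟨l, hl, hs⟩ := Option.bind_eq_some_iff.mp hj
  rw [valueAt_decodeEnv (he ▸ (List.getElem?_eq_some_iff.mp hi).1) hi,
    valueAt_decodeEnv (he' ▸ (List.getElem?_eq_some_iff.mp hl).1) hl,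
    lineValue_of_sort (s := s) rfl, lineValue_of_sort hs, h]

theorem bitAt_iff (hB : B.WF) (h : Complete B q n q') {k : ℕ} (hk : k ≤ n) {c : Nid}
    (hc : Line.bad c ∈ B) : (bitAt (circuits B q k) c).val x = true ↔
      operand (decodeEnv x B (circuits B q k)) (.bitvec 1) c = 1#1 := by
  obtain ⟨h1, h2⟩ := hB.of_bad hc
  have h3 : c < (circuits B q k).length := by rw [h.length k hk]; exact h1
  rw [operand_decodeEnv h3 h2]
  exact (ofNat_one_eq_iff (h.shape k hk c h3 _ h2).word).symm

/-- The values of the circuits are a run of the model. -/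
theorem Complete.badReachable (hB : B.WF) (h : Complete B q n q')
    (hc : ∀ k ≤ n, ∀ j < B.length,
      Computes B x (circuits B q k) j ((circuits B q k).getD j []))
    (ha : q'.Agrees I x)
    (hbad : ∃ k ≤ n, ∃ c, Line.bad c ∈ B ∧ (bitAt (circuits B q k) c).val x = true) :
    B.BadReachable n I := by
  obtain ⟨k, hk, c, hcB, hbit⟩ := hbad
  have ha := h.agrees_iff.mp ha
  have key : ∀ i ≤ n, B.eval (valueAt (decodeEnv x B (circuits B q i))) (I i) =
      decodeEnv x B (circuits B q i) := by
    intro i hi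
    refine eval_eq_decodeEnv (h.length i hi) (hc i hi) (ha i hi) fun j s hj _ => ?_
    have hj' := (List.getElem?_eq_some_iff.mp hj).1
    rw [valueAt_decodeEnv (by rw [h.length i hi]; exact hj') hj, lineValue_of_sort rfl, Value.as_mk]
  refine ⟨k, hk, fun i => valueAt (decodeEnv x B (circuits B q i)), ?_, ?_, c, hcB, ?_⟩
  · intro s st v hv
    have h0 := h.length 0 (Nat.zero_le _)
    obtain ⟨h1, -, h2⟩ := hB.of_init hv
    rw [key 0 (Nat.zero_le _)]
    exact lineValue_congr h1 h2 h0 h0 (h.link 0 (Nat.zero_le _) st s h1 v (hB.findSome?_init hv))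
  · intro i hi s st v hv
    obtain ⟨h1, h2⟩ := hB.of_next hv
    rw [key i (by omega)]
    obtain ⟨v', h3, h4⟩ := h.link (i + 1) (by omega) st s h1
    rw [hB.findSome?_next hv] at h3
    cases h3
    exact lineValue_congr h1 h2 (h.length _ (by omega)) (h.length _ (by omega)) h4
  · rw [key k hk]
    exact (bitAt_iff hB h hk hcB).mp hbit

/-- The circuits compute the values of every run that they have been given the inputs and initial
values of. -/
theorem Complete.bad_of_run (hB : B.WF) (h : Complete B q n q')
    (hc : ∀ k ≤ n, ∀ j < B.length,
      Computes B x (circuits B q k) j ((circuits B q k).getD j []))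
    (ha : q'.Agrees I x) {k : ℕ} (hk : k ≤ n) {σ : ℕ → Nid → Value}
    (hσ : ∀ (j : ℕ) (s : Srt), B[j]? = some (.state s) → B.findSome? (Line.initOf j) = none →
      decode x s ((circuits B q 0).getD j []) = (σ 0 j).as s)
    (h0 : B.Initial (I 0) (σ 0)) (hstep : ∀ i < k, B.Step (I i) (σ i) (σ (i + 1)))
    (hbad : B.Bad (I k) (σ k)) :
    ∃ k ≤ n, ∃ c, Line.bad c ∈ B ∧ (bitAt (circuits B q k) c).val x = true := by
  have ha := h.agrees_iff.mp ha
  have as_eq : ∀ {i j v : ℕ} {s : Srt} {e : List Words} {u : Value}, i ≤ n →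
      B[j]? = some (.state s) → (B[v]?).bind Line.sort = some s → e.length = B.length →
      u = valueAt (decodeEnv x B e) v → (circuits B q i).getD j [] = e.getD v [] →
      u.as s = decode x s ((circuits B q i).getD j []) := by
    intro i j v s e u hi hj hv he hu hz
    rw [hu, ← lineValue_congr hj hv (h.length i hi) he hz, valueAt_decodeEnv
      (by rw [h.length i hi]; exact (List.getElem?_eq_some_iff.mp hj).1) hj, lineValue_of_sort rfl,
      Value.as_mk]
  have key : ∀ i ≤ k, B.eval (σ i) (I i) = decodeEnv x B (circuits B q i) := by
    intro i
    induction i with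
    | zero =>
      intro _
      have h00 := Nat.zero_le n
      refine eval_eq_decodeEnv (h.length 0 h00) (hc 0 h00) (ha 0 h00) fun j s hj hpre => ?_
      cases hv : B.findSome? (Line.initOf j) with
      | none => exact (hσ j s hj hv).symm
      | some v =>
        have hmem := hB.init_of_findSome? hj hv
        obtain ⟨-, h1, h2⟩ := hB.of_init hmem
        exact as_eq h00 hj h2 (h.length 0 h00) ((h0 s j v hmem).trans (hpre v h1))
          (h.link 0 h00 j s hj v hv)
    | succ i ih =>
      intro hi
      have hi' : i + 1 ≤ n := hi.trans hk
      refine eval_eq_decodeEnv (h.length _ hi') (hc _ hi') (ha _ hi') fun j s hj _ => ?_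
      obtain ⟨v, h1, h2⟩ := h.link (i + 1) hi' j s hj
      obtain ⟨v', h3, h4⟩ := hB.exists_next hj
      rw [h1] at h3
      cases h3
      refine as_eq hi' hj (hB.of_next h4).2 (h.length i (by omega)) ?_ h2
      rw [← ih (by omega)]
      exact hstep i (by omega) s j v h4
  obtain ⟨c, hcB, hbit⟩ := hbad
  rw [key k le_rfl] at hbit
  exact ⟨k, hk, c, hcB, (bitAt_iff hB h hk hcB).mpr hbit⟩

end

/-! ### Correctness and cost of QUBOT -/

/-- The state in which the construction of the duplicates starts. -/
def start (B : Model) : QState :=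
  (out (charge B.length) { qubits := 0, offset := 0, terms := [], inputs := [], steps := 0 }).2

theorem start_value (B : Model) (x : Asg) : (start B).value x = 0 := rfl

theorem start_upperTriangular (B : Model) : (start B).UpperTriangular :=
  fun t ht => by cases ht

theorem runQubot_eq (B : Model) (n : ℕ) : runQubot B n =
    (out (assertTrue (out (buildDuplicates B n) (start B)).1.2)
      (out (buildDuplicates B n) (start B)).2).2 := rfl

section

variable {B : Model}

theorem qubot_upperTriangular (hB : B.WF) (n : ℕ) : (qubot B n).UpperTriangular := by
  have hd := buildDuplicates_triple hB (q := start B) rfl (fun _ => ⟨.bitvec 1, 0#1⟩)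
    (fun _ _ => 0) n
  have ha := assertTrue_spec hd.valid.2
  exact ha.grows.upper (hd.grows.upper (start_upperTriangular B))

theorem qubot_value_nonneg (hB : B.WF) (n : ℕ) (x : Asg) : 0 ≤ (qubot B n).value x := by
  have hd := buildDuplicates_triple hB (q := start B) rfl (fun _ => ⟨.bitvec 1, 0#1⟩)
    (fun _ _ => 0) n
  have ha := assertTrue_spec hd.valid.2
  have h1 := hd.grows.value x
  have h2 := ha.grows.value x
  rw [start_value] at h1
  exact h1.trans h2

theorem badReachable_of_value_eq_zero (hB : B.WF) (n : ℕ) {I : Input} {x : Asg}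
    (hI : (qubot B n).Agrees I x)
    (hx : (qubot B n).value x = 0) : B.BadReachable n I := by
  have hd := buildDuplicates_triple hB (q := start B) rfl (fun _ => ⟨.bitvec 1, 0#1⟩)
    (fun _ _ => 0) n
  have ha := assertTrue_spec hd.valid.2
  have h1 := hd.grows.value x
  have h2 := ha.grows.value x
  rw [start_value] at h1
  have hx : (runQubot B n).value x = 0 := hx
  rw [runQubot_eq] at hx
  obtain ⟨h3, h4⟩ := hd.sound x (by rw [start_value]; omega)
  have h5 := ha.sound x (by omega)
  have hI : (runQubot B n).Agrees I x := hI
  rw [runQubot_eq, Qubo.Agrees, ha.valid.1] at hI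
  exact hd.valid.1.badReachable hB h3 hI (h4.mp h5)

theorem exists_value_eq_zero (hB : B.WF) (n : ℕ) {I : Input} (h : B.BadReachable n I) :
    ∃ x, (qubot B n).Agrees I x ∧ (qubot B n).value x = 0 := by
  obtain ⟨k, hk, σ, h0, hstep, hbad⟩ := h
  have hd := buildDuplicates_triple hB (q := start B) rfl (σ 0) I n
  have ha := assertTrue_spec hd.valid.2
  have hu := start_upperTriangular B
  obtain ⟨y, -, h1, h2⟩ := hd.total hu (fun _ => false) trivial
  obtain ⟨h3, h4⟩ := hd.sound y h1
  have hag : (out (buildDuplicates B n) (start B)).2.Agrees I y :=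
    hd.valid.1.agrees_iff.mpr fun k hk j w hj =>
      (h2 k hk j (List.getElem?_eq_some_iff.mp hj).1).1 w hj
  have hacc := h4.mpr (hd.valid.1.bad_of_run hB h3 hag hk
    (fun j s hj hj' => (h2 0 (Nat.zero_le _) j (List.getElem?_eq_some_iff.mp hj).1).2 s hj rfl hj')
    h0 hstep hbad)
  obtain ⟨z, h5, h6, -⟩ := ha.total (hd.grows.upper hu) y hacc
  refine ⟨z, ?_, ?_⟩
  · change (runQubot B n).Agrees I z
    rw [runQubot_eq, Qubo.Agrees, ha.valid.1]
    refine hd.valid.1.agrees_iff.mpr fun k hk j w hj => ?_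
    have hj' := (List.getElem?_eq_some_iff.mp hj).1
    rw [← (hd.valid.1.shape k hk j (by rw [hd.valid.1.length k hk]; exact hj') (.bitvec w)
      (by rw [hj]; rfl)).word.agree h5]
    exact hd.valid.1.agrees_iff.mp hag k hk j w hj
  · change (runQubot B n).value z = 0
    rw [runQubot_eq, h6, ← (hd.grows.upper hu).value_congr h5, h1, start_value]

theorem exists_agrees (hB : B.WF) (n : ℕ) (I : Input) : ∃ x, (qubot B n).Agrees I x := by
  have hd := buildDuplicates_triple hB (q := start B) rfl (fun _ => ⟨.bitvec 1, 0#1⟩) I n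
  have ha := assertTrue_spec hd.valid.2
  obtain ⟨y, -, h1, h2⟩ := hd.total (start_upperTriangular B) (fun _ => false) trivial
  refine ⟨y, ?_⟩
  change (runQubot B n).Agrees I y
  rw [runQubot_eq, Qubo.Agrees, ha.valid.1]
  exact hd.valid.1.agrees_iff.mpr fun k hk j w hj =>
    (h2 k hk j (List.getElem?_eq_some_iff.mp hj).1).1 w hj

/-- Every assignment of the qubits determines an input. -/
theorem exists_agrees_self (hB : B.WF) (n : ℕ) (x : Asg) : ∃ I, (qubot B n).Agrees I x := by
  have hd := buildDuplicates_triple hB (q := start B) rfl (fun _ => ⟨.bitvec 1, 0#1⟩)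
    (fun _ _ => 0) n
  have ha := assertTrue_spec hd.valid.2
  let I : Input := fun k j => valW x (((circuits B (start B) k).getD j []).headD [])
  refine ⟨I, ?_⟩
  change (runQubot B n).Agrees I x
  rw [runQubot_eq, Qubo.Agrees, ha.valid.1]
  refine hd.valid.1.agrees_iff.mpr fun k hk j w hj => ?_
  have hj' := (List.getElem?_eq_some_iff.mp hj).1
  exact (Nat.mod_eq_of_lt ((hd.valid.1.shape k hk j (by rw [hd.valid.1.length k hk]; exact hj')
    (.bitvec w) (by rw [hj]; rfl)).word.lt x)).symm

theorem evaluatesTo_zero_iff (hB : B.WF) (n : ℕ) (I : Input) :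
    (qubot B n).EvaluatesTo I 0 ↔ ∃ x, (qubot B n).Agrees I x ∧ (qubot B n).value x = 0 := by
  constructor
  · rintro ⟨⟨x, h, h'⟩, -⟩
    exact ⟨x, h, h'.symm⟩
  · rintro ⟨x, h, h'⟩
    refine ⟨⟨x, h, h'.symm⟩, ?_⟩
    rintro v ⟨y, -, rfl⟩
    exact qubot_value_nonneg hB n y

theorem badReachable_iff_evaluatesTo_zero (hB : B.WF) (n : ℕ) (I : Input) :
    B.BadReachable n I ↔ (qubot B n).EvaluatesTo I 0 := by
  rw [evaluatesTo_zero_iff hB]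
  exact ⟨exists_value_eq_zero hB n, fun ⟨x, h, h'⟩ => badReachable_of_value_eq_zero hB n h h'⟩

theorem exists_evaluatesTo (hB : B.WF) (n : ℕ) (I : Input) :
    ∃ e : ℤ, (qubot B n).EvaluatesTo I e ∧ 0 ≤ e := by
  have hbdd : ∀ v, (∃ x, (qubot B n).Agrees I x ∧ v = (qubot B n).value x) → 0 ≤ v := by
    rintro v ⟨x, -, rfl⟩
    exact qubot_value_nonneg hB n x
  obtain ⟨x, hx⟩ := exists_agrees hB n I
  obtain ⟨e, he, hle⟩ := Int.exists_least_of_bdd ⟨0, hbdd⟩ ⟨_, x, hx, rfl⟩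
  exact ⟨e, ⟨he, fun v hv => hle v hv⟩, hbdd e he⟩

theorem exists_badReachable_iff (hB : B.WF) (n : ℕ) :
    (∃ I, B.BadReachable n I) ↔ ∃ x, (qubot B n).value x = 0 := by
  constructor
  · rintro ⟨I, h⟩
    obtain ⟨x, -, hx⟩ := exists_value_eq_zero hB n h
    exact ⟨x, hx⟩
  · rintro ⟨x, hx⟩
    obtain ⟨I, hI⟩ := exists_agrees_self hB n x
    exact ⟨I, badReachable_of_value_eq_zero hB n hI hx⟩

/-- The table of lines, the `n + 1` duplicates, and the final constraint. -/
theorem qubotTime_le (hB : B.WF) (n : ℕ) :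
    qubotTime B n ≤ 2000 * (n + 1) * B.unit * (B.length + 1) := by
  have hd := buildDuplicates_triple hB (q := start B) rfl (fun _ => ⟨.bitvec 1, 0#1⟩)
    (fun _ _ => 0) n
  have ha := assertTrue_spec hd.valid.2
  have h1 := hd.steps
  have h2 := ha.steps
  have h0 : (start B).steps = 0 + B.length := rfl
  have hu := one_le_unit B
  have h3 : B.cost ≤ 1011 * (B.unit * B.length) := by
    have : B.length ≤ B.unit * B.length := Nat.le_mul_of_pos_left _ hu
    have e : B.cost = 1000 * (B.unit * B.length) + 11 * B.length := by rw [Model.cost]; ring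
    omega
  have h4 := Nat.mul_le_mul_left (n + 1) h3
  have h5 : B.length + 1 ≤ (n + 1) * (B.unit * (B.length + 1)) :=
    (Nat.le_mul_of_pos_left _ hu).trans (Nat.le_mul_of_pos_left _ n.succ_pos)
  have h6 : (n + 1) * (B.unit * B.length) ≤ (n + 1) * (B.unit * (B.length + 1)) := by gcongr; omega
  calc qubotTime B n ≤ 2000 * ((n + 1) * (B.unit * (B.length + 1))) := by
        rw [qubotTime, runQubot_eq]
        have e : (n + 1) * (1011 * (B.unit * B.length)) =
          1011 * ((n + 1) * (B.unit * B.length)) := by ring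
        omega
    _ = _ := by ring

/-- Every qubit, term and table entry is paid for by a step. -/
theorem qubot_size_le_qubotTime (hB : B.WF) (n : ℕ) : (qubot B n).size ≤ qubotTime B n := by
  have hd := buildDuplicates_triple hB (q := start B) rfl (fun _ => ⟨.bitvec 1, 0#1⟩)
    (fun _ _ => 0) n
  have ha := assertTrue_spec hd.valid.2
  have h1 := hd.grows.size
  have h2 := ha.grows.size
  have h0 : (start B).size = 0 := rfl
  change (runQubot B n).size ≤ (runQubot B n).steps
  rw [runQubot_eq]
  omega

end

/-! ### Well-formedness of unfinished models -/

/-- The line `x` of `B` defines a value of sort `s`. -/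
def Has (B : Model) (x : Nid) (s : Srt) : Prop := (B[x]?).bind Line.sort = some s

/-- The line `l` satisfies the conditions on the line `j` of `B`, except for those on the numbers of
`init` and `next` lines of state variables. Its sort is that of bitvectors of at most `w` bits. -/
def Line.Checked (w : ℕ) (B : Model) (j : Nid) (l : Line) : Prop :=
  (∀ s, l.sort = some s → ∃ v, s = .bitvec v ∧ 0 < v ∧ v ≤ w) ∧
  (∀ x s, (x, s) ∈ l.operands → x < j ∧ Has B x s) ∧
  match l with
  | .slice v u l _ => l ≤ u ∧ u < v
  | .init s st val => B[st]? = some (.state s) ∧ val < st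
  | .next s st _ => B[st]? = some (.state s)
  | _ => True

/-- The model is well-formed, without arrays and with bitvectors of at most `w` bits, except that
the state variables in `P` still lack their `next` lines. -/
structure Inv (w : ℕ) (B : Model) (P : Multiset (Nid × Srt)) : Prop where
  line : ∀ (j : ℕ) (l : Line), B[j]? = some l → l.Checked w B j
  init : ∀ (j : ℕ) (s : Srt), B[j]? = some (.state s) → (B.filterMap (Line.initOf j)).length ≤ 1
  next : ∀ (j : ℕ) (s : Srt), B[j]? = some (.state s) →
    (B.filterMap (Line.nextOf j)).length + (P.map Prod.fst).count j = 1
  pending : ∀ p ∈ P, B[p.1]? = some (.state p.2)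

theorem getElem?_append_some {α : Type} {l m : List α} {j : ℕ} {a : α} (h : l[j]? = some a) :
    (l ++ m)[j]? = some a := by
  rw [List.getElem?_append_left (List.getElem?_eq_some_iff.mp h).1, h]

theorem Has.append {B : Model} {x : Nid} {s : Srt} (h : Has B x s) (B' : Model) :
    Has (B ++ B') x s := by
  obtain ⟨l, hl, hs⟩ := Option.bind_eq_some_iff.mp h
  exact Option.bind_eq_some_iff.mpr ⟨l, getElem?_append_some hl, hs⟩

theorem Has.lt {B : Model} {x : Nid} {s : Srt} (h : Has B x s) : x < B.length := by
  obtain ⟨l, hl, -⟩ := Option.bind_eq_some_iff.mp h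
  exact (List.getElem?_eq_some_iff.mp hl).1

theorem has_concat {B : Model} {l : Line} {s : Srt} (h : l.sort = some s) :
    Has (B ++ [l]) B.length s := by
  rw [Has, List.getElem?_concat_length]
  exact h

theorem Line.Checked.append {w : ℕ} {B : Model} {j : Nid} {l : Line} (h : l.Checked w B j)
    (B' : Model) : l.Checked w (B ++ B') j := by
  obtain ⟨h1, h2, h3⟩ := h
  refine ⟨h1, fun x s hx => ⟨(h2 x s hx).1, (h2 x s hx).2.append B'⟩, ?_⟩
  cases l with
  | init s st val => exact ⟨getElem?_append_some h3.1, h3.2⟩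
  | next s st val => exact getElem?_append_some (show B[st]? = _ from h3)
  | _ => exact h3

theorem getElem?_concat_cases {α : Type} {l : List α} {a b : α} {j : ℕ}
    (h : (l ++ [a])[j]? = some b) : l[j]? = some b ∨ j = l.length ∧ b = a := by
  rcases lt_or_ge j l.length with hj | hj
  · rw [List.getElem?_append_left hj] at h
    exact .inl h
  · obtain rfl : j = l.length := by
      have := (List.getElem?_eq_some_iff.mp h).1
      rw [List.length_append, List.length_singleton] at this
      omega
    rw [List.getElem?_concat_length] at h
    exact .inr ⟨rfl, (Option.some.inj h).symm⟩

section

variable {w : ℕ} {B : Model} {P : Multiset (Nid × Srt)}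

theorem Inv.line_concat (h : Inv w B P) {l : Line} (hl : l.Checked w (B ++ [l]) B.length) :
    ∀ (j : ℕ) (l' : Line), (B ++ [l])[j]? = some l' → l'.Checked w (B ++ [l]) j := by
  intro j l' hj
  rcases getElem?_concat_cases hj with hj | ⟨rfl, rfl⟩
  · exact (h.line j l' hj).append _
  · exact hl

/-- A line that is neither `slice`, `state`, `init` nor `next`. -/
def Line.Plain : Line → Prop
  | .slice _ _ _ _ => False
  | .state _ => False
  | .init _ _ _ => False
  | .next _ _ _ => False
  | _ => True

theorem Inv.plain (h : Inv w B P) {l : Line} (hl : l.Checked w B B.length) (hp : l.Plain) :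
    Inv w (B ++ [l]) P := by
  have h0 : ∀ (j : ℕ) (s : Srt), (B ++ [l])[j]? = some (.state s) → B[j]? = some (.state s) := by
    intro j s hj
    rcases getElem?_concat_cases hj with hj | ⟨-, rfl⟩
    · exact hj
    · exact hp.elim
  have h1 : ∀ j, Line.initOf j l = none := by
    intro j
    cases l <;> first | rfl | exact hp.elim
  have h2 : ∀ j, Line.nextOf j l = none := by
    intro j
    cases l <;> first | rfl | exact hp.elim
  refine ⟨h.line_concat (hl.append _), fun j s hj => ?_, fun j s hj => ?_,
    fun p hp => getElem?_append_some (h.pending p hp)⟩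
  · simpa [h1] using h.init j s (h0 j s hj)
  · simpa [h2] using h.next j s (h0 j s hj)

theorem Inv.nexts_eq_zero (h : Inv w B P) :
    (B.filterMap (Line.nextOf B.length)).length = 0 ∧
      (B.filterMap (Line.initOf B.length)).length = 0 ∧ (P.map Prod.fst).count B.length = 0 := by
  refine ⟨?_, ?_, ?_⟩
  · rw [List.length_eq_zero_iff, List.filterMap_eq_nil_iff]
    intro l hl
    obtain ⟨j, hj⟩ := List.mem_iff_getElem?.mp hl
    have := (h.line j l hj).2.2
    cases l with
    | next s st val =>
      have hst := (List.getElem?_eq_some_iff.mp (show B[st]? = _ from this)).1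
      simp only [Line.nextOf]
      rw [if_neg hst.ne]
    | _ => rfl
  · rw [List.length_eq_zero_iff, List.filterMap_eq_nil_iff]
    intro l hl
    obtain ⟨j, hj⟩ := List.mem_iff_getElem?.mp hl
    have := (h.line j l hj).2.2
    cases l with
    | init s st val =>
      have hst := (List.getElem?_eq_some_iff.mp this.1).1
      simp only [Line.initOf]
      rw [if_neg hst.ne]
    | _ => rfl
  · rw [Multiset.count_eq_zero, Multiset.mem_map]
    rintro ⟨p, hp, hp'⟩
    have := (List.getElem?_eq_some_iff.mp (h.pending p hp)).1
    omega

theorem Inv.state_init (h : Inv w B P) {v : ℕ} (hv : 0 < v) (hvw : v ≤ w) {x : Nid}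
    (hx : Has B x (.bitvec v)) :
    Inv w (B ++ [.state (.bitvec v)] ++ [.init (.bitvec v) B.length x])
      ((B.length, .bitvec v) ::ₘ P) := by
  obtain ⟨hn, hi, hP⟩ := h.nexts_eq_zero
  have hs : (B ++ [Line.state (.bitvec v)])[B.length]? = some (.state (.bitvec v)) :=
    List.getElem?_concat_length
  have hline : ∀ (j : ℕ) (l : Line), (B ++ [Line.state (.bitvec v)])[j]? = some l →
      l.Checked w (B ++ [Line.state (.bitvec v)]) j :=
    h.line_concat ⟨fun s hs => ⟨v, (Option.some.inj hs).symm, hv, hvw⟩, by simp [Line.operands],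
      trivial⟩
  have h0 : ∀ (j : ℕ) (s : Srt), (B ++ [.state (.bitvec v)] ++
      [.init (.bitvec v) B.length x])[j]? = some (.state s) →
        B[j]? = some (.state s) ∧ j ≠ B.length ∨ j = B.length := by
    intro j s hj
    rcases getElem?_concat_cases hj with hj | ⟨-, hj⟩
    · rcases getElem?_concat_cases hj with hj | ⟨hj, -⟩
      · exact .inl ⟨hj, (List.getElem?_eq_some_iff.mp hj).1.ne⟩
      · exact .inr hj
    · cases hj
  refine ⟨?_, fun j s hj => ?_, fun j s hj => ?_, fun p hp => ?_⟩
  · intro j l hj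
    rcases getElem?_concat_cases hj with hj | ⟨rfl, rfl⟩
    · exact (hline j l hj).append _
    · refine Line.Checked.append (l := .init (.bitvec v) B.length x)
        ⟨fun _ hs => (Option.some_ne_none _ hs.symm).elim, ?_, hs, hx.lt⟩ _
      intro y s hy
      simp only [Line.operands, List.mem_cons, Prod.mk.injEq, List.not_mem_nil, or_false] at hy
      rcases hy with ⟨rfl, rfl⟩ | ⟨rfl, rfl⟩
      · exact ⟨by simp, has_concat rfl⟩
      · exact ⟨hx.lt.trans_le (by simp), hx.append _⟩
  · rcases h0 j s hj with ⟨hj, hne⟩ | rfl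
    · simpa [Line.initOf, List.filterMap_cons, hne.symm] using h.init j s hj
    · simp [Line.initOf, List.filterMap_cons, hi]
  · rcases h0 j s hj with ⟨hj, hne⟩ | rfl
    · have := h.next j s hj
      simpa [Line.nextOf, List.filterMap_cons, Multiset.count_cons, hne] using this
    · simp [Line.nextOf, List.filterMap_cons, hn, hP]
  · rcases Multiset.mem_cons.mp hp with rfl | hp
    · exact getElem?_append_some hs
    · rw [List.append_assoc]
      exact getElem?_append_some (h.pending p hp)

theorem Inv.next_line {st : Nid} {s : Srt} (h : Inv w B ((st, s) ::ₘ P)) {x : Nid}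
    (hx : Has B x s) :
    Inv w (B ++ [.next s st x]) P := by
  have hst := h.pending (st, s) (Multiset.mem_cons_self _ _)
  have h0 : ∀ (j : ℕ) (s' : Srt), (B ++ [Line.next s st x])[j]? = some (.state s') →
      B[j]? = some (.state s') := by
    intro j s' hj
    rcases getElem?_concat_cases hj with hj | ⟨-, hj⟩
    · exact hj
    · cases hj
  refine ⟨h.line_concat (Line.Checked.append ⟨by simp [Line.sort], ?_, hst⟩ _), fun j s' hj => ?_,
    fun j s' hj => ?_,
    fun p hp => getElem?_append_some (h.pending p (Multiset.mem_cons_of_mem hp))⟩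
  · intro y s' hy
    simp only [Line.operands, List.mem_cons, Prod.mk.injEq, List.not_mem_nil, or_false] at hy
    rcases hy with ⟨rfl, rfl⟩ | ⟨rfl, rfl⟩
    · exact ⟨(List.getElem?_eq_some_iff.mp hst).1, by rw [Has, hst]; rfl⟩
    · exact ⟨hx.lt, hx⟩
  · simpa [Line.initOf, List.filterMap_cons] using h.init j s' (h0 j s' hj)
  · have := h.next j s' (h0 j s' hj)
    rw [Multiset.map_cons, Multiset.count_cons] at this
    by_cases hj : j = st
    · subst hj
      simp only [if_true] at this
      simp only [List.filterMap_append, Line.nextOf, List.filterMap_cons, if_true,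
        List.filterMap_nil, List.length_append, List.length_singleton]
      omega
    · have hj' : st ≠ j := fun h => hj h.symm
      simpa [Line.nextOf, List.filterMap_cons, hj, hj'] using this

/-- The model is well-formed if no state variable lacks its `next` line. -/
theorem Inv.wf (h : Inv w B 0) : B.WF := by
  intro j l hj
  obtain ⟨h1, h2, h3⟩ := h.line j l hj
  refine ⟨fun s hs => ?_, h2, ?_⟩
  · obtain ⟨v, rfl, hv, -⟩ := h1 s hs
    exact hv
  · cases l with
    | state s => exact ⟨h.init j s hj, by simpa using h.next j s hj⟩
    | _ => exact h3

theorem foldr_max_le {l : List ℕ} {a : ℕ} (ha : 1 ≤ a) (h : ∀ b ∈ l, b ≤ a) :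
    l.foldr max 1 ≤ a := by
  induction l with
  | nil => exact ha
  | cons b l ih =>
    exact max_le (h b (by simp)) (ih fun c hc => h c (List.mem_cons_of_mem _ hc))

theorem Inv.sort_eq (h : Inv w B P) {s : Srt} (hs : s ∈ B.filterMap Line.sort) :
    ∃ v, s = .bitvec v ∧ v ≤ w := by
  obtain ⟨l, hl, hs⟩ := List.mem_filterMap.mp hs
  obtain ⟨j, hj⟩ := List.mem_iff_getElem?.mp hl
  obtain ⟨v, hv, -, hvw⟩ := (h.line j l hj).1 s hs
  exact ⟨v, hv, hvw⟩

theorem Inv.wordSize_le (h : Inv w B P) (hw : 1 ≤ w) : B.wordSize ≤ w := by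
  refine foldr_max_le hw fun b hb => ?_
  obtain ⟨s, hs, rfl⟩ := List.mem_map.mp hb
  obtain ⟨v, rfl, hv⟩ := h.sort_eq hs
  exact hv

theorem Inv.memorySize_le (h : Inv w B P) : B.memorySize ≤ 1 := by
  refine foldr_max_le le_rfl fun b hb => ?_
  obtain ⟨s, hs, rfl⟩ := List.mem_map.mp hb
  obtain ⟨v, rfl, hv⟩ := h.sort_eq hs
  exact le_rfl

end

/-! ### A type system for programs that emit lines -/

/-- A list of nids with their sorts. -/
abbrev Facts := List (Nid × Srt)

/-- The lines of `B` have the sorts stated by `Γ`. -/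
def Known (B : Model) (Γ : Facts) : Prop := ∀ p ∈ Γ, Has B p.1 p.2

/-- If the facts `Γ` hold, and if the state variables `P` lack `next` lines, then the program `p`
appends at most `k` lines, all of them well-typed. With its result `a`, which satisfies `Q a`, the
facts `T a` hold, and the state variables `R a` lack `next` lines. -/
def Typed {α : Type} (w : ℕ) (Γ : Facts) (P : Multiset (Nid × Srt)) (p : BM α) (k : ℕ)
    (T : α → Facts) (R : α → Multiset (Nid × Srt)) (Q : α → Prop) : Prop :=
  ∀ B : Model, Inv w B P → Known B Γ → ∃ (a : α) (B' : Model), p B = (a, B ++ B') ∧ B'.length ≤ k ∧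
    Inv w (B ++ B') (R a) ∧ Known (B ++ B') (T a) ∧ Q a

theorem Known.append {B : Model} {Γ : Facts} (h : Known B Γ) (B' : Model) : Known (B ++ B') Γ :=
  fun p hp => (h p hp).append B'

section

variable {α β : Type} {w k k₁ k₂ : ℕ} {Γ : Facts} {P : Multiset (Nid × Srt)} {p : BM α}
  {f : α → BM β} {T₁ : α → Facts} {R₁ : α → Multiset (Nid × Srt)} {Q₁ : α → Prop} {T : β → Facts}
  {R : β → Multiset (Nid × Srt)} {Q : β → Prop}

theorem Typed.pure {b : β} (hT : T b ⊆ Γ) (hR : R b = P) (hQ : Q b) :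
    Typed w Γ P (pure b) 0 T R Q :=
  fun B hB hΓ => ⟨b, [], by rw [List.append_nil]; rfl, le_rfl, by rwa [List.append_nil, hR],
    by rw [List.append_nil]; exact fun p hp => hΓ p (hT hp), hQ⟩

theorem Typed.bind (hp : Typed w Γ P p k₁ T₁ R₁ Q₁)
    (hf : ∀ a, Q₁ a → Typed w (T₁ a ++ Γ) (R₁ a) (f a) k₂ T R Q) :
    Typed w Γ P (p >>= f) (k₁ + k₂) T R Q := by
  intro B hB hΓ
  obtain ⟨a, B₁, h1, h2, h3, h4, h5⟩ := hp B hB hΓ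
  obtain ⟨b, B₂, h6, h7, h8⟩ := hf a h5 (B ++ B₁) h3 fun p hp => by
    rcases List.mem_append.mp hp with hp | hp
    · exact h4 p hp
    · exact hΓ.append B₁ p hp
  rw [List.append_assoc] at h6 h8
  refine ⟨b, B₁ ++ B₂, ?_, by rw [List.length_append]; omega, h8⟩
  change f (p B).1 (p B).2 = _
  rw [h1]
  exact h6

theorem Typed.weaken {p : BM β} {k' : ℕ} {Γ' : Facts} {T' : β → Facts}
    {R' : β → Multiset (Nid × Srt)} {Q' : β → Prop} (h : Typed w Γ P p k T R Q) (hk : k ≤ k')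
    (hΓ : Γ ⊆ Γ') (hT : ∀ b, Q b → T' b ⊆ T b ++ Γ') (hR : ∀ b, Q b → R b = R' b)
    (hQ : ∀ b, Q b → Q' b) : Typed w Γ' P p k' T' R' Q' := by
  intro B hB hΓ'
  obtain ⟨b, B', h1, h2, h3, h4, h5⟩ := h B hB fun p hp => hΓ' p (hΓ hp)
  refine ⟨b, B', h1, h2.trans hk, hR b h5 ▸ h3, fun p hp => ?_, hQ b h5⟩
  rcases List.mem_append.mp (hT b h5 hp) with hp | hp
  · exact h4 p hp
  · exact hΓ'.append B' p hp

theorem Typed.le {p : BM β} {k' : ℕ} (h : Typed w Γ P p k T R Q) (hk : k ≤ k') :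
    Typed w Γ P p k' T R Q :=
  h.weaken hk (fun _ => id) (fun _ _ => List.subset_append_left _ _) (fun _ _ => rfl) fun _ => id

theorem Typed.mono {p : BM β} {Γ' : Facts} (h : Typed w Γ P p k T R Q) (hΓ : Γ ⊆ Γ') :
    Typed w Γ' P p k T R Q :=
  h.weaken le_rfl hΓ (fun _ _ => List.subset_append_left _ _) (fun _ _ => rfl) fun _ => id

/-- A line that is neither a state variable nor one of its `init` and `next` lines, nor a slice. -/
theorem Typed.emit_bind {l : Line} {v : ℕ} {f : Nid → BM β} (hs : l.sort = some (.bitvec v))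
    (hl : l.Plain) (hop : l.operands ⊆ Γ) (hv : 0 < v ∧ v ≤ w)
    (cont : ∀ x, Typed w ((x, .bitvec v) :: Γ) P (f x) k T R Q) :
    Typed w Γ P (emit l >>= f) (1 + k) T R Q :=
  Typed.bind (T₁ := fun x => [(x, .bitvec v)]) (R₁ := fun _ => P) (Q₁ := fun _ => True)
    (fun B hB hΓ => ⟨B.length, [l], rfl, le_rfl, hB.plain
      ⟨fun s hs' => ⟨v, Option.some.inj (hs'.symm.trans hs), hv⟩,
        fun x s hx => ⟨(hΓ _ (hop hx)).lt, hΓ _ (hop hx)⟩, by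
          cases l <;> trivial⟩ hl,
      fun p hp => by
        rw [List.mem_singleton.mp hp]
        exact has_concat hs, trivial⟩) fun x _ => cont x

theorem Typed.bad_bind {c : Nid} {f : Nid → BM β} (hc : (c, .bitvec 1) ∈ Γ)
    (cont : ∀ x, Typed w Γ P (f x) k T R Q) : Typed w Γ P (emit (.bad c) >>= f) (1 + k) T R Q :=
  Typed.bind (T₁ := fun _ => []) (R₁ := fun _ => P) (Q₁ := fun _ => True)
    (fun B hB hΓ => ⟨B.length, [.bad c], rfl, le_rfl, hB.plain
      ⟨fun s hs' => (Option.some_ne_none s hs'.symm).elim, fun x s hx => by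
        rw [Line.operands, List.mem_singleton] at hx
        cases hx
        exact ⟨(hΓ _ hc).lt, hΓ _ hc⟩, trivial⟩ trivial,
      fun _ hp => absurd hp List.not_mem_nil, trivial⟩) fun x _ => cont x

/-- A new state variable with an initial value still lacks its `next` line. -/
theorem Typed.state_init_bind {v : ℕ} {c : Nid} {f : Nid → BM β} (hc : (c, .bitvec v) ∈ Γ)
    (hv : 0 < v ∧ v ≤ w)
    (cont : ∀ x, Typed w ((x, .bitvec v) :: Γ) ((x, .bitvec v) ::ₘ P) (f x) k T R Q) :
    Typed w Γ P (emit (.state (.bitvec v)) >>= fun x => emit (.init (.bitvec v) x c) >>=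
      fun _ => f x) (2 + k) T R Q :=
  Typed.bind (p := emit (.state (.bitvec v)) >>= fun x => emit (.init (.bitvec v) x c) >>= fun _ =>
      Pure.pure x) (T₁ := fun x => [(x, .bitvec v)]) (R₁ := fun x => (x, .bitvec v) ::ₘ P)
    (Q₁ := fun _ => True)
    (fun B hB hΓ => by
      have e : B ++ [.state (.bitvec v), .init (.bitvec v) B.length c] =
        B ++ [.state (.bitvec v)] ++ [.init (.bitvec v) B.length c] := List.append_cons _ _ _
      refine ⟨B.length, [.state (.bitvec v), .init (.bitvec v) B.length c], ?_, le_rfl, ?_,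
        fun p hp => ?_, trivial⟩
      · rw [e]
        rfl
      · rw [e]
        exact hB.state_init hv.1 hv.2 (hΓ _ hc)
      · rw [List.mem_singleton.mp hp, e]
        exact (has_concat rfl).append _) fun x _ => cont x

theorem Typed.next_bind {s : Srt} {st c : Nid} {f : Nid → BM β} (hc : (c, s) ∈ Γ)
    (cont : ∀ x, Typed w Γ P (f x) k T R Q) :
    Typed w Γ ((st, s) ::ₘ P) (emit (.next s st c) >>= f) (1 + k) T R Q :=
  Typed.bind (T₁ := fun _ => []) (R₁ := fun _ => P) (Q₁ := fun _ => True)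
    (fun B hB hΓ => ⟨B.length, [.next s st c], rfl, le_rfl, hB.next_line (hΓ _ hc),
      fun _ hp => absurd hp List.not_mem_nil, trivial⟩) fun x _ => cont x

theorem Typed.emit_last {l : Line} {v : ℕ} {T : Nid → Facts} {R : Nid → Multiset (Nid × Srt)}
    {Q : Nid → Prop} (hs : l.sort = some (.bitvec v)) (hl : l.Plain) (hop : l.operands ⊆ Γ)
    (hv : 0 < v ∧ v ≤ w) (last : ∀ x, T x ⊆ (x, .bitvec v) :: Γ ∧ R x = P ∧ Q x) :
    Typed w Γ P (emit l) (1 + 0) T R Q := by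
  rw [← bind_pure (emit l)]
  exact Typed.emit_bind hs hl hop hv fun x => Typed.pure (last x).1 (last x).2.1 (last x).2.2

end

section

variable {ι α : Type} {w c : ℕ} {Γ : Facts} {P : Multiset (Nid × Srt)}

/-- The `i`-th pass leaves the state variables in `D i a` without `next` lines, where `a` is its
result. -/
theorem Typed.mapM {g : ι → BM α} {T : α → Facts} {D : ι → α → Multiset (Nid × Srt)} {L : List ι}
    (h : ∀ i ∈ L, ∀ P, Typed w Γ P (g i) c T (fun a => D i a + P) (fun _ => True)) :
    Typed w Γ P (L.mapM g) (L.length * c) (fun as => as.flatMap T)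
      (fun as => ((L.zip as).map fun p => D p.1 p.2).sum + P) (fun as => as.length = L.length) := by
  induction L generalizing P with
  | nil =>
    rw [List.mapM_nil]
    exact Typed.le (Typed.pure (by simp) (by simp) rfl) (Nat.zero_le _)
  | cons i L ih =>
    rw [List.mapM_cons]
    refine ((h i (by simp) P).bind fun a _ => Typed.bind ((ih fun j hj P =>
      h j (by simp [hj]) P).mono (List.subset_append_right _ _)) fun as has =>
        Typed.pure (b := a :: as) (T := fun as => as.flatMap T)
        (R := fun as => (((i :: L).zip as).map fun p => D p.1 p.2).sum + P)
        (Q := fun as => as.length = L.length + 1)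
        ?_ ?_ ?_).le (by rw [List.length_cons, Nat.succ_mul L.length]; omega)
    · intro p hp
      simp only [List.flatMap_cons, List.mem_append] at hp ⊢
      tauto
    · simp only [List.zip_cons_cons, List.map_cons, List.sum_cons]
      abel
    · simp [has]

theorem Typed.mapM_bind {β : Type} {k : ℕ} {g : ι → BM Nid} {s : Srt} {L : List ι}
    {f : List Nid → BM β} {T : β → Facts} {R : β → Multiset (Nid × Srt)} {Q : β → Prop}
    (step : ∀ i ∈ L, ∀ P, Typed w Γ P (g i) c (fun a => [(a, s)]) (fun _ => P) (fun _ => True))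
    (cont : ∀ as : List Nid, as.length = L.length →
      Typed w (as.map (fun a => (a, s)) ++ Γ) P (f as) k T R Q) :
    Typed w Γ P (L.mapM g >>= f) (L.length * c + k) T R Q := by
  refine Typed.bind (Typed.mapM (D := fun _ _ => 0) fun i hi P =>
    (step i hi P).weaken le_rfl (fun _ => id) (fun _ _ => List.subset_append_left _ _)
      (fun _ _ => (zero_add P).symm) fun _ => id) fun as has => ?_
  have h := cont as has
  rw [← List.flatMap_singleton' as, List.map_flatMap] at h
  simpa using h

theorem Typed.foldlM {g : Nid → ι → BM Nid} {s : Srt} {a : Nid} {L : List ι} (ha : (a, s) ∈ Γ)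
    (h : ∀ i ∈ L, ∀ a, Typed w ((a, s) :: Γ) P (g a i) c (fun a => [(a, s)]) (fun _ => P)
      (fun _ => True)) :
    Typed w Γ P (L.foldlM g a) (L.length * c) (fun a => [(a, s)]) (fun _ => P) (fun _ => True) := by
  induction L generalizing a Γ with
  | nil =>
    rw [List.foldlM_nil]
    exact Typed.le (Typed.pure (by simpa using ha) rfl trivial) (Nat.zero_le _)
  | cons i L ih =>
    rw [List.foldlM_cons]
    refine Typed.le (Typed.bind ((h i (by simp) a).mono (List.cons_subset.mpr ⟨ha, fun _ => id⟩))
      fun b _ => ih (by simp) fun j hj d => (h j (by simp [hj]) d).mono ?_)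
        (by rw [List.length_cons, Nat.succ_mul L.length]; omega)
    intro p hp
    simp only [List.mem_cons, List.mem_append] at hp ⊢
    tauto

theorem Typed.foldlM_bind {β : Type} {k : ℕ} {g : Nid → ι → BM Nid} {s : Srt} {a : Nid}
    {L : List ι} {f : Nid → BM β} {T : β → Facts} {R : β → Multiset (Nid × Srt)} {Q : β → Prop}
    (init : (a, s) ∈ Γ)
    (step : ∀ i ∈ L, ∀ a, Typed w ((a, s) :: Γ) P (g a i) c (fun a => [(a, s)]) (fun _ => P)
      (fun _ => True))
    (cont : ∀ a, Typed w ((a, s) :: Γ) P (f a) k T R Q) :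
    Typed w Γ P (L.foldlM g a >>= f) (L.length * c + k) T R Q :=
  Typed.bind (Typed.foldlM init step) fun a _ => cont a

/-- The `i`-th pass supplies the `next` lines of the state variables in `D i`. -/
theorem Typed.forM {g : ι → BM Unit} {D : ι → Multiset (Nid × Srt)} {c : ι → ℕ} {L : List ι}
    (h : ∀ i ∈ L, ∀ P, Typed w Γ (D i + P) (g i) (c i) (fun _ => []) (fun _ => P) (fun _ => True)) :
    Typed w Γ ((L.map D).sum + P) (L.forM g) (L.map c).sum (fun _ => []) (fun _ => P)
      (fun _ => True) := by
  induction L with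
  | nil =>
    exact Typed.pure (by simp) (by simp) trivial
  | cons i L ih =>
    rw [List.map_cons, List.map_cons, List.sum_cons, List.sum_cons, add_assoc]
    change Typed w Γ _ (g i >>= fun _ => L.forM g) _ _ _ _
    exact (h i (by simp) _).bind fun _ _ => ih fun j hj P => h j (by simp [hj]) P

end

/-! ### System calls -/

/-- The facts about the nids of the header. -/
structure HeaderOK (n : ℕ) (Γ : Facts) (H : Header) : Prop where
  pos : 0 < H.w
  ff : (H.ff, .bitvec 1) ∈ Γ
  tt : (H.tt, .bitvec 1) ∈ Γ
  kernel : (H.kernel, .bitvec 1) ∈ Γ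
  user : (H.user, .bitvec 1) ∈ Γ
  zero : (H.zero, .bitvec H.w) ∈ Γ
  one : (H.one, .bitvec H.w) ∈ Γ
  mask : (H.mask, .bitvec H.w) ∈ Γ
  bytes : (H.bytes, .bitvec H.w) ∈ Γ
  dataStart : (H.dataStart, .bitvec H.w) ∈ Γ
  dataEnd : (H.dataEnd, .bitvec H.w) ∈ Γ
  heapStart : (H.heapStart, .bitvec H.w) ∈ Γ
  heapEnd : (H.heapEnd, .bitvec H.w) ∈ Γ
  allowedHeapEnd : (H.allowedHeapEnd, .bitvec H.w) ∈ Γ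
  allowedStackStart : (H.allowedStackStart, .bitvec H.w) ∈ Γ
  highest : (H.highest, .bitvec H.w) ∈ Γ
  counts : ∀ x ∈ H.counts, (x, .bitvec H.w) ∈ Γ
  counts_length : H.counts.length ≤ 7
  inputs : ∀ x ∈ H.inputs, (x, .bitvec H.w) ∈ Γ
  input : (H.inputs.headD 0, .bitvec H.w) ∈ Γ
  reg : ∀ r, (H.reg r, .bitvec H.w) ∈ Γ
  flag : ∀ i < n, (H.flag i, .bitvec 1) ∈ Γ
  ram : ∀ p ∈ H.ram, (p.1, .bitvec H.w) ∈ Γ ∧ (p.2, .bitvec H.w) ∈ Γ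

/-- The facts about the heads of the cascades. -/
structure FlowOK (w : ℕ) (Γ : Facts) (F : Flow) : Prop where
  reg : ∀ r, (F.reg r, .bitvec w) ∈ Γ
  ram : ∀ x ∈ F.ram, (x, .bitvec w) ∈ Γ
  division : (F.division, .bitvec w) ∈ Γ
  remainder : (F.remainder, .bitvec w) ∈ Γ
  access : (F.access, .bitvec w) ∈ Γ
  ecall : (F.ecall, .bitvec 1) ∈ Γ

/-- The facts of `FlowOK`, as a list. -/
def Flow.facts (w : ℕ) (F : Flow) : Facts :=
  (List.finRange 32).map (fun r => (F.reg r, .bitvec w)) ++ F.ram.map (fun x => (x, .bitvec w)) ++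
    [(F.division, .bitvec w), (F.remainder, .bitvec w), (F.access, .bitvec w), (F.ecall, .bitvec 1)]

theorem Flow.facts_subset_iff {w : ℕ} {Γ : Facts} {F : Flow} :
    F.facts w ⊆ Γ ↔ FlowOK w Γ F := by
  constructor
  · intro h
    constructor <;> intros <;> apply h <;> simp [Flow.facts, *]
  · rintro ⟨h1, h2, h3, h4, h5, h6⟩ p hp
    simp only [Flow.facts, List.mem_append, List.mem_map, List.mem_cons, List.not_mem_nil,
      or_false] at hp
    rcases hp with (⟨r, -, rfl⟩ | ⟨x, hx, rfl⟩) | rfl | rfl | rfl | rfl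
    exacts [h1 r, h2 x hx, h3, h4, h5, h6]

/-- The facts about the nids that the system calls define. -/
def Syscalls.facts (w : ℕ) (S : Syscalls) : Facts :=
  S.ids.map (fun x => (x, .bitvec 1)) ++ [(S.exitActive, .bitvec 1), (S.brk, .bitvec w)]

theorem FlowOK.setReg {w : ℕ} {Γ : Facts} {F : Flow} (h : FlowOK w Γ F) (r : Reg) {x : Nid}
    (hx : (x, .bitvec w) ∈ Γ) : FlowOK w Γ (F.setReg r x) := by
  refine ⟨fun r' => ?_, h.ram, h.division, h.remainder, h.access, h.ecall⟩
  by_cases hr : r' = r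
  · subst hr
    simpa [Flow.setReg] using hx
  · simpa [Flow.setReg, hr] using h.reg r'

section

variable {β : Type} {w k : ℕ} {Γ : Facts} {P : Multiset (Nid × Srt)} {T : β → Facts}
  {R : β → Multiset (Nid × Srt)} {Q : β → Prop}

/-- A cascade that selects one of the values in `L` by comparing `x` with their keys. -/
theorem Typed.cascade_bind {x a : Nid} {L : List (Nid × Nid)} {f : Nid → BM β} (hw : 0 < w)
    (hx : (x, .bitvec w) ∈ Γ) (ha : (a, .bitvec w) ∈ Γ)
    (hL : ∀ p ∈ L, (p.1, .bitvec w) ∈ Γ ∧ (p.2, .bitvec w) ∈ Γ)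
    (cont : ∀ y, Typed w ((y, .bitvec w) :: Γ) P (f y) k T R Q) :
    Typed w Γ P (L.foldlM (fun v p => do
        let e ← emit (.compare .eq w x p.1)
        emit (.ite (.bitvec w) e p.2 v)) a >>= f) (L.length * 2 + k) T R Q := by
  refine Typed.foldlM_bind ha (fun p hp v => ?_) cont
  obtain ⟨h1, h2⟩ := hL p hp
  refine Typed.emit_bind rfl (by trivial) (by simp [Line.operands, hx, h1]) ⟨Nat.one_pos, hw⟩
    fun e => Typed.emit_last rfl (by trivial) (by simp [Line.operands, h2]) ⟨hw, le_rfl⟩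
    fun y => ⟨?_, rfl, trivial⟩
  simp

/-- An update of the memory words with the address `a` under a condition `c`. -/
theorem Typed.store_bind {a c v : Nid} {L : List ((Nid × Nid) × Nid)} {f : List Nid → BM β}
    (hw : 0 < w) (ha : (a, .bitvec w) ∈ Γ) (hc : (c, .bitvec 1) ∈ Γ) (hv : (v, .bitvec w) ∈ Γ)
    (hL : ∀ p ∈ L, (p.1.1, .bitvec w) ∈ Γ ∧ (p.2, .bitvec w) ∈ Γ)
    (cont : ∀ as : List Nid, as.length = L.length →
      Typed w (as.map (fun a => (a, .bitvec w)) ++ Γ) P (f as) k T R Q) :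
    Typed w Γ P (L.mapM (fun p => do
        let e ← emit (.compare .eq w a p.1.1)
        let u ← emit (.ite (.bitvec w) e v p.2)
        emit (.ite (.bitvec w) c u p.2)) >>= f) (L.length * 3 + k) T R Q := by
  refine Typed.mapM_bind (fun p hp P => ?_) cont
  obtain ⟨h1, h2⟩ := hL p hp
  refine Typed.emit_bind rfl (by trivial) (by simp [Line.operands, ha, h1]) ⟨Nat.one_pos, hw⟩
    fun e => Typed.emit_bind rfl (by trivial) (by simp [Line.operands, h2, hv]) ⟨hw, le_rfl⟩ fun u =>
    Typed.emit_last rfl (by trivial) (by simp [Line.operands, h2, hc]) ⟨hw, le_rfl⟩ fun y =>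
      ⟨?_, rfl, trivial⟩
  simp

end

set_option maxHeartbeats 400000 in
/-- The system calls supply the `next` line of the kernel-mode flag; the state variables that they
introduce are completed within. -/
theorem emitSyscalls_typed {n : ℕ} {Γ : Facts} {P : Multiset (Nid × Srt)} {H : Header} {F : Flow}
    (hH : HeaderOK n Γ H) (hF : FlowOK H.w Γ F) :
    Typed H.w Γ ((H.kernel, .bitvec 1) ::ₘ P) (emitSyscalls H F) (100 + 3 * H.ram.length)
      (fun a => a.1.facts H.w ++ a.2.facts H.w) (fun _ => P)
      (fun a => a.1.ram.length = min H.ram.length F.ram.length ∧ a.2.ids.length = 5) := by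
  have hcounts := hH.counts_length
  have hinputs : ∀ p ∈ H.counts.zip H.inputs.tail,
      (p.1, .bitvec H.w) ∈ Γ ∧ (p.2, .bitvec H.w) ∈ Γ := fun p hp =>
    ⟨hH.counts _ (List.of_mem_zip hp).1,
      hH.inputs _ (List.mem_of_mem_tail (List.of_mem_zip hp).2)⟩
  have hram : ∀ p ∈ H.ram.zip F.ram, (p.1.1, .bitvec H.w) ∈ Γ ∧ (p.2, .bitvec H.w) ∈ Γ :=
    fun p hp => ⟨(hH.ram _ (List.of_mem_zip hp).1).1, hF.ram _ (List.of_mem_zip hp).2⟩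
  unfold emitSyscalls
  dsimp only
  apply Typed.le
  · repeat first
    | with_reducible apply Typed.emit_bind
      case hs => exact rfl
      case hl => trivial
      case' cont => intro _
    | with_reducible apply Typed.state_init_bind
      case' cont => intro _
    | with_reducible apply Typed.next_bind
      case' cont => intro _
    | with_reducible apply Typed.cascade_bind
      case' hL => intro p hp; have := hinputs p hp
      case' cont => intro _
    | with_reducible apply Typed.store_bind
      case' hL => intro p hp; have := hram p hp
      case' cont => intro _ _
    | refine Typed.pure (List.append_subset.mpr ⟨Flow.facts_subset_iff.mpr
        (FlowOK.setReg ⟨fun _ => ?_, fun _ hx => ?_, ?_, ?_, ?_, ?_⟩ _ ?_), ?_⟩) rfl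
        ⟨List.length_zip ▸ ‹_›, rfl⟩
    any_goals first
      | exact hH.pos
      | exact ⟨hH.pos, le_rfl⟩
      | exact ⟨Nat.one_pos, hH.pos⟩
      | simp only [Line.operands, List.cons_subset, List.nil_subset, List.mem_cons, List.mem_append,
          eq_self, true_or, or_true, and_true, Syscalls.facts, List.map_cons, List.map_nil,
          List.cons_append, List.nil_append, hH.tt, hH.kernel,
          hH.zero, hH.one, hH.bytes, hH.mask, hH.heapEnd, hH.input, hH.reg, hF.access, hF.reg,
          hF.division, hF.remainder, hF.ecall, *]; done
      | have h := List.mem_map_of_mem (f := fun a => (a, Srt.bitvec H.w)) hx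
        dsimp only at h
        simp only [List.mem_cons, List.mem_append, h, true_or, or_true]
  · simp only [List.length_zip, ← Nat.add_assoc, Nat.reduceAdd]
    omega

/-! ### Data flow and control flow -/

/-- The facts about the nids that the data flow of an instruction supplies for control flow. -/
def Instr.facts (w : ℕ) (x : Nid × Nid) : Instr → Facts
  | .beq _ _ _ => [(x.1, .bitvec 1), (x.2, .bitvec 1)]
  | .jal rd _ => if rd = regZero then [] else [(x.1, .bitvec w)]
  | _ => []

theorem HeaderOK.mono {n : ℕ} {Γ Γ' : Facts} {H : Header} (h : HeaderOK n Γ H) (hΓ : Γ ⊆ Γ') :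
    HeaderOK n Γ' H :=
  { pos := h.pos, ff := hΓ h.ff, tt := hΓ h.tt, kernel := hΓ h.kernel, user := hΓ h.user
    zero := hΓ h.zero, one := hΓ h.one, mask := hΓ h.mask, bytes := hΓ h.bytes
    dataStart := hΓ h.dataStart, dataEnd := hΓ h.dataEnd, heapStart := hΓ h.heapStart
    heapEnd := hΓ h.heapEnd, allowedHeapEnd := hΓ h.allowedHeapEnd
    allowedStackStart := hΓ h.allowedStackStart, highest := hΓ h.highest
    counts := fun x hx => hΓ (h.counts x hx), counts_length := h.counts_length
    inputs := fun x hx => hΓ (h.inputs x hx), input := hΓ h.input, reg := fun r => hΓ (h.reg r)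
    flag := fun i hi => hΓ (h.flag i hi)
    ram := fun p hp => ⟨hΓ (h.ram p hp).1, hΓ (h.ram p hp).2⟩ }

set_option maxHeartbeats 400000 in
theorem emitDataFlow_typed {n : ℕ} {Γ : Facts} {P : Multiset (Nid × Srt)} {H : Header} {F : Flow}
    (hH : HeaderOK n Γ H) (hF : FlowOK H.w Γ F) (hl : F.ram.length = H.ram.length) (pc : ℕ)
    {flag : Nid} (hflag : (flag, .bitvec 1) ∈ Γ) (a : Instr) :
    Typed H.w Γ P (emitDataFlow H pc flag F a) (4 + 3 * H.ram.length)
      (fun r => r.1.facts H.w ++ a.facts H.w r.2) (fun _ => P)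
      (fun r => r.1.ram.length = H.ram.length) := by
  have hzip : ∀ p ∈ H.ram.zip F.ram, (p.1.1, .bitvec H.w) ∈ Γ ∧ (p.2, .bitvec H.w) ∈ Γ :=
    fun p hp => ⟨(hH.ram _ (List.of_mem_zip hp).1).1, hF.ram _ (List.of_mem_zip hp).2⟩
  have hzl : (H.ram.zip F.ram).length = H.ram.length := by
    rw [List.length_zip, hl, min_self]
  have hwd : 0 < H.w ∧ H.w ≤ H.w := ⟨hH.pos, le_rfl⟩
  have hskip (a : Instr) (ha : a.facts H.w (0, 0) = []) :
      Typed H.w Γ P (pure (F, 0, 0)) (4 + 3 * H.ram.length)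
        (fun r => r.1.facts H.w ++ a.facts H.w r.2) (fun _ => P)
        (fun r => r.1.ram.length = H.ram.length) :=
    Typed.le (Typed.pure (by
      rw [ha, List.append_nil]
      exact Flow.facts_subset_iff.mpr hF) rfl hl) (Nat.zero_le _)
  cases a with
  | jalr rd rs1 imm => exact hskip _ rfl
  | _ =>
    simp only [emitDataFlow]
    try cases ‹ArithOp›
    all_goals
      try
        split
        next h => exact hskip _ (by first | rfl | exact if_pos h)
      try simp only [pure_bind, bind_assoc]
      apply Typed.le
      · repeat first
        | with_reducible apply Typed.emit_bind
          case hs => first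
            | exact congrArg (fun v => some (Srt.bitvec v)) (Nat.add_sub_cancel' hH.pos)
            | exact rfl
          case hl => trivial
          case' cont => intro _
        | with_reducible apply Typed.cascade_bind
          case' hL => intro p hp; have := hH.ram p hp
          case' cont => intro _
        | with_reducible apply Typed.store_bind
          case' hL => intro p hp; have := hzip p hp
          case' cont => intro _ _
        | refine Typed.pure (List.append_subset.mpr ⟨Flow.facts_subset_iff.mpr
            (FlowOK.setReg ⟨fun _ => ?_, fun x hx => ?_, ?_, ?_, ?_, ?_⟩ _ ?_), ?_⟩) rfl ?_
        | refine Typed.pure (List.append_subset.mpr ⟨Flow.facts_subset_iff.mpr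
            ⟨fun _ => ?_, fun x hx => ?_, ?_, ?_, ?_, ?_⟩, ?_⟩) rfl ?_
        all_goals first
          | exact hH.pos
          | exact ⟨hH.pos, le_rfl⟩
          | exact ⟨Nat.one_pos, hH.pos⟩
          | exact hl
          | exact hzl ▸ ‹_›
          | simp only [Line.operands, List.cons_subset, List.nil_subset, List.mem_cons,
              List.mem_append, eq_self, true_or, or_true, and_true, Instr.facts, reduceIte,
              hH.tt, hH.zero, hH.reg, hF.access, hF.reg, hF.division, hF.remainder, hF.ecall, *]
            done
          | have h := hF.ram x hx
            simp only [List.mem_cons, h, or_true]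
          | have h := List.mem_map_of_mem (f := fun a => (a, Srt.bitvec H.w)) hx
            dsimp only at h
            simp only [List.mem_cons, List.mem_append, h, true_or]
      · first
        | rw [hzl]; omega
        | omega

theorem emitAllDataFlow_typed {n : ℕ} {Γ : Facts} {P : Multiset (Nid × Srt)} {H : Header}
    {F : Flow} (R : Binary) {i : ℕ} {as : List Instr} (hi : i + as.length ≤ n)
    (hH : HeaderOK n Γ H) (hF : FlowOK H.w Γ F) (hl : F.ram.length = H.ram.length) :
    Typed H.w Γ P (emitAllDataFlow R H i as F) (as.length * (4 + 3 * H.ram.length))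
      (fun r => r.1.facts H.w ++ (as.zip r.2).flatMap fun p => p.1.facts H.w p.2) (fun _ => P)
      (fun r => r.1.ram.length = H.ram.length) := by
  induction as generalizing i Γ F with
  | nil =>
    refine Typed.le (Typed.pure ?_ rfl hl) (Nat.zero_le _)
    simpa using Flow.facts_subset_iff.mpr hF
  | cons a as ih =>
    rw [List.length_cons] at hi
    refine Typed.le (Typed.bind (emitDataFlow_typed hH hF hl _ (hH.flag i (by omega)) a)
      fun r hr => ?_) (k := (4 + 3 * H.ram.length) + (as.length * (4 + 3 * H.ram.length) + 0))
      (by rw [List.length_cons, Nat.succ_mul as.length]; omega)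
    refine Typed.bind (ih (by omega) (hH.mono (List.subset_append_right _ _))
      (Flow.facts_subset_iff.mp ?_) hr) fun r' hr' => Typed.pure ?_ rfl hr'
    · intro p hp
      simp [hp]
    · intro p hp
      simp only [List.zip_cons_cons, List.flatMap_cons, List.mem_append] at hp ⊢
      tauto

/-- The nids of an edge are well-typed, and the indices of instructions are less than `n`. -/
def Edge.OK (n w : ℕ) (Γ : Facts) : Edge → Prop
  | .plain i => i < n
  | .branch i c => i < n ∧ (c, .bitvec 1) ∈ Γ
  | .ret _ link => (link, .bitvec w) ∈ Γ
  | .ecall i => i < n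

/-- The edges are well-typed, and the indices of instructions are less than `n`. -/
structure Control.OK (n w : ℕ) (Γ : Facts) (K : Control) : Prop where
  edges : ∀ e ∈ K.edges, e.2.OK n w Γ
  returns : ∀ e ∈ K.returns, e.2 < n

theorem Control.OK.add {n w : ℕ} {Γ : Facts} {K : Control} (hK : K.OK n w Γ) {i : ℕ} (hi : i < n)
    (pc : ℤ) {x : Nid × Nid} {a : Instr} (hx : a.facts w x ⊆ Γ) :
    (K.add i pc x a).OK n w Γ ∧ (K.add i pc x a).edges.length ≤ K.edges.length + 2 := by
  obtain ⟨h1, h2⟩ := hK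
  cases a <;> simp only [Control.add, Instr.facts] at hx ⊢ <;> (try split) <;>
    refine ⟨⟨fun e he => ?_, fun e he => ?_⟩, ?_⟩ <;>
    simp_all [Edge.OK] <;> grind [Edge.OK]

theorem Control.OK.addAll {n w : ℕ} {Γ : Facts} {K : Control} (hK : K.OK n w Γ) (R : Binary) {i : ℕ}
    {as : List (Instr × Nid × Nid)} (hi : i + as.length ≤ n)
    (hx : (as.flatMap fun p => p.1.facts w p.2) ⊆ Γ) :
    (Control.addAll R i as K).OK n w Γ ∧
      (Control.addAll R i as K).edges.length ≤ K.edges.length + 2 * as.length := by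
  induction as generalizing i K with
  | nil => exact ⟨hK, le_rfl⟩
  | cons a as ih =>
    rw [List.flatMap_cons, List.append_subset] at hx
    rw [List.length_cons] at hi ⊢
    have h1 := hK.add (i := i) (by omega) ((R.codeStart : ℤ) + 4 * i) hx.1
    have h2 := ih h1.1 (i := i + 1) (by omega) hx.2
    exact ⟨h2.1, h2.2.trans (by omega)⟩

/-- The state variable of an `ecall` edge gets its `next` line within the edge. -/
theorem emitEdge_typed {n : ℕ} {Γ : Facts} {P : Multiset (Nid × Srt)} {H : Header}
    (hH : HeaderOK n Γ H) {returns : List (ℤ × ℕ)} (hr : ∀ e ∈ returns, e.2 < n) {e : Edge}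
    (he : e.OK n H.w Γ) :
    Typed H.w Γ P (emitEdge H returns e) 5 (fun o => o.toList.map (fun x => (x, .bitvec 1)))
      (fun _ => P) (fun _ => True) := by
  have hret {i : ℕ} {c : ℤ} (h : returns.lookup c = some i) : i < n := by
    obtain ⟨l₁, l₂, rfl, -⟩ := List.lookup_eq_some_iff.mp h
    exact hr (c, i) (by simp)
  cases e with
  | plain i =>
    exact Typed.le (Typed.pure (by simpa using hH.flag i he) rfl trivial) (Nat.zero_le _)
  | _ =>
    simp only [emitEdge]
    simp only [Edge.OK] at he
    try split
    all_goals
      try have := hret ‹_›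
      apply Typed.le
      · repeat first
        | with_reducible apply Typed.emit_bind
          case hs => exact rfl
          case hl => trivial
          case' cont => intro _
        | with_reducible apply Typed.state_init_bind
          case' cont => intro _
        | with_reducible apply Typed.next_bind
          case' cont => intro _
        | refine Typed.pure ?_ rfl trivial
        all_goals first
          | exact hH.pos
          | exact ⟨hH.pos, le_rfl⟩
          | exact ⟨Nat.one_pos, hH.pos⟩
          | simp only [Line.operands, List.cons_subset, List.nil_subset, List.mem_cons,
              eq_self, true_or, or_true, and_true, Option.toList, List.map_cons, List.map_nil,
              hH.ff, hH.one, hH.reg, hH.kernel, hH.user, hH.flag, *]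
      · omega

/-- An edge of control flow costs at most five lines, and one more for the disjunction with the other
edges. -/
theorem emitControlFlow_typed {n : ℕ} {Γ : Facts} {P : Multiset (Nid × Srt)} {H : Header}
    (R : Binary) (hH : HeaderOK n Γ H) {K : Control} (hK : K.OK n H.w Γ) {i : ℕ} :
    Typed H.w Γ ((H.flag i, .bitvec 1) ::ₘ P) (emitControlFlow R H K i)
      (K.edges.countP (fun e => decide (e.1 = (R.codeStart : ℤ) + 4 * i)) * 6 + 1) (fun _ => [])
      (fun _ => P) (fun _ => True) := by
  unfold emitControlFlow
  dsimp only
  rw [List.countP_eq_length_filter, ← List.length_map (f := Prod.snd)]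
  refine Typed.foldlM_bind (s := .bitvec 1) hH.ff (fun e he flow => ?_) fun flow => ?_
  swap
  · refine Typed.next_bind (k := 0) List.mem_cons_self fun _ => ?_
    exact Typed.pure (List.nil_subset _) rfl trivial
  obtain ⟨e, he', rfl⟩ := List.mem_map.mp he
  refine Typed.bind (k₁ := 5) (k₂ := 1) ((emitEdge_typed hH hK.returns
    (hK.edges e (List.mem_of_mem_filter he'))).mono (List.subset_cons_self _ _)) fun o _ => ?_
  cases o with
  | none => exact Typed.le (Typed.pure (by simp) rfl trivial) (Nat.zero_le _)
  | some x =>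
    dsimp only
    split
    · exact Typed.le (Typed.pure (by simp) rfl trivial) (Nat.zero_le _)
    · refine Typed.emit_last rfl trivial ?_ ⟨Nat.one_pos, hH.pos⟩ fun _ => ⟨by simp, rfl, trivial⟩
      simp [Line.operands, hH.tt]

/-! ### Error states -/

theorem emitChecks_typed {n : ℕ} {Γ : Facts} {P : Multiset (Nid × Srt)} {H : Header} {F : Flow}
    {S : Syscalls} (hH : HeaderOK n Γ H) (hF : FlowOK H.w Γ F) (hS : S.facts H.w ⊆ Γ)
    (hl : S.ids.length = 5) :
    Typed H.w Γ P (emitChecks H F S) 30 (fun _ => []) (fun _ => P) (fun _ => True) := by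
  have hids : ∀ x ∈ S.ids, (x, .bitvec 1) ∈ Γ := fun x hx => hS (by simp [Syscalls.facts, hx])
  have hexit : (S.exitActive, .bitvec 1) ∈ Γ := hS (by simp [Syscalls.facts])
  unfold emitChecks
  refine Typed.le (Typed.mapM_bind (c := 1) (s := .bitvec 1) (fun x hx P => ?_) fun no hno => ?_)
    (k := S.ids.length * 1 + (4 * 1 + 13)) (by omega)
  · exact Typed.emit_last rfl trivial (by simp [Line.operands, hids x hx]) ⟨Nat.one_pos, hH.pos⟩
      fun _ => ⟨by simp, rfl, trivial⟩
  · have hno' : ∀ x ∈ no, (x, Srt.bitvec 1) ∈ no.map (fun x => (x, Srt.bitvec 1)) ++ Γ :=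
      fun x hx => List.mem_append_left _ (List.mem_map_of_mem hx)
    have htail : no.tail.length = 4 := by rw [List.length_tail, hno, hl]
    rw [← htail]
    refine Typed.foldlM_bind (s := .bitvec 1) ?_ (fun x hx v => ?_) fun v => ?_
    · cases no with
      | nil => simp [hl] at hno
      | cons x no => exact hno' _ List.mem_cons_self
    · refine Typed.emit_last rfl (by trivial) ?_ ⟨Nat.one_pos, hH.pos⟩
        fun _ => ⟨by simp, rfl, trivial⟩
      rw [Line.operands, List.cons_subset, List.cons_subset]
      exact ⟨List.mem_cons_self, List.mem_cons_of_mem _ (hno' x (List.mem_of_mem_tail hx)),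
        List.nil_subset _⟩
    apply Typed.le
    · repeat first
      | with_reducible apply Typed.bad_bind
        case' cont => intro _
      | with_reducible apply Typed.emit_bind
        case hs => exact rfl
        case hl => trivial
        case' cont => intro _
      | refine Typed.pure ?_ rfl trivial
      all_goals first
        | exact hH.pos
        | exact ⟨hH.pos, le_rfl⟩
        | exact ⟨Nat.one_pos, hH.pos⟩
        | simp only [Line.operands, List.cons_subset, List.nil_subset, List.mem_cons,
            List.mem_append, eq_self, true_or, or_true, and_true, hH.reg, hH.zero, hH.mask,
            hF.access, hF.division, hF.remainder, hF.ecall, hexit]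
    · omega

theorem emitSegfaults_typed {n : ℕ} {Γ : Facts} {P : Multiset (Nid × Srt)} {H : Header} {F : Flow}
    {S : Syscalls} (hH : HeaderOK n Γ H) (hF : FlowOK H.w Γ F) (hS : S.facts H.w ⊆ Γ) :
    Typed H.w Γ P (emitSegfaults H F S) 30 (fun _ => []) (fun _ => P) (fun _ => True) := by
  have hbrk : (S.brk, .bitvec H.w) ∈ Γ := hS (by simp [Syscalls.facts])
  unfold emitSegfaults
  dsimp only
  apply Typed.le
  · repeat first
    | with_reducible apply Typed.bad_bind
      case' cont => intro _
    | with_reducible apply Typed.emit_bind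
      case hs => exact rfl
      case hl => trivial
      case' cont => intro _
    | refine Typed.pure ?_ rfl trivial
    all_goals first
      | exact ⟨Nat.one_pos, hH.pos⟩
      | simp only [Line.operands, List.cons_subset, List.nil_subset, List.mem_cons,
          eq_self, true_or, or_true, and_true, hH.reg, hF.access, hH.dataStart, hH.dataEnd,
          hH.heapStart, hH.allowedHeapEnd, hH.allowedStackStart, hH.highest, hbrk]
  · omega

/-! ### The header -/

/-- The facts of `HeaderOK` that do not depend on the numbers of nids, as a list. -/
def Header.facts (H : Header) : Facts :=
  [(H.ff, .bitvec 1), (H.tt, .bitvec 1), (H.kernel, .bitvec 1), (H.user, .bitvec 1)] ++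
  ([H.zero, H.one, H.mask, H.bytes, H.dataStart, H.dataEnd, H.heapStart, H.heapEnd,
    H.allowedHeapEnd, H.allowedStackStart, H.highest] ++ H.counts ++ H.inputs ++ H.regs).map
      (fun x => (x, .bitvec H.w)) ++
  H.flags.map (fun x => (x, .bitvec 1)) ++
  H.ram.flatMap fun p => [(p.1, .bitvec H.w), (p.2, .bitvec H.w)]

/-- The numbers of nids in the header of the model for `R`, with `m` words of memory. -/
structure Header.Shape (R : Binary) (m : ℕ) (H : Header) : Prop where
  w : H.w = R.machine.bits
  counts : H.counts.length ≤ 7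
  inputs : H.inputs ≠ []
  regs : H.regs.length = 32
  flags : H.flags.length = R.code.length
  ram : H.ram.length = m

theorem Machine.bits_pos (M : Machine) : 0 < M.bits := by cases M <;> decide

theorem Header.Shape.headerOK {R : Binary} {m : ℕ} {H : Header} {Γ : Facts} (h : H.Shape R m)
    (hΓ : H.facts ⊆ Γ) : HeaderOK R.code.length Γ H := by
  obtain ⟨hw, hc, hi, hr, hf, -⟩ := h
  constructor
  case pos => exact hw ▸ R.machine.bits_pos
  case counts_length => exact hc
  case counts => exact fun x hx => hΓ (by simp [Header.facts, hx])
  case inputs => exact fun x hx => hΓ (by simp [Header.facts, hx])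
  case input =>
    have : H.inputs.headD 0 ∈ H.inputs := by
      rw [List.headD_eq_head?_getD, List.head?_eq_some_head hi]
      exact List.head_mem hi
    exact hΓ (by simp only [Header.facts, List.mem_append, List.mem_map, Prod.mk.injEq, and_true,
      exists_eq_right, this, or_true, true_or])
  case reg =>
    intro r
    have : H.reg r ∈ H.regs := by
      have hr' : (r : ℕ) < H.regs.length := by omega
      rw [Header.reg, List.getD_eq_getElem _ _ hr']
      exact List.getElem_mem _
    exact hΓ (by simp [Header.facts, this])
  case flag =>
    intro i hi
    have : H.flag i ∈ H.flags := by
      have hi' : i < H.flags.length := hf ▸ hi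
      rw [Header.flag, List.getD_eq_getElem _ _ hi']
      exact List.getElem_mem _
    exact hΓ (by simp [Header.facts, this])
  case ram =>
    intro p hp
    constructor <;> refine hΓ (List.mem_append_right _ (List.mem_flatMap.mpr ⟨p, hp, by simp⟩))
  all_goals exact hΓ (by simp [Header.facts])

/-- The state variables for which the header leaves `next` lines to be supplied. -/
def Header.pending (n : ℕ) (H : Header) : Multiset (Nid × Srt) :=
  (H.kernel, .bitvec 1) ::ₘ
    (((List.range n).map fun i => ({(H.flag i, .bitvec 1)} : Multiset (Nid × Srt))).sum +
    (((List.finRange 32).map fun r =>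
      if r = regZero then (0 : Multiset (Nid × Srt)) else {(H.reg r, .bitvec H.w)}).sum +
    (H.ram.map fun p => ({(p.2, .bitvec H.w)} : Multiset (Nid × Srt))).sum))

/-- Sums over the state variables of a list of items, and sums over the items. -/
theorem zip_map_eq_map_getD {ι M : Type} {L : List ι} {as : List Nid} (h : as.length = L.length)
    {f : ι → ℕ} (hf : ∀ (j : ℕ) (hj : j < L.length), f L[j] = j) (D : ι → Nid → M) :
    (L.zip as).map (fun p => D p.1 p.2) = L.map fun i => D i (as.getD (f i) 0) := by
  refine List.ext_getElem (by simp [h]) fun j h1 h2 => ?_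
  rw [List.length_map] at h2
  simp [hf j h2, h, h2]

theorem emitHeader_typed (R : Binary) (h s : ℕ) :
    Typed R.machine.bits [] 0 (emitHeader R h s)
      (132 + 2 * R.code.length + 4 * (R.addresses h s).length) Header.facts
      (Header.pending R.code.length) (Header.Shape R (R.addresses h s).length) := by
  have hb : 4 ≤ R.machine.bytes ∧ R.machine.bytes ≤ 8 := by
    cases R.machine <;> decide
  have hbits : R.machine.bits = 8 * R.machine.bytes := rfl
  unfold emitHeader
  dsimp only
  generalize hw : R.machine.bits = w at *
  have hw1 : 0 < w ∧ w ≤ w := by omega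
  have h11 : 0 < 1 ∧ 1 ≤ w := by omega
  have reg_step (Γ : Facts) (r : Reg) (P : Multiset (Nid × Srt)) :
      Typed w Γ P (if r = regZero then emit (.constd w 0) else do
        let v ← emit (.constd w (R.register r))
        let x ← emit (.state (.bitvec w))
        let _ ← emit (.init (.bitvec w) x v)
        return x) 3 (fun x => [(x, .bitvec w)])
        (fun x => (if r = regZero then (0 : Multiset (Nid × Srt)) else {(x, .bitvec w)}) + P)
        (fun _ => True) := by
    split
    · exact (Typed.emit_last rfl (by trivial) (List.nil_subset _) hw1
        fun _ => ⟨by simp, zero_add P, trivial⟩).le (by omega)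
    · refine Typed.emit_bind rfl (by trivial) (List.nil_subset _) hw1 fun v => Typed.state_init_bind
        (k := 0) (by simp) hw1 fun x => Typed.pure (by simp) (Multiset.singleton_add _ _) trivial
  have flag_step (tt ff : Nid) (Γ : Facts) (ht : (tt, .bitvec 1) ∈ Γ) (hf : (ff, .bitvec 1) ∈ Γ)
      (i : ℕ) (P : Multiset (Nid × Srt)) : Typed w Γ P (do
        let x ← emit (.state (.bitvec 1))
        let _ ← emit (.init (.bitvec 1) x (if R.codeStart + 4 * i = R.entry then tt else ff))
        return x) 2 (fun x => [(x, .bitvec 1)]) (fun x => {(x, .bitvec 1)} + P)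
        (fun _ => True) := by
    refine Typed.state_init_bind (k := 0) (by split <;> assumption) h11 fun x =>
      Typed.pure (by simp) (Multiset.singleton_add _ _) trivial
  have ram_step (Γ : Facts) (a : ℕ) (P : Multiset (Nid × Srt)) : Typed w Γ P (do
        let v ← emit (.constd w a)
        let c ← emit (.constd w (R.memory a))
        let x ← emit (.state (.bitvec w))
        let _ ← emit (.init (.bitvec w) x c)
        return (v, x)) 4 (fun p => [(p.1, .bitvec w), (p.2, .bitvec w)])
        (fun p => {(p.2, .bitvec w)} + P) (fun _ => True) := by
    refine Typed.emit_bind rfl (by trivial) (List.nil_subset _) hw1 fun v =>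
      Typed.emit_bind rfl (by trivial) (List.nil_subset _) hw1 fun c => Typed.state_init_bind
        (k := 0) (by simp) hw1 fun x => Typed.pure (by simp) (Multiset.singleton_add _ _) trivial
  have hlen : (do let a ← List.range (R.machine.bytes - 1); pure (a : ℤ)).length =
      R.machine.bytes - 1 := by simp
  -- The lines of the header in the order in which they are emitted.
  refine Typed.le ?_ (k := 4 +
    ((do let a ← List.range (R.machine.bytes - 1); pure (a : ℤ)).length * 1 + (7 + (2 + (1 +
    ((List.range (R.machine.bytes - 1)).length * 2 + (1 + ((List.finRange 32).length * 3 +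
    ((List.range R.code.length).length * 2 + ((R.addresses h s).length * 4 + 0)))))))))) (by
      rw [hlen, List.length_range, List.length_range, List.length_finRange]
      omega)
  have h4 (k : ℕ) : 4 + k = 1 + (1 + (1 + (1 + k))) := by omega
  have h7 (k : ℕ) : 7 + k = 1 + (1 + (1 + (1 + (1 + (1 + (1 + k)))))) := by omega
  rw [h4, h7]
  refine Typed.emit_bind rfl (by trivial) (List.nil_subset _) h11 fun ff => ?_
  refine Typed.emit_bind rfl (by trivial) (List.nil_subset _) h11 fun tt => ?_
  refine Typed.emit_bind rfl (by trivial) (List.nil_subset _) hw1 fun zero' => ?_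
  refine Typed.emit_bind rfl (by trivial) (List.nil_subset _) hw1 fun one => ?_
  refine Typed.mapM_bind (s := .bitvec w) (fun k _ P => Typed.emit_last rfl (by trivial)
    (List.nil_subset _) hw1 fun _ => ⟨by simp, rfl, trivial⟩) fun counts hcounts => ?_
  rw [hlen] at hcounts
  refine Typed.emit_bind rfl (by trivial) (List.nil_subset _) hw1 fun dataStart => ?_
  refine Typed.emit_bind rfl (by trivial) (List.nil_subset _) hw1 fun dataEnd => ?_
  refine Typed.emit_bind rfl (by trivial) (List.nil_subset _) hw1 fun heapStart => ?_
  refine Typed.emit_bind rfl (by trivial) (List.nil_subset _) hw1 fun heapEnd => ?_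
  refine Typed.emit_bind rfl (by trivial) (List.nil_subset _) hw1 fun allowedHeapEnd => ?_
  refine Typed.emit_bind rfl (by trivial) (List.nil_subset _) hw1 fun allowedStackStart => ?_
  refine Typed.emit_bind rfl (by trivial) (List.nil_subset _) hw1 fun highest => ?_
  refine Typed.state_init_bind (by simp) h11 fun kernel => ?_
  refine Typed.emit_bind rfl (by trivial) (by simp [Line.operands]) h11 fun user => ?_
  refine Typed.mapM_bind (s := .bitvec w) (fun k hk P => ?_) fun inputs hinputs => ?_
  · have hk' := List.mem_range.mp hk
    refine Typed.emit_bind (v := 8 * (k + 1)) rfl (by trivial) (List.nil_subset _) (by omega)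
      fun x => Typed.emit_last (v := w) ?_ (by trivial) (by simp [Line.operands]) hw1
      fun _ => ⟨by simp, rfl, trivial⟩
    exact congrArg (fun v => some (Srt.bitvec v)) (by omega)
  refine Typed.emit_bind rfl (by trivial) (List.nil_subset _) hw1 fun wordInput => ?_
  refine Typed.bind (Typed.mapM fun r _ P => reg_step _ r P) fun regs hregs => ?_
  refine Typed.bind (Typed.mapM fun i _ P => flag_step tt ff _ (by simp) (by simp) i P)
    fun flags hflags => ?_
  refine Typed.bind (Typed.mapM fun a _ P => ram_step _ a P) fun ram hram => ?_
  rw [List.length_range] at hinputs hflags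
  rw [List.length_finRange] at hregs
  have hmem (j : ℕ) (hj : j < counts.length) : counts.getD j 0 ∈ counts := by
    rw [List.getD_eq_getElem _ _ hj]
    exact List.getElem_mem hj
  have h3 := hmem (R.machine.bytes - 3) (by omega)
  have h2 := hmem (R.machine.bytes - 2) (by omega)
  refine Typed.pure ?_ ?_ ⟨hw.symm, hcounts.trans_le (by omega), by simp, hregs, hflags, hram⟩
  · simp only [Header.facts, ← List.map_eq_flatMap]
    generalize counts.getD (R.machine.bytes - 3) 0 = mask at *
    generalize counts.getD (R.machine.bytes - 2) 0 = bytes at *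
    have h3' := List.mem_map_of_mem (f := fun a => (a, Srt.bitvec w)) h3
    have h2' := List.mem_map_of_mem (f := fun a => (a, Srt.bitvec w)) h2
    simp only [List.map_append, List.map_cons, List.map_nil, List.append_subset, List.cons_subset,
      List.nil_subset, List.mem_append, List.mem_cons, true_or, or_true, and_true, true_and, h3',
      h2']
    refine ⟨⟨⟨⟨?_, ?_⟩, ?_⟩, ?_⟩, ?_⟩ <;> intro p hp <;>
      simp only [List.mem_append, List.mem_cons, hp, true_or, or_true]
  · have e1 := zip_map_eq_map_getD (L := List.finRange 32) (as := regs) (f := fun r => r.val)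
      (by simpa using hregs) (by simp) fun r x =>
        if r = regZero then (0 : Multiset (Nid × Srt)) else {(x, .bitvec w)}
    have e2 := zip_map_eq_map_getD (L := List.range R.code.length) (as := flags) (f := id)
      (by simpa using hflags) (by simp) fun _ x => ({(x, .bitvec 1)} : Multiset (Nid × Srt))
    have e3 : ((R.addresses h s).zip ram).map
        (fun p => ({(p.2.2, .bitvec w)} : Multiset (Nid × Srt))) =
          ram.map fun p => ({(p.2, .bitvec w)} : Multiset (Nid × Srt)) := by
      refine List.ext_getElem (by simp [hram]) fun j h1 h2 => by simp
    rw [e1, e2, e3]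
    simp only [Header.pending, Header.flag, Header.reg, id_eq, ← Multiset.singleton_add]
    abel

/-! ### The model -/

/-- Each edge flows into at most one instruction. -/
theorem sum_countP_le (c : ℤ) (n : ℕ) (l : List (ℤ × Edge)) :
    ((List.range n).map fun i : ℕ => l.countP fun e => decide (e.1 = c + 4 * i)).sum ≤
      l.length := by
  change ∑ i ∈ Finset.range n, l.countP (fun e => decide (e.1 = c + 4 * (i : ℤ))) ≤ l.length
  induction l with
  | nil => simp
  | cons e l ih =>
    simp only [List.countP_cons, Finset.sum_add_distrib, List.length_cons, decide_eq_true_eq]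
    refine Nat.add_le_add ih ?_
    rw [Finset.sum_boole, Nat.cast_id, Finset.card_le_one]
    intro i hi j hj
    rw [Finset.mem_filter] at hi hj
    omega

theorem Control.OK.mono {n w : ℕ} {Γ Γ' : Facts} {K : Control} (h : K.OK n w Γ) (hΓ : Γ ⊆ Γ') :
    K.OK n w Γ' := by
  refine ⟨fun e he => ?_, h.returns⟩
  have := h.edges e he
  cases he' : e.2 <;> rw [he'] at this
  · exact this
  · exact ⟨this.1, hΓ this.2⟩
  · exact hΓ this
  · exact this

/-- No state variable lacks its `next` line in the end. There are at most two edges of control flow for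
an instruction, each with at most six lines, and at most `4 + 3 * m` lines for its data flow, with
`m` words of memory; the remaining lines are proportional to the sizes of code and memory. -/
theorem emitModel_typed (R : Binary) (h s : ℕ) :
    Typed R.machine.bits [] 0 (emitModel R h s)
      (400 * (((R.addresses h s).length + 1) * (R.code.length + 1))) (fun _ => []) (fun _ => 0)
      (fun _ => True) := by
  have hsub (A B C : Facts) : A ⊆ A ++ B ++ C ∧ B ⊆ A ++ B ++ C ∧ C ⊆ A ++ B ++ C := by
    refine ⟨fun p hp => ?_, fun p hp => ?_, fun p hp => ?_⟩ <;> simp [hp]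
  unfold emitModel
  dsimp only
  generalize hm : (R.addresses h s).length = m
  refine Typed.le (Typed.bind (k₂ := R.code.length * (4 + 3 * m) + ((100 + 3 * m) +
      (13 * R.code.length + (32 + (m + (30 + 30)))))) (emitHeader_typed R h s) fun H hH => ?_) ?_
  · have hH₀ : HeaderOK R.code.length (H.facts ++ []) H :=
      hH.headerOK (List.subset_append_left _ _)
    rw [← hm, ← hH.w, ← hH.ram]
    have hF₀ : FlowOK H.w (H.facts ++ [])
        { reg := H.reg, ram := H.ram.map Prod.snd, division := H.one, remainder := H.one,
          access := H.dataStart, ecall := H.ff } := by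
      refine ⟨hH₀.reg, fun x hx => ?_, hH₀.one, hH₀.one, hH₀.dataStart, hH₀.ff⟩
      obtain ⟨p, hp, rfl⟩ := List.mem_map.mp hx
      exact (hH₀.ram p hp).2
    refine Typed.bind (emitAllDataFlow_typed R (by omega) hH₀ hF₀ (List.length_map ..))
      fun r hr => ?_
    have hs₁ := hsub (r.1.facts H.w) ((R.code.zip r.2).flatMap fun p => p.1.facts H.w p.2)
      (H.facts ++ [])
    have hH₁ := hH₀.mono hs₁.2.2
    have hF₁ : FlowOK H.w _ r.1 := Flow.facts_subset_iff.mp hs₁.1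
    have hK₁ := Control.OK.addAll
      (K := { edges := [], a7 := 0, callee := R.codeStart, returns := [] })
      (n := R.code.length) (w := H.w) ⟨by simp, by simp⟩ R (i := 0) (as := R.code.zip r.2)
      (by rw [List.length_zip]; omega) hs₁.2.1
    generalize Control.addAll R 0 (R.code.zip r.2) _ = K at *
    obtain ⟨hK₁, hKl⟩ := hK₁
    refine Typed.bind (emitSyscalls_typed hH₁ hF₁) fun a ha => ?_
    have hs₂ := hsub (a.1.facts H.w) (a.2.facts H.w)
      (r.1.facts H.w ++ ((R.code.zip r.2).flatMap fun p => p.1.facts H.w p.2) ++ (H.facts ++ []))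
    have hH₂ := hH₁.mono hs₂.2.2
    have hF₂ : FlowOK H.w _ a.1 := Flow.facts_subset_iff.mp hs₂.1
    have hS₂ := hs₂.2.1
    have hK₂ : K.OK R.code.length H.w _ := hK₁.mono hs₂.2.2
    generalize a.1.facts H.w ++ a.2.facts H.w ++
      (r.1.facts H.w ++ ((R.code.zip r.2).flatMap fun p => p.1.facts H.w p.2) ++
        (H.facts ++ [])) = Γ at *
    have hflags : ((List.range R.code.length).map fun i : ℕ =>
        K.edges.countP (fun e => decide (e.1 = (R.codeStart : ℤ) + 4 * i)) * 6 + 1).sum ≤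
          13 * R.code.length := by
      have := sum_countP_le R.codeStart R.code.length K.edges
      rw [List.length_zip] at hKl
      rw [List.sum_map_add, List.sum_map_mul_right]
      simp
      simp at hKl
      omega
    refine Typed.bind ((Typed.forM fun i _ P => ?_).le hflags) fun _ _ => ?_
    · exact emitControlFlow_typed R hH₂ hK₂
    refine Typed.bind ((Typed.forM (c := fun _ => 1) fun r _ P => ?_).le (by simp)) fun _ _ => ?_
    · split
      · exact Typed.le (Typed.pure (List.nil_subset _) (zero_add _).symm trivial) (Nat.zero_le _)
      · exact Typed.next_bind (k := 0) (hF₂.reg r) fun _ =>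
          Typed.pure (List.nil_subset _) rfl trivial
    have hl : a.1.ram.length = H.ram.length := by rw [ha.1, hr, min_self]
    have hzip : ((H.ram.zip a.1.ram).map fun p => ({(p.1.2, .bitvec H.w)} : Multiset (Nid × Srt))) =
        H.ram.map fun p => {(p.2, .bitvec H.w)} :=
      List.ext_getElem (by simp [hl]) fun j h1 h2 => by simp
    rw [← hzip, ← add_zero (List.sum _)]
    refine Typed.bind ((Typed.forM (c := fun _ => 1) fun p hp P => ?_).le (by simp)) fun _ _ => ?_
    · exact Typed.next_bind (k := 0) (hF₂.ram _ (List.of_mem_zip hp).2) fun _ =>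
        Typed.pure (List.nil_subset _) rfl trivial
    exact Typed.bind (emitChecks_typed hH₂ hF₂ hS₂ ha.2) fun _ _ => emitSegfaults_typed hH₂ hF₂ hS₂
  · rw [hm]
    nlinarith

theorem Inv.nil (w : ℕ) : Inv w [] 0 :=
  ⟨by simp, by simp, by simp, by simp⟩

theorem addresses_length (R : Binary) (h s : ℕ) : (R.addresses h s).length = R.memoryWords h s := by
  simp only [Binary.addresses, Binary.memoryWords, List.length_append, List.length_map,
    List.length_range]
  omega

/-- All state variables of the models of BEATOR have their `next` lines. -/
theorem inv_beator (R : Binary) (h s : ℕ) : Inv R.machine.bits (beator R h s) 0 ∧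
    (beator R h s).length ≤ 400 * ((R.memoryWords h s + 1) * (R.code.length + 1)) := by
  obtain ⟨_, B, hB, hl, hi, -⟩ := emitModel_typed R h s [] (Inv.nil _) (by simp [Known])
  have he : beator R h s = B := by rw [beator, StateT.run, hB, List.nil_append]
  rw [he, ← addresses_length]
  exact ⟨hi, hl⟩

theorem beator_wf (R : Binary) (h s : ℕ) : (beator R h s).WF := (inv_beator R h s).1.wf

/-- The constant is `2000 * 401`, from `qubotTime_le` and `inv_beator`. -/
theorem qubotTime_beator_le (R : Binary) (h s n : ℕ) : qubotTime (beator R h s) n ≤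
    802000 * (n + 1) * (R.memoryWords h s + 1) * R.machine.bits ^ 2 * (R.code.length + 1) := by
  obtain ⟨hi, hl⟩ := inv_beator R h s
  have hm := hi.memorySize_le
  have hw := hi.wordSize_le R.machine.bits_pos
  have hpos : 1 ≤ (R.memoryWords h s + 1) * (R.code.length + 1) := Nat.mul_pos (by simp) (by simp)
  calc qubotTime (beator R h s) n
      ≤ 2000 * (n + 1) * (beator R h s).unit * ((beator R h s).length + 1) :=
        qubotTime_le (beator_wf R h s) n
    _ ≤ 2000 * (n + 1) * (1 * R.machine.bits ^ 2) *
        (401 * ((R.memoryWords h s + 1) * (R.code.length + 1))) := by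
        refine Nat.mul_le_mul (Nat.mul_le_mul_left _ ?_) (by omega)
        exact Nat.mul_le_mul hm (Nat.pow_le_pow_left hw 2)
    _ = _ := by ring

/-- The size of memory is proportional to `n + 1` if it grows by at most `a` words per transition. -/
theorem qubotTime_le_sq (R : Binary) (a : ℕ) : ∃ C : ℕ, ∀ n h s : ℕ, h + s ≤ a * (n + 1) →
    qubotTime (beator R h s) n ≤ C * (n + 1) ^ 2 := by
  refine ⟨802000 * (R.memoryWords 0 0 + 1 + a) * R.machine.bits ^ 2 * (R.code.length + 1),
    fun n h s hs => (qubotTime_beator_le R h s n).trans ?_⟩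
  have hm : R.memoryWords h s + 1 ≤ (R.memoryWords 0 0 + 1 + a) * (n + 1) := by
    simp only [Binary.memoryWords]
    nlinarith
  calc _ ≤ 802000 * (n + 1) * ((R.memoryWords 0 0 + 1 + a) * (n + 1)) * R.machine.bits ^ 2 *
        (R.code.length + 1) := by gcongr
    _ = _ := by ring

end QA

theorem mainTheorem1 :
    -- the models of BEATOR, for every RISC-U binary and every allowance of memory
    (∀ (R : QA.Binary) (h s : ℕ), (QA.beator R h s).WF ∧
      ∀ (n : ℕ) (I : QA.Input),
        (QA.beator R h s).BadReachable n I ↔ (QA.qubot (QA.beator R h s) n).EvaluatesTo I 0) ∧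
    -- all models
    (∀ B : QA.Model, B.WF → ∀ n : ℕ,
      (QA.qubot B n).UpperTriangular ∧
      (∀ x : ℕ → Bool, 0 ≤ (QA.qubot B n).value x) ∧
      (∀ I : QA.Input,
        (∃ e : ℤ, (QA.qubot B n).EvaluatesTo I e ∧ 0 ≤ e) ∧
        (B.BadReachable n I ↔ (QA.qubot B n).EvaluatesTo I 0)) ∧
      ((∃ I : QA.Input, B.BadReachable n I) ↔ ∃ x : ℕ → Bool, (QA.qubot B n).value x = 0)) ∧
    -- time and space for all models
    (∃ C : ℕ, ∀ B : QA.Model, B.WF → ∀ n : ℕ,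
      QA.qubotTime B n ≤ C * (n + 1) * B.memorySize * B.wordSize ^ 2 * (B.length + 1) ∧
      (QA.qubot B n).size ≤ C * (n + 1) * B.memorySize * B.wordSize ^ 2 * (B.length + 1)) ∧
    -- time and space for the models of BEATOR, in terms of the sizes of code and memory
    (∃ C : ℕ, ∀ (R : QA.Binary) (h s n : ℕ),
      QA.qubotTime (QA.beator R h s) n ≤
        C * (n + 1) * (R.memoryWords h s + 1) * R.machine.bits ^ 2 * (R.code.length + 1) ∧
      (QA.qubot (QA.beator R h s) n).size ≤
        C * (n + 1) * (R.memoryWords h s + 1) * R.machine.bits ^ 2 * (R.code.length + 1)) ∧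
    -- quadratic time and space if memory grows by a bounded number of words per state transition
    (∀ (R : QA.Binary) (a : ℕ), ∃ C : ℕ, ∀ n h s : ℕ, h + s ≤ a * (n + 1) →
      QA.qubotTime (QA.beator R h s) n ≤ C * (n + 1) ^ 2 ∧
      (QA.qubot (QA.beator R h s) n).size ≤ C * (n + 1) ^ 2) := by
  refine ⟨fun R h s =>
      ⟨QA.beator_wf R h s, QA.badReachable_iff_evaluatesTo_zero (QA.beator_wf R h s)⟩,
    fun B hB n => ⟨QA.qubot_upperTriangular hB n, QA.qubot_value_nonneg hB n, fun I =>
      ⟨QA.exists_evaluatesTo hB n I, QA.badReachable_iff_evaluatesTo_zero hB n I⟩,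
      QA.exists_badReachable_iff hB n⟩,
    ⟨2000, fun B hB n => ?_⟩, ⟨802000, fun R h s n => ?_⟩, fun R a => ?_⟩
  · have hle := QA.qubotTime_le hB n
    rw [QA.Model.unit, ← Nat.mul_assoc (2000 * (n + 1))] at hle
    exact ⟨hle, (QA.qubot_size_le_qubotTime hB n).trans hle⟩
  · have hle := QA.qubotTime_beator_le R h s n
    exact ⟨hle, (QA.qubot_size_le_qubotTime (QA.beator_wf R h s) n).trans hle⟩
  · obtain ⟨C, hC⟩ := QA.qubotTime_le_sq R a
    exact ⟨C, fun n h s hs => ⟨hC n h s hs,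
      (QA.qubot_size_le_qubotTime (QA.beator_wf R h s) n).trans (hC n h s hs)⟩⟩
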